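/- Let $m_1,m_2$ be nonnegative integers, $m=m_1+m_2$, and $0<l<\infty$. Let $v$ be a measurable $m_1\times m_2$ complex matrix function which is bounded on $(0,l)$, and put \[ j=\begin{bmatrix} I_{m_1}&0\\0&-I_{m_2}\end{bmatrix},\qquad V=\begin{bmatrix}0&v\\v^*&0\end{bmatrix}. \] For $z\in\mathbb C$ let $u(x,z)$ be the fundamental solution on $[0,l]$ of the skew-self-adjoint Dirac system $u'(x,z)=(izj+jV(x))u(x,z)$, $u(0,z)=I_m$ (absolutely continuous solution, equation holding a.e.). Set \[ \gamma(x)=\begin{bmatrix}0&I_{m_2}\end{bmatrix}u(x,0)=\begin{bmatrix}\gamma_1(x)&\gamma_2(x)\end{bmatrix}, \] where $\gamma_1,\gamma_2$ have $m_1$ and $m_2$ columns. In $L^2_{m_2}(0,l)$ consider the operators $A=-i\int_0^x\cdot\,dt$ and $K=-i\gamma(x)\int_0^x\gamma(t)^*\cdot\,dt$. A bounded operator $E$ with bounded inverse is called a (normalized) similarity operator for $\gamma$ if * $K=EAE^{-1}$; * $(Ef)(x)=\rho(x)f(x)+\int_0^xE(x,t)f(t)\,dt$ with a bounded measurable kernel,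 where $\rho$ is absolutely continuous, $\rho'=\gamma'\gamma^*\rho$ a.e. and $\det\rho(0)\neq0$, and $E^{-1}$ is likewise of triangular form, with diagonal term $\rho^{-1}$ and a bounded measurable kernel; * $E^{\pm1}$ map absolutely continuous functions with bounded derivative on $[0,l]$ into such functions; * $E^{-1}\gamma_2\equiv I_{m_2}$ (with $E^{-1}$ applied columnwise). Given such an $E$, define $S=E^{-1}(E^*)^{-1}$ and $\Pi=\begin{bmatrix}\Phi_1&\Phi_2\end{bmatrix}:\mathbb C^m\to L^2_{m_2}(0,l)$ by $\Phi_1g=(E^{-1}\gamma_1)(x)g$ and $\Phi_2g\equiv g$. For $0\le r\le l$ let $P_r$ be the restriction (orthoprojection) of $L^2_{m_2}(0,l)$ onto $L^2_{m_2}(0,r)$, let $A_r=P_rAP_r^*$, $S_r=P_rSP_r^*$, and let \[ w_A(r,z)=I_m-iz\,\Pi^*P_r^*S_r^{-1}(I-zA_r)^{-1}P_r\Pi . \] Then a normalized similarity operator $E$ for $\gamma$ exists, and for every such $E$ the following holds. 1. $A,S,\Pi$ form an $S$-node: $AS-SA^*=-i\,\Pi\Pi^*$. 2. For all $r\in[0,l]$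 and $z\in\mathbb C$ the operators $S_r$ and $I-zA_r$ are boundedly invertible, so that $w_A(r,z)$ is well defined. 3. For every $z\in\mathbb C$ the function $w(x,z)=w_A(x,z)$ is the fundamental solution on $[0,l]$ of $w'(x,z)=-iz\,\gamma(x)^*\gamma(x)\,w(x,z)$, $w(0,z)=I_m$. 4. For all $x\in[0,l]$ and $z\in\mathbb C$, \[ u(x,z)=e^{ixz}\,u(x,0)\,w(x,2z). \] -/

import Mathlib

open MeasureTheory Set Matrix
open scoped Matrix.Norms.L2Operator ENNReal InnerProduct

noncomputable section

namespace SkewDirac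

/-- Lebesgue measure on the interval `(0, r)`. -/
abbrev vol (r : ℝ) : Measure ℝ := volume.restrict (Ioo 0 r)

/-- The Hilbert space `L²_n(0, r)` of square integrable `ℂⁿ`-valued functions. -/
abbrev L2 (n : ℕ) (r : ℝ) : Type := Lp (EuclideanSpace ℂ (Fin n)) 2 (vol r)

/-- `U` is an absolutely continuous solution on `[0, l]` of `U' = C(x) U` (a.e.). -/
structure IsSolution {n p : Type*} [Fintype n] (l : ℝ)
    (C : ℝ → Matrix n n ℂ) (U : ℝ → Matrix n p ℂ) : Prop where
  ac : ∀ i j, AbsolutelyContinuousOnInterval (fun x => U x i j) 0 l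
  eqn : ∀ᵐ x ∂(vol l), ∀ i j, HasDerivAt (fun s => U s i j) ((C x * U x) i j) x

/-- The fundamental solution: the square solution normalized by `U(0) = I`. -/
structure IsFundamentalSolution {n : Type*} [Fintype n] [DecidableEq n] (l : ℝ)
    (C : ℝ → Matrix n n ℂ) (U : ℝ → Matrix n n ℂ) : Prop extends IsSolution l C U where
  init : U 0 = 1

/-- The coefficient `i z j + j V` of the skew-self-adjoint Dirac system,
`j = diag (I, -I)`, `V = [0 v; v* 0]`. -/
def diracCoeff {m₁ m₂ : ℕ} (v : Matrix (Fin m₁) (Fin m₂) ℂ) (z : ℂ) :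
    Matrix (Fin m₁ ⊕ Fin m₂) (Fin m₁ ⊕ Fin m₂) ℂ :=
  (Complex.I * z) • fromBlocks 1 0 0 (-1) + fromBlocks 1 0 0 (-1) * fromBlocks 0 v vᴴ 0

/-- Boundedly differentiable functions on `[0, l]`: absolutely continuous functions whose
derivative is essentially bounded. -/
def MemB1 {n : ℕ} (l : ℝ) (f : ℝ → EuclideanSpace ℂ (Fin n)) : Prop :=
  AbsolutelyContinuousOnInterval f 0 l ∧ ∃ C : ℝ, ∀ᵐ x ∂(vol l), ‖deriv f x‖ ≤ C

open Classical in
/-- The class in `L²_n(0, l)` of a square integrable function (and `0` for other functions). -/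
def toL2 {n : ℕ} (l : ℝ) (f : ℝ → EuclideanSpace ℂ (Fin n)) : L2 n l :=
  if h : MemLp f 2 (vol l) then h.toLp f else 0

/-- The `j`-th column of a matrix function, as a function with values in `ℂⁿ`. -/
def col {n : ℕ} {p : Type*} (θ : ℝ → Matrix (Fin n) p ℂ) (j : p) :
    ℝ → EuclideanSpace ℂ (Fin n) :=
  fun x => WithLp.toLp 2 (fun i => θ x i j)

/-- The operator `g ↦ ∑ j, g j • c j`, given by its columns `c j ∈ L²_n(0, l)`. -/
def ofCols {n : ℕ} {p : Type*} [Fintype p] {l : ℝ} (c : p → L2 n l) :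
    EuclideanSpace ℂ p →L[ℂ] L2 n l :=
  ∑ j, (EuclideanSpace.proj j : EuclideanSpace ℂ p →L[ℂ] ℂ).smulRight (c j)

/-! ### The operator of integration and the restriction operators -/

lemma integrableOn_coe {n : ℕ} {l : ℝ} (f : L2 n l) :
    IntegrableOn (fun x => f x) (Ioo 0 l) volume :=
  (Lp.memLp f).integrable (by norm_num)

lemma intervalIntegrable_coe {n : ℕ} {l x : ℝ} (f : L2 n l) (hx : x ∈ Ioo 0 l) :
    IntervalIntegrable (fun t => f t) volume 0 x := by
  rw [intervalIntegrable_iff_integrableOn_Ioo_of_le hx.1.le]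
  exact (integrableOn_coe f).mono_set (Ioo_subset_Ioo_right hx.2.le)

/-- The bound used for the operator of integration. -/
lemma norm_primitive_le {n : ℕ} {l x : ℝ} (f : L2 n l) (hx : x ∈ Ioo 0 l) :
    ‖(-Complex.I) • ∫ t in (0 : ℝ)..x, f t‖
      ≤ ((vol l univ) ^ (1 / (1 : ℝ≥0∞).toReal - 1 / (2 : ℝ≥0∞).toReal)).toReal * ‖f‖ := by
  have h1 : ‖(-Complex.I) • ∫ t in (0 : ℝ)..x, f t‖ ≤ ∫ t, ‖f t‖ ∂(vol l) := by
    rw [norm_smul, norm_neg, Complex.norm_I, one_mul]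
    refine (intervalIntegral.norm_integral_le_integral_norm hx.1.le).trans ?_
    rw [intervalIntegral.integral_of_le hx.1.le, integral_Ioc_eq_integral_Ioo]
    exact setIntegral_mono_set (integrableOn_coe f).norm
      (Filter.Eventually.of_forall fun t => norm_nonneg _)
      (Ioo_subset_Ioo_right hx.2.le).eventuallyLE
  refine h1.trans ?_
  rw [integral_norm_eq_lintegral_enorm (Lp.aestronglyMeasurable f), ← eLpNorm_one_eq_lintegral_enorm]
  have h2 := eLpNorm_le_eLpNorm_mul_rpow_measure_univ (μ := vol l) (p := 1) (q := 2)
    (by norm_num) (Lp.aestronglyMeasurable f)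
  have hfin : (vol l univ) ^ (1 / (1 : ℝ≥0∞).toReal - 1 / (2 : ℝ≥0∞).toReal) ≠ ⊤ :=
    ENNReal.rpow_ne_top_of_nonneg (by norm_num) (measure_ne_top _ _)
  have h3 := ENNReal.toReal_mono (ENNReal.mul_ne_top (Lp.eLpNorm_ne_top f) hfin) h2
  rw [ENNReal.toReal_mul] at h3
  rw [Lp.norm_def, mul_comm]
  exact h3

lemma memLp_primitive {n : ℕ} {l : ℝ} (f : L2 n l) :
    MemLp (fun x => (-Complex.I) • ∫ t in (0 : ℝ)..x, f t) 2 (vol l) := by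
  have hc : ContinuousOn (fun x => (-Complex.I) • ∫ t in (0 : ℝ)..x, f t) (Ioo 0 l) := by
    suffices h : ContinuousOn (fun x => ∫ t in (0 : ℝ)..x, f t) (Ioo 0 l) from
      h.const_smul (-Complex.I)
    rcases le_or_gt l 0 with hl | hl
    · intro x hx; exact absurd (hx.1.trans hx.2) (not_lt.mpr hl)
    · have h := intervalIntegral.continuousOn_primitive_interval (μ := volume) (a := 0) (b := l)
        (f := fun t => f t)
        (by rw [uIcc_of_le hl.le, integrableOn_Icc_iff_integrableOn_Ioo]; exact integrableOn_coe f)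
      rw [uIcc_of_le hl.le] at h
      exact h.mono Ioo_subset_Icc_self
  refine MemLp.of_bound (hc.aestronglyMeasurable measurableSet_Ioo)
    (((vol l univ) ^ (1 / (1 : ℝ≥0∞).toReal - 1 / (2 : ℝ≥0∞).toReal)).toReal * ‖f‖) ?_
  · filter_upwards [ae_restrict_mem measurableSet_Ioo] with x hx
    exact norm_primitive_le f hx

/-- The operator `A = -i ∫₀ˣ · dt` on `L²_n(0, l)`. -/
def opA (n : ℕ) (l : ℝ) : L2 n l →L[ℂ] L2 n l :=
  LinearMap.mkContinuousOfExistsBound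
    { toFun := fun f => (memLp_primitive f).toLp _
      map_add' := by
        intro f g
        rw [← MemLp.toLp_add, MemLp.toLp_eq_toLp_iff]
        filter_upwards [ae_restrict_mem measurableSet_Ioo] with x hx
        have h : ∫ t in (0 : ℝ)..x, (f + g) t = ∫ t in (0 : ℝ)..x, (f t + g t) := by
          rw [intervalIntegral.integral_of_le hx.1.le, intervalIntegral.integral_of_le hx.1.le,
            integral_Ioc_eq_integral_Ioo, integral_Ioc_eq_integral_Ioo]
          exact integral_congr_ae
            (ae_restrict_of_ae_restrict_of_subset (Ioo_subset_Ioo_right hx.2.le)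
              (Lp.coeFn_add f g))
        simp only [Pi.add_apply]
        rw [h, intervalIntegral.integral_add (intervalIntegrable_coe f hx)
          (intervalIntegrable_coe g hx), smul_add]
      map_smul' := by
        intro c f
        simp only [RingHom.id_apply]
        rw [← MemLp.toLp_const_smul, MemLp.toLp_eq_toLp_iff]
        filter_upwards [ae_restrict_mem measurableSet_Ioo] with x hx
        have h : ∫ t in (0 : ℝ)..x, (c • f) t = ∫ t in (0 : ℝ)..x, c • f t := by
          rw [intervalIntegral.integral_of_le hx.1.le, intervalIntegral.integral_of_le hx.1.le,
            integral_Ioc_eq_integral_Ioo, integral_Ioc_eq_integral_Ioo]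
          exact integral_congr_ae
            (ae_restrict_of_ae_restrict_of_subset (Ioo_subset_Ioo_right hx.2.le)
              (Lp.coeFn_smul c f))
        simp only [Pi.smul_apply]
        rw [h, intervalIntegral.integral_smul, smul_comm] }
    (by
      refine ⟨measureUnivNNReal (vol l) ^ (2 : ℝ≥0∞).toReal⁻¹ *
        ((vol l univ) ^ (1 / (1 : ℝ≥0∞).toReal - 1 / (2 : ℝ≥0∞).toReal)).toReal, fun f => ?_⟩
      rw [mul_assoc]
      refine Lp.norm_le_of_ae_bound (by positivity) ?_
      filter_upwards [ae_restrict_mem measurableSet_Ioo, (memLp_primitive f).coeFn_toLp]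
        with x hx hfx
      simp only [LinearMap.coe_mk, AddHom.coe_mk]
      rw [hfx]
      exact norm_primitive_le f hx)

lemma memLp_cut {n : ℕ} {l : ℝ} (r : ℝ) (f : L2 n l) :
    MemLp ((Ioo 0 l).indicator (fun x => f x)) 2 (vol r) :=
  ((memLp_indicator_iff_restrict measurableSet_Ioo).mpr (Lp.memLp f)).restrict _

lemma indicator_congr_vol {n : ℕ} {l : ℝ} (r : ℝ) {f g : ℝ → EuclideanSpace ℂ (Fin n)}
    (h : f =ᵐ[vol l] g) : (Ioo 0 l).indicator f =ᵐ[vol r] (Ioo 0 l).indicator g := by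
  refine ae_restrict_of_ae ?_
  have h' := (ae_restrict_iff' measurableSet_Ioo).mp h
  filter_upwards [h'] with x hx
  by_cases hm : x ∈ Ioo 0 l
  · simp [hm, hx hm]
  · simp [hm]

/-- The operator `P_r` from `L²_n(0, l)` to `L²_n(0, r)`, `(P_r f)(x) = f(x)` for `0 < x < r`
(here `r ≤ l`, so that the indicator function is `1` on `(0, r)`). -/
def opP (n : ℕ) (l r : ℝ) : L2 n l →L[ℂ] L2 n r :=
  LinearMap.mkContinuous
    { toFun := fun f => (memLp_cut r f).toLp _
      map_add' := by
        intro f g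
        rw [← MemLp.toLp_add, MemLp.toLp_eq_toLp_iff]
        refine (indicator_congr_vol r (Lp.coeFn_add f g)).trans ?_
        rw [← indicator_add']
      map_smul' := by
        intro c f
        simp only [RingHom.id_apply]
        rw [← MemLp.toLp_const_smul, MemLp.toLp_eq_toLp_iff]
        refine (indicator_congr_vol r (Lp.coeFn_smul c f)).trans ?_
        refine Filter.Eventually.of_forall fun x => ?_
        by_cases hm : x ∈ Ioo 0 l
        · simp [hm]
        · simp [hm] }
    1 (by
      intro f
      simp only [LinearMap.coe_mk, AddHom.coe_mk, one_mul]
      rw [Lp.norm_toLp, Lp.norm_def]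
      refine ENNReal.toReal_mono (Lp.eLpNorm_ne_top f) ?_
      refine (eLpNorm_restrict_le _ _ _ _).trans ?_
      rw [eLpNorm_indicator_eq_eLpNorm_restrict measurableSet_Ioo])

/-! ### Triangular operators and the similarity operator -/

/-- `(T f)(x) = ρ(x) f(x) + ∫₀ˣ k(x,t) f(t) dt` for all `f`, a.e. on `(0, l)`. -/
def IsTriangular {n : ℕ} {l : ℝ} (T : L2 n l →L[ℂ] L2 n l)
    (ρ : ℝ → Matrix (Fin n) (Fin n) ℂ) (k : ℝ → ℝ → Matrix (Fin n) (Fin n) ℂ) : Prop :=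
  ∀ f : L2 n l, ∀ᵐ x ∂(vol l),
    T f x = toEuclideanCLM (𝕜 := ℂ) (ρ x) (f x)
      + ∫ t in (0 : ℝ)..x, toEuclideanCLM (𝕜 := ℂ) (k x t) (f t)

/-- Measurable kernels which are bounded on the triangle `0 < t < x < l`. -/
def IsBoundedKernel {n : ℕ} (l : ℝ) (k : ℝ → ℝ → Matrix (Fin n) (Fin n) ℂ) : Prop :=
  (∀ i j, Measurable fun p : ℝ × ℝ => k p.1 p.2 i j) ∧
    ∃ C : ℝ, ∀ x t, 0 < t → t < x → x < l → ‖k x t‖ ≤ C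

/-- The entrywise derivative of a matrix function. -/
def mderiv {n p : Type*} (θ : ℝ → Matrix n p ℂ) (x : ℝ) : Matrix n p ℂ :=
  Matrix.of fun i j => deriv (fun s => θ s i j) x

/-- `E` is a similarity operator for `γ = [γ₁ γ₂]`, normalized by `E⁻¹ γ₂ = I`. With `F = γ`
and `G = -i γ*`, it transforms `A` into the operator `K = ∫₀ˣ F(x) G(t) · dt`. -/
structure IsSimilarityOperator {m₁ m₂ : ℕ} (l : ℝ)
    (γ : ℝ → Matrix (Fin m₂) (Fin m₁ ⊕ Fin m₂) ℂ) (E : L2 m₂ l ≃L[ℂ] L2 m₂ l) : Prop where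
  /-- `E A E⁻¹ = K`. -/
  similar : IsTriangular ((E : L2 m₂ l →L[ℂ] L2 m₂ l) ∘L opA m₂ l ∘L
      (E.symm : L2 m₂ l →L[ℂ] L2 m₂ l)) (fun _ => 0)
      (fun x t => γ x * ((-Complex.I) • (γ t)ᴴ))
  /-- `E` is triangular with `ρ' = i F' G ρ`, `det ρ(0) ≠ 0`, and the kernels of `E` and `E⁻¹`
  are bounded. -/
  triangular : ∃ (ρ : ℝ → Matrix (Fin m₂) (Fin m₂) ℂ)
      (k k' : ℝ → ℝ → Matrix (Fin m₂) (Fin m₂) ℂ),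
    IsSolution l (fun x => Complex.I • (mderiv γ x * ((-Complex.I) • (γ x)ᴴ))) ρ ∧
    (ρ 0).det ≠ 0 ∧
    IsBoundedKernel l k ∧ IsTriangular (E : L2 m₂ l →L[ℂ] L2 m₂ l) ρ k ∧
    IsBoundedKernel l k' ∧
      IsTriangular (E.symm : L2 m₂ l →L[ℂ] L2 m₂ l) (fun x => (ρ x)⁻¹) k'
  /-- `E` and `E⁻¹` map boundedly differentiable functions into such functions. -/
  map_B1 : ∀ f, MemB1 l f → ∃ g, MemB1 l g ∧ E (toL2 l f) = toL2 l g
  symm_map_B1 : ∀ f, MemB1 l f → ∃ g, MemB1 l g ∧ E.symm (toL2 l f) = toL2 l g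
  /-- `E⁻¹ γ₂ = I`, columnwise. -/
  normalized : ∀ j, E.symm (toL2 l (col (fun x => (γ x).toCols₂) j)) = toL2 l (col (fun _ => 1) j)

/-! ### The S-node recovered from `γ` and its transfer matrix function -/

section Node

variable {m₁ m₂ : ℕ} {l : ℝ}

/-- `S = E⁻¹ (E*)⁻¹`, where `(E*)⁻¹ = (E⁻¹)*`. -/
def opS (E : L2 m₂ l ≃L[ℂ] L2 m₂ l) : L2 m₂ l →L[ℂ] L2 m₂ l :=
  (E.symm : L2 m₂ l →L[ℂ] L2 m₂ l) ∘L
    ContinuousLinearMap.adjoint (E.symm : L2 m₂ l →L[ℂ] L2 m₂ l)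

/-- `Π = [Φ₁ Φ₂]`, `Φ₁ g = (E⁻¹ γ₁) g` with `E⁻¹` applied columnwise, `Φ₂ g ≡ g`. -/
def opPi (γ : ℝ → Matrix (Fin m₂) (Fin m₁ ⊕ Fin m₂) ℂ) (E : L2 m₂ l ≃L[ℂ] L2 m₂ l) :
    EuclideanSpace ℂ (Fin m₁ ⊕ Fin m₂) →L[ℂ] L2 m₂ l :=
  ofCols (Sum.elim
    (fun j => E.symm (toL2 l (col (fun x => (γ x).toCols₁) j)))
    (fun j => toL2 l (col (fun _ => 1) j)))

/-- `A`, `S`, `Π` form an S-node: `A S - S A* = -i Π Π*`. -/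
def IsSNode {p : Type*} [Fintype p] (A S : L2 m₂ l →L[ℂ] L2 m₂ l)
    (Pi : EuclideanSpace ℂ p →L[ℂ] L2 m₂ l) : Prop :=
  A ∘L S - S ∘L ContinuousLinearMap.adjoint A
    = (-Complex.I) • (Pi ∘L ContinuousLinearMap.adjoint Pi)

/-- The compression `T_r = P_r T P_r*` to `L²_n(0, r)`. -/
def compress (r : ℝ) (T : L2 m₂ l →L[ℂ] L2 m₂ l) : L2 m₂ r →L[ℂ] L2 m₂ r :=
  opP m₂ l r ∘L T ∘L ContinuousLinearMap.adjoint (opP m₂ l r)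

/-- The transfer matrix function
`w_A(r, z) = I - i z Π* P_r* S_r⁻¹ (I - z A_r)⁻¹ P_r Π`, as a matrix. -/
def transfer {p : Type*} [Fintype p] [DecidableEq p] (A S : L2 m₂ l →L[ℂ] L2 m₂ l)
    (Pi : EuclideanSpace ℂ p →L[ℂ] L2 m₂ l) (r : ℝ) (z : ℂ) : Matrix p p ℂ :=
  1 - (Complex.I * z) • (toEuclideanCLM (n := p) (𝕜 := ℂ)).symm
    (ContinuousLinearMap.adjoint Pi ∘L ContinuousLinearMap.adjoint (opP m₂ l r) ∘L
      Ring.inverse (compress r S) ∘L Ring.inverse (1 - z • compress r A) ∘L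
      opP m₂ l r ∘L Pi)

end Node

end SkewDirac

end

open SkewDirac

/-!
At `z = 0` the coefficient of the Dirac system is skew-Hermitian, so `u(x, 0)` is unitary and
`w(x, z) = exp(-i x z / 2) u(x, 0)* u(x, z / 2)` solves `w' = -i z γ* γ w`. This is the relation
between `u` and `w` in the theorem; the rest identifies `w` with the transfer matrix function.

Let `J` be the operator of integration, so that `A = -i J`, let `Γ` be the Volterra operator with
kernel `γ(x) γ(t)*`, so that `K = -i Γ`, and let `θ` be the upper block row of `u(·, 0)`. Then
`θ' = v γ` and `γ' = -v* θ`, while the unitarity of `u(x, 0)` gives `γ γ* = I` and `θ γ* = 0`, hence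
`∫ₛˣ v γ γ(s)* = θ(x) γ(s)*` and `∫ₛˣ v* θ γ(s)* = I - γ(x) γ(s)*`. With `Q` the Volterra operator
with kernel `v(x)* v(t)`, these two formulas say `(I + J Q) Γ = J` and `(I + J Q) γ₂ = I`. A
similarity operator is therefore an operator `E = I + D`, with `D` Volterra, such that
`E J = (I + J Q)⁻¹ J E` and `(I + J Q) E c = c` for constants `c`. Such a `D` is found by solving an
integral equation along the characteristics `x - t = const`.

For a triangular `E` the compression `P_r S P_r*` factors as `(P_r E⁻¹ P_r*) (P_r E⁻¹ P_r*)*`, so it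
is invertible and `w_A(r, z)` can be computed from the equation `(I + i z Γ) η = γ`. Its solution is
`η = γ w`, by the integral form of the canonical system.
-/

noncomputable section

namespace SkewDirac

/-! ### Volterra kernels -/

section Kernel

variable {𝔸 : Type*} [NormedRing 𝔸] {l : ℝ} {k d e : ℝ → ℝ → 𝔸}

/-- Bounded measurable kernels on the plane which vanish off the triangle `0 < t < x < l`, so that
compositions can be written as integrals over the whole line. -/
structure IsVolterra (l : ℝ) (k : ℝ → ℝ → 𝔸) : Prop where
  stronglyMeasurable : StronglyMeasurable (Function.uncurry k)
  bounded : ∃ C, 0 ≤ C ∧ ∀ x t, ‖k x t‖ ≤ C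
  eq_zero : ∀ x t, ¬ (0 < t ∧ t < x ∧ x < l) → k x t = 0

/-- The bound `‖k x s‖ ≤ M xⁿ / n!` for `0 < x < l`, which is the inductive estimate of the Picard
iteration. -/
def HasFactorialBound (l M : ℝ) (n : ℕ) (k : ℝ → ℝ → 𝔸) : Prop :=
  ∀ x s, 0 < x → x < l → ‖k x s‖ ≤ M * x ^ n / n.factorial

namespace IsVolterra

lemma zero : IsVolterra l (0 : ℝ → ℝ → 𝔸) :=
  ⟨stronglyMeasurable_const, ⟨0, le_rfl, by simp⟩, fun _ _ _ => rfl⟩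

lemma add (hk : IsVolterra l k) (hd : IsVolterra l d) : IsVolterra l (k + d) := by
  obtain ⟨C, hC, hkC⟩ := hk.bounded
  obtain ⟨B, hB, hdB⟩ := hd.bounded
  exact ⟨hk.stronglyMeasurable.add hd.stronglyMeasurable,
    ⟨C + B, by positivity, fun x t => norm_add_le_of_le (hkC x t) (hdB x t)⟩,
    fun x t h => by rw [Pi.add_apply, Pi.add_apply, hk.eq_zero x t h, hd.eq_zero x t h, add_zero]⟩

lemma neg (hk : IsVolterra l k) : IsVolterra l (-k) := by
  obtain ⟨C, hC, hkC⟩ := hk.bounded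
  exact ⟨hk.stronglyMeasurable.neg, ⟨C, hC, fun x t => (norm_neg _).trans_le (hkC x t)⟩,
    fun x t h => by rw [Pi.neg_apply, Pi.neg_apply, hk.eq_zero x t h, neg_zero]⟩

lemma sub (hk : IsVolterra l k) (hd : IsVolterra l d) : IsVolterra l (k - d) :=
  sub_eq_add_neg k d ▸ hk.add hd.neg

lemma stronglyMeasurable_row (hk : IsVolterra l k) (x : ℝ) : StronglyMeasurable (k x) :=
  hk.stronglyMeasurable.comp_measurable measurable_prodMk_left

lemma integrable_row (hk : IsVolterra l k) (x : ℝ) : Integrable (k x) := by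
  obtain ⟨C, -, hkC⟩ := hk.bounded
  suffices IntegrableOn (k x) (Ioo 0 x) from
    this.integrable_of_forall_notMem_eq_zero fun t ht =>
      hk.eq_zero x t fun h => ht ⟨h.1, h.2.1⟩
  exact Measure.integrableOn_of_bounded measure_Ioo_lt_top.ne
    (hk.stronglyMeasurable_row x).aestronglyMeasurable (.of_forall (hkC x))

lemma integrable (hk : IsVolterra l k) : Integrable (Function.uncurry k) := by
  obtain ⟨C, -, hkC⟩ := hk.bounded
  suffices IntegrableOn (Function.uncurry k) (Ioo 0 l ×ˢ Ioo 0 l) from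
    this.integrable_of_forall_notMem_eq_zero fun p hp =>
      hk.eq_zero _ _ fun h => hp ⟨⟨h.1.trans h.2.1, h.2.2⟩, h.1, h.2.1.trans h.2.2⟩
  exact Measure.integrableOn_of_bounded
    ((Metric.isBounded_Ioo _ _).prod (Metric.isBounded_Ioo _ _)).measure_lt_top.ne
    hk.stronglyMeasurable.aestronglyMeasurable (.of_forall fun p => hkC _ _)

lemma integrable_mul (hk : IsVolterra l k) (hd : IsVolterra l d) (x s : ℝ) :
    Integrable fun η => k x η * d η s := by
  obtain ⟨C, -, hdC⟩ := hd.bounded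
  exact (hk.integrable_row x).mul_bdd
    (hd.stronglyMeasurable.comp_measurable measurable_prodMk_right).aestronglyMeasurable
    (.of_forall fun η => hdC η s)

lemma stronglyMeasurable_diagonal (hk : IsVolterra l k) :
    StronglyMeasurable fun p : (ℝ × ℝ) × ℝ => k p.2 (p.2 - p.1.1 + p.1.2) :=
  hk.stronglyMeasurable.comp_measurable (f := Function.uncurry k)
    (g := fun p : (ℝ × ℝ) × ℝ => (p.2, p.2 - p.1.1 + p.1.2)) (by fun_prop)

lemma integrableOn_diagonal (hk : IsVolterra l k) (x s : ℝ) :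
    IntegrableOn (fun y => k y (y - x + s)) (Ioo 0 x) := by
  obtain ⟨C, -, hkC⟩ := hk.bounded
  exact Measure.integrableOn_of_bounded measure_Ioo_lt_top.ne
    (hk.stronglyMeasurable_diagonal.comp_measurable
      (measurable_prodMk_left (x := (x, s)))).aestronglyMeasurable
    (.of_forall fun η => hkC _ _)

lemma norm_le_of_hasFactorialBound (hk : IsVolterra l k) {M : ℝ} {n : ℕ} (hM : 0 ≤ M)
    (h : HasFactorialBound l M n k) (x s : ℝ) : ‖k x s‖ ≤ M * |l| ^ n / n.factorial := by
  by_cases hxs : 0 < s ∧ s < x ∧ x < l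
  · have hx : 0 < x := hxs.1.trans hxs.2.1
    refine (h x s hx hxs.2.2).trans ?_
    gcongr
    exact hxs.2.2.le.trans (le_abs_self l)
  · rw [hk.eq_zero x s hxs, norm_zero]
    positivity

lemma exists_limit [CompleteSpace 𝔸] {a : ℕ → ℝ → ℝ → 𝔸} {c : ℕ → ℝ}
    (ha : ∀ n, IsVolterra l (a n)) (hc : Summable c)
    (hac : ∀ n x s, ‖a (n + 1) x s - a n x s‖ ≤ c n) :
    ∃ b, IsVolterra l b ∧ ∀ n x s, ‖b x s - a n x s‖ ≤ ∑' m, c (n + m) := by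
  have hdist : ∀ x s n, dist (a n x s) (a (n + 1) x s) ≤ c n := fun x s n => by
    rw [dist_comm, dist_eq_norm]
    exact hac n x s
  choose b hb using fun x s =>
    cauchySeq_tendsto_of_complete (cauchySeq_of_dist_le_of_summable c (hdist x s) hc)
  have hab : ∀ n x s, ‖b x s - a n x s‖ ≤ ∑' m, c (n + m) := fun n x s => by
    rw [← dist_eq_norm, dist_comm]
    exact dist_le_tsum_of_dist_le_of_tendsto c (hdist x s) hc (hb x s) n
  obtain ⟨B, hB, haB⟩ := (ha 0).bounded
  refine ⟨b, ⟨?_, ⟨∑' m, c (0 + m) + B, ?_, fun x s => ?_⟩, fun x s h => ?_⟩, hab⟩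
  · exact stronglyMeasurable_of_tendsto (f := fun n => Function.uncurry (a n)) Filter.atTop
      (fun n => (ha n).stronglyMeasurable) (tendsto_pi_nhds.mpr fun p => hb p.1 p.2)
  · exact add_nonneg ((norm_nonneg _).trans (hab 0 0 0)) hB
  · exact (norm_le_norm_sub_add _ (a 0 x s)).trans (add_le_add (hab 0 x s) (haB x s))
  · refine tendsto_nhds_unique (hb x s) ?_
    simp only [(ha _).eq_zero x s h, tendsto_const_nhds]

/-- Picard iteration: the bound `Cⁿ M xⁿ / n!` for consecutive iterates is summable in `n`. -/
theorem exists_fixedPoint [CompleteSpace 𝔸] {C : ℝ} (hC : 0 ≤ C) (T : (ℝ → ℝ → 𝔸) → ℝ → ℝ → 𝔸)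
    (hT : ∀ k, IsVolterra l k → IsVolterra l (T k))
    (hbound : ∀ k d, IsVolterra l k → IsVolterra l d → ∀ (M : ℝ) (n : ℕ),
      HasFactorialBound l M n (k - d) → HasFactorialBound l (C * M) (n + 1) (T k - T d)) :
    ∃ k, IsVolterra l k ∧ T k = k := by
  set a : ℕ → ℝ → ℝ → 𝔸 := fun n => T^[n] 0 with ha
  have hsucc : ∀ n, a (n + 1) = T (a n) := fun n => Function.iterate_succ_apply' T n _
  have haV : ∀ n, IsVolterra l (a n) := fun n => by
    induction n with
    | zero => exact zero
    | succ n ih => exact hsucc n ▸ hT _ ih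
  obtain ⟨M, hM, haM⟩ := (haV 1).bounded
  have hstep : ∀ n, HasFactorialBound l (C ^ n * M) n (a (n + 1) - a n) := fun n => by
    induction n with
    | zero => exact fun x s _ _ => by simpa [ha] using haM x s
    | succ n ih =>
      have := hbound _ _ (haV (n + 1)) (haV n) _ n ih
      rwa [← hsucc, ← hsucc, ← mul_assoc, ← pow_succ'] at this
  have hsummable : Summable fun n => C ^ n * M * |l| ^ n / n.factorial :=
    ((Real.summable_pow_div_factorial (C * |l|)).mul_left M).congr fun n => by ring
  obtain ⟨b, hb, hab⟩ := exists_limit haV hsummable fun n x s =>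
    ((haV (n + 1)).sub (haV n)).norm_le_of_hasFactorialBound (by positivity) (hstep n) x s
  set τ : ℕ → ℝ := fun n => ∑' m, C ^ (n + m) * M * |l| ^ (n + m) / (n + m).factorial
  have hτ : Filter.Tendsto τ Filter.atTop (nhds 0) := by
    simpa only [add_comm] using tendsto_sum_nat_add fun n => C ^ n * M * |l| ^ n / n.factorial
  have hτ_nonneg : ∀ n, 0 ≤ τ n := fun n => (norm_nonneg _).trans (hab n 0 0)
  have hTb : ∀ n x s, ‖T b x s - a (n + 1) x s‖ ≤ C * τ n * |l| := fun n x s => by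
    have h0 : HasFactorialBound l (τ n) 0 (b - a n) := fun x s _ _ => by simpa using hab n x s
    have h1 := ((hT b hb).sub (haV (n + 1))).norm_le_of_hasFactorialBound
      (mul_nonneg hC (hτ_nonneg n)) (hsucc n ▸ hbound _ _ hb (haV n) _ 0 h0) x s
    rwa [zero_add, pow_one, Nat.factorial_one, Nat.cast_one, div_one] at h1
  refine ⟨b, hb, funext₂ fun x s => ?_⟩
  refine tendsto_nhds_unique (f := fun n => a (n + 1) x s) (l := Filter.atTop) ?_ ?_
  · refine tendsto_iff_norm_sub_tendsto_zero.mpr (squeeze_zero (fun _ => norm_nonneg _)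
      (fun n => (norm_sub_rev _ _).trans_le (hTb n x s)) ?_)
    simpa using (hτ.const_mul C).mul_const |l|
  · exact tendsto_iff_norm_sub_tendsto_zero.mpr (squeeze_zero (fun _ => norm_nonneg _)
      (fun n => (norm_sub_rev _ _).trans_le (hab (n + 1) x s))
      (hτ.comp (Filter.tendsto_add_atTop_nat 1)))

end IsVolterra

lemma HasFactorialBound.neg {M : ℝ} {n : ℕ} (h : HasFactorialBound l M n k) :
    HasFactorialBound l M n (-k) :=
  fun x s hx hxl => (norm_neg _).trans_le (h x s hx hxl)

lemma HasFactorialBound.of_succ {M : ℝ} {n : ℕ} (h : HasFactorialBound l M (n + 1) k) :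
    HasFactorialBound l (|l| * M) n k := fun x s hx hxl => by
  have hM : 0 ≤ M * x ^ (n + 1) / (n + 1).factorial := (norm_nonneg _).trans (h x s hx hxl)
  have hM : 0 ≤ M := by
    rw [mul_div_assoc] at hM
    exact nonneg_of_mul_nonneg_left hM (by positivity)
  calc ‖k x s‖ ≤ M * x ^ (n + 1) / (n + 1).factorial := h x s hx hxl
    _ = x / (n + 1 : ℕ) * M * x ^ n / n.factorial := by
      rw [Nat.factorial_succ]
      push_cast
      field_simp
      ring
    _ ≤ |l| * M * x ^ n / n.factorial := by
      gcongr
      exact (div_le_self hx.le (by simp)).trans (hxl.le.trans (le_abs_self l))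

variable [NormedSpace ℝ 𝔸]

/-- The kernel of the composition of the Volterra operators with kernels `k` and `d`. -/
def kernelComp (k d : ℝ → ℝ → 𝔸) (x s : ℝ) : 𝔸 := ∫ η, k x η * d η s

/-- The integral of a kernel along the line of slope one which ends at `(x, s)`; it inverts
`∂ₓ + ∂ₛ`. -/
def diagonalIntegral (l : ℝ) (k : ℝ → ℝ → 𝔸) (x s : ℝ) : 𝔸 :=
  if x < l then ∫ y in Ioo 0 x, k y (y - x + s) else 0

lemma norm_setIntegral_le_pow_succ {E : Type*} [NormedAddCommGroup E] [NormedSpace ℝ E]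
    {f : ℝ → E} {x M : ℝ} {n : ℕ} (hx : 0 < x)
    (hf : ∀ y ∈ Ioo 0 x, ‖f y‖ ≤ M * y ^ n / n.factorial) :
    ‖∫ y in Ioo 0 x, f y‖ ≤ M * x ^ (n + 1) / (n + 1).factorial := by
  have hint : IntegrableOn (fun y : ℝ => M * y ^ n / n.factorial) (Ioo 0 x) :=
    (Continuous.integrableOn_Icc (by fun_prop)).mono_set Ioo_subset_Icc_self
  calc ‖∫ y in Ioo 0 x, f y‖ ≤ ∫ y in Ioo 0 x, M * y ^ n / n.factorial :=
      norm_integral_le_of_norm_le hint ((ae_restrict_mem measurableSet_Ioo).mono hf)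
    _ = M * ((x ^ (n + 1) / (n + 1)) / n.factorial) := by
      rw [← integral_Ioc_eq_integral_Ioo, ← intervalIntegral.integral_of_le hx.le]
      simp [mul_div_assoc]
    _ = M * x ^ (n + 1) / (n + 1).factorial := by
      rw [Nat.factorial_succ]
      push_cast
      field_simp

namespace IsVolterra

lemma kernelComp_eq_setIntegral (hk : IsVolterra l k) (d : ℝ → ℝ → 𝔸) (x s : ℝ) :
    kernelComp k d x s = ∫ η in Ioo 0 x, k x η * d η s :=
  (setIntegral_eq_integral_of_forall_compl_eq_zero fun η hη => by
    rw [hk.eq_zero x η fun h => hη ⟨h.1, h.2.1⟩, zero_mul]).symm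

lemma hasFactorialBound_comp (hk : IsVolterra l k) {C M : ℝ} {n : ℕ} (hC : 0 ≤ C)
    (hkC : ∀ x t, ‖k x t‖ ≤ C) (hd : HasFactorialBound l M n d) :
    HasFactorialBound l (C * M) (n + 1) (kernelComp k d) := fun x s hx hxl => by
  rw [hk.kernelComp_eq_setIntegral d]
  refine norm_setIntegral_le_pow_succ hx fun y hy => (norm_mul_le _ _).trans ?_
  calc ‖k x y‖ * ‖d y s‖ ≤ C * (M * y ^ n / n.factorial) :=
      mul_le_mul (hkC _ _) (hd y s hy.1 (hy.2.trans hxl)) (norm_nonneg _) hC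
    _ = C * M * y ^ n / n.factorial := by ring

lemma comp (hk : IsVolterra l k) (hd : IsVolterra l d) : IsVolterra l (kernelComp k d) := by
  obtain ⟨C, hC, hkC⟩ := hk.bounded
  obtain ⟨B, hB, hdB⟩ := hd.bounded
  have hzero : ∀ x t, ¬ (0 < t ∧ t < x ∧ x < l) → kernelComp k d x t = 0 := fun x t h => by
    refine integral_eq_zero_of_ae (.of_forall fun η => ?_)
    by_cases hη : 0 < η ∧ η < x ∧ x < l
    · simp [hd.eq_zero η t fun h' => h ⟨h'.1, h'.2.1.trans hη.2.1, hη.2.2⟩]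
    · simp [hk.eq_zero x η hη]
  have hmeas : StronglyMeasurable fun p : (ℝ × ℝ) × ℝ => k p.1.1 p.2 * d p.2 p.1.2 :=
    (hk.stronglyMeasurable.comp_measurable (f := Function.uncurry k)
      (g := fun p : (ℝ × ℝ) × ℝ => (p.1.1, p.2)) (by fun_prop)).mul
    (hd.stronglyMeasurable.comp_measurable (f := Function.uncurry d)
      (g := fun p : (ℝ × ℝ) × ℝ => (p.2, p.1.2)) (by fun_prop))
  refine ⟨hmeas.integral_prod_right' (ν := volume), ⟨|l| * (C * B), by positivity, fun x t => ?_⟩,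
    hzero⟩
  by_cases h : 0 < t ∧ t < x ∧ x < l
  · have hd0 : HasFactorialBound l B 0 d := fun x s _ _ => by simpa using hdB x s
    simpa using (hk.hasFactorialBound_comp hC hkC hd0).of_succ x t (h.1.trans h.2.1) h.2.2
  · rw [hzero x t h, norm_zero]
    positivity

lemma kernelComp_sub (hk : IsVolterra l k) (hd : IsVolterra l d) (he : IsVolterra l e) :
    kernelComp k (d - e) = kernelComp k d - kernelComp k e := by
  ext x s
  simp only [kernelComp, Pi.sub_apply, mul_sub]
  exact integral_sub (hk.integrable_mul hd x s) (hk.integrable_mul he x s)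

end IsVolterra

lemma HasFactorialBound.diagonalIntegral {M : ℝ} {n : ℕ} (h : HasFactorialBound l M n k) :
    HasFactorialBound l M (n + 1) (diagonalIntegral l k) := fun x s hx hxl => by
  rw [SkewDirac.diagonalIntegral, if_pos hxl]
  exact norm_setIntegral_le_pow_succ hx fun y hy => h _ _ hy.1 (hy.2.trans hxl)

lemma IsVolterra.stronglyMeasurable_diagonalIntegral (hk : IsVolterra l k) :
    StronglyMeasurable (Function.uncurry (diagonalIntegral l k)) := by
  have h : StronglyMeasurable fun p : ℝ × ℝ => ∫ y,
      ({p | 0 < p.2 ∧ p.2 < p.1.1} : Set ((ℝ × ℝ) × ℝ)).indicator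
        (fun p => k p.2 (p.2 - p.1.1 + p.1.2)) (p, y) :=
    (hk.stronglyMeasurable_diagonal.indicator
      ((measurableSet_lt measurable_const measurable_snd).inter
        (measurableSet_lt measurable_snd (by fun_prop)))).integral_prod_right' (ν := volume)
  convert h.indicator (s := {p : ℝ × ℝ | p.1 < l})
    (measurableSet_lt (by fun_prop) measurable_const) using 1
  ext ⟨x, s⟩
  simp only [Function.uncurry, diagonalIntegral, indicator, mem_ofPred_eq]
  split_ifs with hx
  · rw [← integral_indicator measurableSet_Ioo]
    simp [indicator]
  · rfl

lemma IsVolterra.diagonal (hk : IsVolterra l k) : IsVolterra l (diagonalIntegral l k) := by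
  obtain ⟨C, hC, hkC⟩ := hk.bounded
  have hzero : ∀ x t, ¬ (0 < t ∧ t < x ∧ x < l) → diagonalIntegral l k x t = 0 := fun x t h => by
    rw [diagonalIntegral]
    split_ifs with hx
    · refine setIntegral_eq_zero_of_forall_eq_zero fun y hy =>
        hk.eq_zero _ _ fun h' => h ⟨?_, ?_, hx⟩
      · linarith [h'.1, hy.2]
      · linarith [h'.2.1]
    · rfl
  refine ⟨hk.stronglyMeasurable_diagonalIntegral, ⟨|l| * C, by positivity, fun x t => ?_⟩, hzero⟩
  by_cases h : 0 < t ∧ t < x ∧ x < l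
  · have hk0 : HasFactorialBound l C 0 k := fun x s _ _ => by simpa using hkC x s
    simpa using hk0.diagonalIntegral.of_succ x t (h.1.trans h.2.1) h.2.2
  · rw [hzero x t h, norm_zero]
    positivity

lemma IsVolterra.diagonalIntegral_sub (hk : IsVolterra l k) (hd : IsVolterra l d) :
    diagonalIntegral l (k - d) = diagonalIntegral l k - diagonalIntegral l d := by
  ext x s
  simp only [diagonalIntegral, Pi.sub_apply]
  split_ifs
  · exact integral_sub (hk.integrableOn_diagonal x s) (hd.integrableOn_diagonal x s)
  · simp

theorem IsVolterra.exists_resolvent [CompleteSpace 𝔸] (hk : IsVolterra l k) :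
    ∃ d, IsVolterra l d ∧ d + (k + kernelComp k d) = 0 := by
  obtain ⟨C, hC, hkC⟩ := hk.bounded
  obtain ⟨d, hd, hfix⟩ := exists_fixedPoint hC (fun d => -(k + kernelComp k d))
    (fun d hd => (hk.add (hk.comp hd)).neg) fun d e hd he M n hde => by
      rw [show -(k + kernelComp k d) - -(k + kernelComp k e) = -kernelComp k (d - e) by
        rw [hk.kernelComp_sub hd he]; abel]
      exact (hk.hasFactorialBound_comp hC hkC hde).neg
  exact ⟨d, hd, add_eq_zero_iff_eq_neg.mpr hfix.symm⟩

/-- The equation is the integrated form of `∂ₓ d + ∂ₛ d = -(k + k d)`, `d(x, 0) = 0`. -/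
theorem IsVolterra.exists_transmutation [CompleteSpace 𝔸] (hk : IsVolterra l k) :
    ∃ d, IsVolterra l d ∧ d + diagonalIntegral l (k + kernelComp k d) = 0 := by
  obtain ⟨C, hC, hkC⟩ := hk.bounded
  have hV : ∀ d, IsVolterra l d → IsVolterra l (k + kernelComp k d) :=
    fun d hd => hk.add (hk.comp hd)
  obtain ⟨d, hd, hfix⟩ := exists_fixedPoint (l := l) (C := |l| * C) (by positivity)
    (fun d => -diagonalIntegral l (k + kernelComp k d)) (fun d hd => (hV d hd).diagonal.neg)
    fun d e hd he M n hde => by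
      rw [neg_sub_neg, ← neg_sub, ← (hV d hd).diagonalIntegral_sub (hV e he),
        add_sub_add_left_eq_sub, ← hk.kernelComp_sub hd he, mul_assoc]
      exact (hk.hasFactorialBound_comp hC hkC hde).of_succ.diagonalIntegral.neg
  exact ⟨d, hd, add_eq_zero_iff_eq_neg.mpr hfix.symm⟩

end Kernel

/-! ### Volterra operators -/

lemma setIntegral_eq_intervalIntegral {E : Type*} [NormedAddCommGroup E] [NormedSpace ℝ E]
    {f : ℝ → E} {s : Set ℝ} {a b : ℝ} (hs : MeasurableSet s) (hab : a ≤ b) (hsub : Ioo a b ⊆ s)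
    (hf : ∀ t ∉ Ioo a b, f t = 0) : ∫ t in s, f t = ∫ t in a..b, f t := by
  rw [intervalIntegral.integral_of_le hab, integral_Ioc_eq_integral_Ioo]
  exact setIntegral_eq_of_subset_of_forall_sdiff_eq_zero hs hsub fun t ht => hf t ht.2

section KernelOperator

variable {m : Type*} [Fintype m] [DecidableEq m]

lemma norm_toEuclideanCLM_apply_le (M : Matrix m m ℂ) (w : EuclideanSpace ℂ m) :
    ‖toEuclideanCLM (𝕜 := ℂ) M w‖ ≤ ‖M‖ * ‖w‖ :=
  ((toEuclideanCLM (𝕜 := ℂ) M).le_opNorm w).trans_eq (by rw [l2_opNorm_toEuclideanCLM])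

lemma continuous_toEuclideanCLM : Continuous (toEuclideanCLM (n := m) (𝕜 := ℂ)) :=
  (toEuclideanCLM (n := m) (𝕜 := ℂ)).toAlgEquiv.toLinearMap.continuous_of_finiteDimensional

section

variable {α : Type*} [MeasurableSpace α] {μ : Measure α} {M : α → Matrix m m ℂ}

lemma aestronglyMeasurable_toEuclideanCLM_apply {f : α → EuclideanSpace ℂ m}
    (hM : AEStronglyMeasurable M μ) (hf : AEStronglyMeasurable f μ) :
    AEStronglyMeasurable (fun a => toEuclideanCLM (𝕜 := ℂ) (M a) (f a)) μ :=
  isBoundedBilinearMap_apply.continuous.comp_aestronglyMeasurable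
    ((continuous_toEuclideanCLM.comp_aestronglyMeasurable hM).prodMk hf)

lemma integral_toEuclideanCLM_apply (hM : Integrable M μ) (w : EuclideanSpace ℂ m) :
    ∫ a, toEuclideanCLM (𝕜 := ℂ) (M a) w ∂μ = toEuclideanCLM (𝕜 := ℂ) (∫ a, M a ∂μ) w :=
  ((ContinuousLinearMap.apply ℂ _ w) ∘L
    (⟨(toEuclideanCLM (n := m) (𝕜 := ℂ)).toAlgEquiv.toLinearMap, continuous_toEuclideanCLM⟩ :
      Matrix m m ℂ →L[ℂ] _)).integral_comp_comm hM

end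

variable {n : ℕ} {l : ℝ} {k d : ℝ → ℝ → Matrix (Fin n) (Fin n) ℂ}
  {f g : ℝ → EuclideanSpace ℂ (Fin n)}

lemma integrable_coe (f : L2 n l) : Integrable (fun x => f x) (vol l) := integrableOn_coe f

lemma exists_integral_norm_le_mul_norm (n : ℕ) (l : ℝ) :
    ∃ B : ℝ, 0 ≤ B ∧ ∀ f : L2 n l, ∫ t, ‖f t‖ ∂(vol l) ≤ B * ‖f‖ := by
  set c : ℝ≥0∞ := (vol l univ) ^ (1 / (1 : ℝ≥0∞).toReal - 1 / (2 : ℝ≥0∞).toReal)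
  have hc : c ≠ ⊤ := ENNReal.rpow_ne_top_of_nonneg (by norm_num) (measure_ne_top _ _)
  refine ⟨c.toReal, ENNReal.toReal_nonneg, fun f => ?_⟩
  have h : eLpNorm f 1 (vol l) ≤ eLpNorm f 2 (vol l) * c :=
    eLpNorm_le_eLpNorm_mul_rpow_measure_univ (by norm_num) (Lp.aestronglyMeasurable f)
  rw [integral_norm_eq_lintegral_enorm (Lp.aestronglyMeasurable f),
    ← eLpNorm_one_eq_lintegral_enorm, Lp.norm_def, mul_comm, ← ENNReal.toReal_mul]
  exact ENNReal.toReal_mono (ENNReal.mul_ne_top (Lp.eLpNorm_ne_top f) hc) h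

lemma toL2_eq_toLp (hf : MemLp f 2 (vol l)) : toL2 l f = hf.toLp f := dif_pos hf

lemma coeFn_toL2 (hf : MemLp f 2 (vol l)) : toL2 l f =ᵐ[vol l] f := by
  rw [toL2_eq_toLp hf]
  exact hf.coeFn_toLp

lemma toL2_congr (h : f =ᵐ[vol l] g) : toL2 l f = toL2 l g := by
  by_cases hf : MemLp f 2 (vol l)
  · rw [toL2_eq_toLp hf, toL2_eq_toLp (hf.ae_eq h), MemLp.toLp_eq_toLp_iff]
    exact h
  · have hg : ¬MemLp g 2 (vol l) := fun hg => hf (hg.ae_eq h.symm)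
    rw [toL2, toL2, dif_neg hf, dif_neg hg]

lemma toL2_add (hf : MemLp f 2 (vol l)) (hg : MemLp g 2 (vol l)) :
    toL2 l (fun x => f x + g x) = toL2 l f + toL2 l g := by
  rw [toL2_eq_toLp hf, toL2_eq_toLp hg, ← MemLp.toLp_add hf hg]
  exact toL2_eq_toLp (hf.add hg)

lemma toL2_const_smul (c : ℂ) (hf : MemLp f 2 (vol l)) :
    toL2 l (fun x => c • f x) = c • toL2 l f := by
  rw [toL2_eq_toLp hf]
  exact (toL2_eq_toLp (hf.const_smul c)).trans (MemLp.toLp_const_smul c hf)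

lemma eq_toL2_of_ae_eq {f : L2 n l} (h : f =ᵐ[vol l] g) : f = toL2 l g := by
  rw [toL2_eq_toLp ((Lp.memLp f).ae_eq h)]
  exact Lp.ext (h.trans ((Lp.memLp f).ae_eq h).coeFn_toLp.symm)

/-- The integral operator with kernel `k`, on functions on `(0, l)`. -/
def kernelIntegral (l : ℝ) (k : ℝ → ℝ → Matrix (Fin n) (Fin n) ℂ)
    (f : ℝ → EuclideanSpace ℂ (Fin n)) (x : ℝ) : EuclideanSpace ℂ (Fin n) :=
  ∫ t, toEuclideanCLM (𝕜 := ℂ) (k x t) (f t) ∂(vol l)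

lemma kernelIntegral_congr (h : f =ᵐ[vol l] g) (x : ℝ) :
    kernelIntegral l k f x = kernelIntegral l k g x :=
  integral_congr_ae (h.mono fun t ht => by simp only [ht])

lemma kernelIntegral_smul_right (k : ℝ → ℝ → Matrix (Fin n) (Fin n) ℂ) (c : ℂ)
    (f : ℝ → EuclideanSpace ℂ (Fin n)) (x : ℝ) :
    kernelIntegral l k (c • f) x = c • kernelIntegral l k f x := by
  simp only [kernelIntegral, Pi.smul_apply, map_smul]
  exact integral_smul _ _

lemma norm_kernelIntegral_le {C : ℝ} (hkC : ∀ x t, ‖k x t‖ ≤ C) (hf : Integrable f (vol l))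
    (x : ℝ) : ‖kernelIntegral l k f x‖ ≤ C * ∫ t, ‖f t‖ ∂(vol l) := by
  rw [← integral_const_mul]
  refine norm_integral_le_of_norm_le (hf.norm.const_mul C) (.of_forall fun t => ?_)
  exact (norm_toEuclideanCLM_apply_le _ _).trans
    (mul_le_mul_of_nonneg_right (hkC x t) (norm_nonneg _))

namespace IsVolterra

lemma integrable_toEuclideanCLM_row (hk : IsVolterra l k) (hf : Integrable f (vol l)) (x : ℝ) :
    Integrable (fun t => toEuclideanCLM (𝕜 := ℂ) (k x t) (f t)) (vol l) := by
  obtain ⟨C, -, hkC⟩ := hk.bounded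
  refine (hf.norm.const_mul C).mono' (aestronglyMeasurable_toEuclideanCLM_apply
    (hk.stronglyMeasurable_row x).aestronglyMeasurable hf.aestronglyMeasurable)
    (.of_forall fun t => (norm_toEuclideanCLM_apply_le _ _).trans ?_)
  exact mul_le_mul_of_nonneg_right (hkC x t) (norm_nonneg _)

lemma kernelIntegral_add_right (hk : IsVolterra l k) (hf : Integrable f (vol l))
    (hg : Integrable g (vol l)) (x : ℝ) :
    kernelIntegral l k (f + g) x = kernelIntegral l k f x + kernelIntegral l k g x := by
  simp only [kernelIntegral, Pi.add_apply, map_add]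
  exact integral_add (hk.integrable_toEuclideanCLM_row hf x) (hk.integrable_toEuclideanCLM_row hg x)

lemma kernelIntegral_add_left (hk : IsVolterra l k) (hd : IsVolterra l d)
    (hf : Integrable f (vol l)) (x : ℝ) :
    kernelIntegral l (k + d) f x = kernelIntegral l k f x + kernelIntegral l d f x := by
  simp only [kernelIntegral, Pi.add_apply, map_add, _root_.add_apply]
  exact integral_add (hk.integrable_toEuclideanCLM_row hf x) (hd.integrable_toEuclideanCLM_row hf x)

lemma kernelIntegral_eq_intervalIntegral (hk : IsVolterra l k)
    (f : ℝ → EuclideanSpace ℂ (Fin n)) {x : ℝ} (hx : x ∈ Ioo 0 l) :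
    kernelIntegral l k f x = ∫ t in (0 : ℝ)..x, toEuclideanCLM (𝕜 := ℂ) (k x t) (f t) := by
  refine setIntegral_eq_intervalIntegral measurableSet_Ioo hx.1.le (Ioo_subset_Ioo_right hx.2.le)
    fun t ht => ?_
  rw [hk.eq_zero x t fun h => ht ⟨h.1, h.2.1⟩, map_zero, _root_.zero_apply]

lemma aestronglyMeasurable_kernelIntegral (hk : IsVolterra l k) (hf : Integrable f (vol l)) :
    AEStronglyMeasurable (kernelIntegral l k f) (vol l) := by
  have h : AEStronglyMeasurable (fun p : ℝ × ℝ => toEuclideanCLM (𝕜 := ℂ) (k p.1 p.2) (f p.2))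
      ((vol l).prod (vol l)) :=
    aestronglyMeasurable_toEuclideanCLM_apply hk.stronglyMeasurable.aestronglyMeasurable
      hf.aestronglyMeasurable.comp_snd
  exact h.integral_prod_right'

lemma memLp_kernelIntegral (hk : IsVolterra l k) (hf : Integrable f (vol l)) :
    MemLp (kernelIntegral l k f) 2 (vol l) := by
  obtain ⟨C, -, hkC⟩ := hk.bounded
  exact MemLp.of_bound (hk.aestronglyMeasurable_kernelIntegral hf) _
    (.of_forall (norm_kernelIntegral_le hkC hf))

lemma kernelComp_eq_integral_vol (hk : IsVolterra l k) (x t : ℝ) :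
    kernelComp k d x t = ∫ η, k x η * d η t ∂(vol l) :=
  (setIntegral_eq_integral_of_forall_compl_eq_zero fun η hη => by
    rw [hk.eq_zero x η fun h => hη ⟨h.1, h.2.1.trans h.2.2⟩, zero_mul]).symm

lemma kernelIntegral_kernelIntegral (hk : IsVolterra l k) (hd : IsVolterra l d)
    (hf : Integrable f (vol l)) (x : ℝ) :
    kernelIntegral l k (kernelIntegral l d f) x = kernelIntegral l (kernelComp k d) f x := by
  obtain ⟨C, -, hkC⟩ := hk.bounded
  obtain ⟨B, -, hdB⟩ := hd.bounded
  have hmeas : AEStronglyMeasurable (fun p : ℝ × ℝ =>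
      toEuclideanCLM (𝕜 := ℂ) (k x p.1 * d p.1 p.2) (f p.2)) ((vol l).prod (vol l)) :=
    aestronglyMeasurable_toEuclideanCLM_apply
      (((hk.stronglyMeasurable_row x).comp_measurable measurable_fst).mul
        hd.stronglyMeasurable).aestronglyMeasurable hf.aestronglyMeasurable.comp_snd
  have hint : Integrable (fun p : ℝ × ℝ =>
      toEuclideanCLM (𝕜 := ℂ) (k x p.1 * d p.1 p.2) (f p.2)) ((vol l).prod (vol l)) :=
    ((hf.norm.comp_snd (vol l)).const_mul (C * B)).mono' hmeas (.of_forall fun p =>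
      (norm_toEuclideanCLM_apply_le _ _).trans (mul_le_mul_of_nonneg_right
        (norm_mul_le_of_le (hkC _ _) (hdB _ _)) (norm_nonneg _)))
  calc kernelIntegral l k (kernelIntegral l d f) x
      = ∫ η, ∫ t, toEuclideanCLM (𝕜 := ℂ) (k x η * d η t) (f t) ∂(vol l) ∂(vol l) := by
        refine integral_congr_ae (.of_forall fun η => ?_)
        simp only [kernelIntegral, map_mul, mul_apply_eq_comp]
        exact (ContinuousLinearMap.integral_comp_comm _
          (hd.integrable_toEuclideanCLM_row hf η)).symm
    _ = ∫ t, ∫ η, toEuclideanCLM (𝕜 := ℂ) (k x η * d η t) (f t) ∂(vol l) ∂(vol l) :=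
        integral_integral_swap hint
    _ = kernelIntegral l (kernelComp k d) f x := integral_congr_ae (.of_forall fun t => by
        simp only [hk.kernelComp_eq_integral_vol]
        exact integral_toEuclideanCLM_apply (hk.integrable_mul hd x t).integrableOn _)

end IsVolterra

/-- The Volterra operator on `L²` with kernel `k`. -/
def kernelOp (hk : IsVolterra l k) : L2 n l →L[ℂ] L2 n l :=
  LinearMap.mkContinuousOfExistsBound
    { toFun := fun f => (hk.memLp_kernelIntegral (integrable_coe f)).toLp _
      map_add' := fun f g => by
        rw [← MemLp.toLp_add, MemLp.toLp_eq_toLp_iff]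
        refine .of_forall fun x => ?_
        rw [kernelIntegral_congr (Lp.coeFn_add f g)]
        exact hk.kernelIntegral_add_right (integrable_coe f) (integrable_coe g) x
      map_smul' := fun c f => by
        rw [RingHom.id_apply, ← MemLp.toLp_const_smul, MemLp.toLp_eq_toLp_iff]
        refine .of_forall fun x => ?_
        rw [kernelIntegral_congr (Lp.coeFn_smul c f)]
        exact kernelIntegral_smul_right k c f x }
    (by
      obtain ⟨C, hC, hkC⟩ := hk.bounded
      obtain ⟨B, hB, hfB⟩ := exists_integral_norm_le_mul_norm n l
      refine ⟨measureUnivNNReal (vol l) ^ (2 : ℝ≥0∞).toReal⁻¹ * (C * B), fun f => ?_⟩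
      rw [mul_assoc]
      refine Lp.norm_le_of_ae_bound (by positivity) ?_
      filter_upwards [(hk.memLp_kernelIntegral (integrable_coe f)).coeFn_toLp] with x hx
      simp only [LinearMap.coe_mk, AddHom.coe_mk]
      rw [hx, mul_assoc]
      exact (norm_kernelIntegral_le hkC (integrable_coe f) x).trans
        (mul_le_mul_of_nonneg_left (hfB f) hC))

lemma coeFn_kernelOp (hk : IsVolterra l k) (f : L2 n l) :
    kernelOp hk f =ᵐ[vol l] kernelIntegral l k f :=
  (hk.memLp_kernelIntegral (integrable_coe f)).coeFn_toLp

lemma kernelOp_toL2 (hk : IsVolterra l k) (hf : MemLp f 2 (vol l)) :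
    kernelOp hk (toL2 l f) = toL2 l (kernelIntegral l k f) :=
  eq_toL2_of_ae_eq ((coeFn_kernelOp hk _).trans
    (.of_forall (kernelIntegral_congr (coeFn_toL2 hf))))

lemma kernelOp_congr (hk : IsVolterra l k) (hd : IsVolterra l d) (h : k = d) :
    kernelOp hk = kernelOp hd := by
  subst h
  rfl

lemma kernelOp_zero : kernelOp (IsVolterra.zero : IsVolterra l (0 : ℝ → ℝ → Matrix _ _ ℂ)) =
    (0 : L2 n l →L[ℂ] L2 n l) := by
  ext1 f
  refine Lp.ext ?_
  filter_upwards [coeFn_kernelOp IsVolterra.zero f,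
    Lp.coeFn_zero (EuclideanSpace ℂ (Fin n)) 2 (vol l)] with x hf h0
  rw [hf, _root_.zero_apply, h0, kernelIntegral]
  simp

lemma kernelOp_add (hk : IsVolterra l k) (hd : IsVolterra l d) :
    kernelOp (hk.add hd) = kernelOp hk + kernelOp hd := by
  ext1 f
  refine Lp.ext ?_
  filter_upwards [coeFn_kernelOp (hk.add hd) f, coeFn_kernelOp hk f, coeFn_kernelOp hd f,
    Lp.coeFn_add (kernelOp hk f) (kernelOp hd f)] with x hkd hkf hdf hadd
  rw [_root_.add_apply, hadd, Pi.add_apply, hkd, hkf, hdf,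
    hk.kernelIntegral_add_left hd (integrable_coe f)]

lemma kernelOp_comp (hk : IsVolterra l k) (hd : IsVolterra l d) :
    kernelOp hk ∘L kernelOp hd = kernelOp (hk.comp hd) := by
  ext1 f
  refine Lp.ext ?_
  filter_upwards [coeFn_kernelOp hk (kernelOp hd f), coeFn_kernelOp (hk.comp hd) f] with x h1 h2
  rw [ContinuousLinearMap.comp_apply, h1, h2, kernelIntegral_congr (coeFn_kernelOp hd f),
    hk.kernelIntegral_kernelIntegral hd (integrable_coe f)]

lemma exists_one_add_kernelOp_mul_eq_one (hk : IsVolterra l k) :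
    ∃ (d : ℝ → ℝ → Matrix (Fin n) (Fin n) ℂ) (hd : IsVolterra l d),
      (1 + kernelOp hk) * (1 + kernelOp hd) = 1 := by
  obtain ⟨d, hd, h⟩ := hk.exists_resolvent
  refine ⟨d, hd, ?_⟩
  have h0 : kernelOp hd + (kernelOp hk + kernelOp hk * kernelOp hd) = 0 := by
    rw [ContinuousLinearMap.mul_def, kernelOp_comp, ← kernelOp_add, ← kernelOp_add,
      kernelOp_congr _ IsVolterra.zero h, kernelOp_zero]
  calc (1 + kernelOp hk) * (1 + kernelOp hd)
      = 1 + (kernelOp hd + (kernelOp hk + kernelOp hk * kernelOp hd)) := by noncomm_ring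
    _ = 1 := by rw [h0, add_zero]

theorem exists_inverse_one_add_kernelOp (hk : IsVolterra l k) :
    ∃ (d : ℝ → ℝ → Matrix (Fin n) (Fin n) ℂ) (hd : IsVolterra l d),
      (1 + kernelOp hk) * (1 + kernelOp hd) = 1 ∧ (1 + kernelOp hd) * (1 + kernelOp hk) = 1 := by
  obtain ⟨d, hd, hkd⟩ := exists_one_add_kernelOp_mul_eq_one hk
  obtain ⟨e, he, hde⟩ := exists_one_add_kernelOp_mul_eq_one hd
  exact ⟨d, hd, hkd, left_inv_eq_right_inv hkd hde ▸ hde⟩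

end KernelOperator

section IntegrationKernel

variable {𝔸 : Type*} [NormedRing 𝔸] {l : ℝ} {k : ℝ → ℝ → 𝔸}

/-- The kernel of the operator of integration `∫₀ˣ · dt` on `(0, l)`. -/
def intKernel (l x t : ℝ) : 𝔸 := if 0 < t ∧ t < x ∧ x < l then 1 else 0

lemma isVolterra_intKernel : IsVolterra l (intKernel l : ℝ → ℝ → 𝔸) := by
  refine ⟨StronglyMeasurable.ite ?_ stronglyMeasurable_const stronglyMeasurable_const,
    ⟨‖(1 : 𝔸)‖, norm_nonneg _, fun x t => ?_⟩, fun x t h => if_neg h⟩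
  · exact (measurableSet_lt measurable_const measurable_snd).inter
      ((measurableSet_lt measurable_snd measurable_fst).inter
        (measurableSet_lt measurable_fst measurable_const))
  · rw [intKernel]
    split_ifs <;> simp

variable [NormedSpace ℝ 𝔸]

namespace IsVolterra

lemma kernelComp_intKernel (hk : IsVolterra l k) {s : ℝ} (hs : 0 < s) (x : ℝ) :
    kernelComp k (intKernel l) x s = ∫ η in Ioi s, k x η := by
  rw [kernelComp, ← integral_indicator measurableSet_Ioi]
  congr 1 with η
  by_cases h : 0 < η ∧ η < x ∧ x < l
  · simp [intKernel, indicator, hs, h.2.1.trans h.2.2]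
  · simp [indicator, hk.eq_zero x η h]

lemma intKernel_kernelComp (hk : IsVolterra l k) {x : ℝ} (hx : x < l) (s : ℝ) :
    kernelComp (intKernel l) k x s = ∫ η in Iio x, k η s := by
  rw [kernelComp, ← integral_indicator measurableSet_Iio]
  congr 1 with η
  by_cases h : 0 < s ∧ s < η ∧ η < l
  · simp [intKernel, indicator, h.1.trans h.2.1, hx]
  · simp [indicator, hk.eq_zero η s h]

lemma integral_Iio_eq_integral_Ioo (hk : IsVolterra l k) (x : ℝ) (T : Set ℝ) :
    ∫ y in Iio x, ∫ t in T, k y t = ∫ y in Ioo 0 x, ∫ t in T, k y t := by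
  refine setIntegral_eq_of_subset_of_forall_sdiff_eq_zero measurableSet_Iio
    (fun y hy => hy.2) fun y hy => setIntegral_eq_zero_of_forall_eq_zero fun t _ => ?_
  exact hk.eq_zero y t fun h => hy.2 ⟨h.1.trans h.2.1, hy.1⟩

lemma integrable_setIntegral (hk : IsVolterra l k) {T : Set (ℝ × ℝ)} (hT : MeasurableSet T) :
    Integrable fun y => ∫ t in {t | (y, t) ∈ T}, k y t := by
  have h : Integrable fun y => ∫ t, T.indicator (Function.uncurry k) (y, t) :=
    (hk.integrable.indicator hT).integral_prod_left
  refine h.congr (.of_forall fun y => ?_)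
  exact integral_indicator (hT.preimage measurable_prodMk_left)

lemma integral_Ioi_diagonalIntegral (hk : IsVolterra l k) {x : ℝ} (hx : x < l) (s : ℝ) :
    ∫ η in Ioi s, diagonalIntegral l k x η = ∫ y in Ioo 0 x, ∫ t in Ioi (y - x + s), k y t := by
  obtain ⟨C, -, hkC⟩ := hk.bounded
  have hint : Integrable (fun p : ℝ × ℝ => k p.2 (p.2 - x + p.1))
      ((volume.restrict (Ioo s x)).prod (volume.restrict (Ioo 0 x))) := by
    rw [Measure.prod_restrict]
    refine Measure.integrableOn_of_bounded (M := C) ?_ ?_ (.of_forall fun p => hkC _ _)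
    · exact (Bornology.IsBounded.prod (Metric.isBounded_Ioo _ _)
        (Metric.isBounded_Ioo _ _)).measure_lt_top.ne
    · exact (hk.stronglyMeasurable_diagonal.comp_measurable (f := fun p : (ℝ × ℝ) × ℝ => _)
        (g := fun p : ℝ × ℝ => ((x, p.1), p.2)) (by fun_prop)).aestronglyMeasurable
  have hshift (y : ℝ) (T : Set ℝ) : ∫ η in (y - x + ·) ⁻¹' T, k y (y - x + η) =
      ∫ t in T, k y t :=
    (measurePreserving_add_left volume (y - x)).setIntegral_preimage_emb
      (measurableEmbedding_addLeft _) (k y) T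
  calc ∫ η in Ioi s, diagonalIntegral l k x η
      = ∫ η in Ioo s x, ∫ y in Ioo 0 x, k y (y - x + η) := by
        simp only [diagonalIntegral, if_pos hx]
        refine setIntegral_eq_of_subset_of_forall_sdiff_eq_zero measurableSet_Ioi
          (fun η hη => hη.1) fun η hη => setIntegral_eq_zero_of_forall_eq_zero fun y _ => ?_
        exact hk.eq_zero _ _ fun h => hη.2 ⟨hη.1, by linarith⟩
    _ = ∫ y in Ioo 0 x, ∫ η in Ioo s x, k y (y - x + η) := integral_integral_swap hint
    _ = ∫ y in Ioo 0 x, ∫ t in Ioi (y - x + s), k y t := by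
        congr 1 with y
        rw [← hshift]
        refine (setIntegral_eq_of_subset_of_forall_sdiff_eq_zero
          (measurableSet_Ioi.preimage (by fun_prop)) (fun η hη => ?_) fun η hη => ?_).symm
        · simpa using hη.1
        · exact hk.eq_zero _ _ fun h => hη.2 ⟨by simpa using hη.1, by linarith⟩

lemma integral_Iio_diagonalIntegral (hk : IsVolterra l k) {x : ℝ} (hx : x < l) (s : ℝ) :
    ∫ η in Iio x, diagonalIntegral l k η s = ∫ y in Ioo 0 x, ∫ t in Ioo (y - x + s) s, k y t := by
  obtain ⟨C, -, hkC⟩ := hk.bounded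
  have hint : Integrable (fun p : ℝ × ℝ => (Ioi p.2).indicator (fun η => k p.2 (p.2 - η + s)) p.1)
      ((volume.restrict (Ioo 0 x)).prod (volume.restrict (Ioo 0 x))) := by
    rw [Measure.prod_restrict]
    refine Measure.integrableOn_of_bounded (M := C) ?_ ?_ (.of_forall fun p => ?_)
    · exact (Bornology.IsBounded.prod (Metric.isBounded_Ioo _ _)
        (Metric.isBounded_Ioo _ _)).measure_lt_top.ne
    · exact ((hk.stronglyMeasurable_diagonal.comp_measurable (f := fun p : (ℝ × ℝ) × ℝ => _)
        (g := fun p : ℝ × ℝ => ((p.1, s), p.2)) (by fun_prop)).indicator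
        (measurableSet_lt measurable_snd measurable_fst)).aestronglyMeasurable
    · exact (norm_indicator_le_norm_self _ _).trans (hkC _ _)
  have hreflect (y : ℝ) (T : Set ℝ) : ∫ η in (fun η => y + s - η) ⁻¹' T, k y (y + s - η) =
      ∫ t in T, k y t :=
    (Measure.measurePreserving_sub_left volume (y + s)).setIntegral_preimage_emb
      (measurableEmbedding_subLeft _) (k y) T
  calc ∫ η in Iio x, diagonalIntegral l k η s
      = ∫ η in Ioo 0 x, ∫ y in Ioo 0 x,
          (Ioi y).indicator (fun η => k y (y - η + s)) η := by
        rw [setIntegral_eq_of_subset_of_forall_sdiff_eq_zero measurableSet_Iio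
          (fun η (hη : η ∈ Ioo 0 x) => hη.2) fun η hη => hk.diagonal.eq_zero η s fun h =>
            hη.2 ⟨h.1.trans h.2.1, hη.1⟩]
        refine setIntegral_congr_fun measurableSet_Ioo fun η hη => ?_
        change _ = ∫ y in Ioo 0 x, (Iio η).indicator (fun y => k y (y - η + s)) y
        rw [diagonalIntegral, if_pos (hη.2.trans hx), setIntegral_indicator measurableSet_Iio,
          Ioo_inter_Iio, min_eq_right hη.2.le]
    _ = ∫ y in Ioo 0 x, ∫ η in Ioo 0 x, (Ioi y).indicator (fun η => k y (y - η + s)) η :=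
        integral_integral_swap hint
    _ = ∫ y in Ioo 0 x, ∫ t in Ioo (y - x + s) s, k y t := by
        refine setIntegral_congr_fun measurableSet_Ioo fun y hy => ?_
        rw [← hreflect, setIntegral_indicator measurableSet_Ioi]
        simp only [sub_add_eq_add_sub]
        congr 2 with η
        simp only [mem_inter_iff, mem_Ioo, mem_Ioi, mem_preimage]
        exact ⟨fun h => ⟨by linarith, by linarith⟩,
          fun h => ⟨⟨hy.1.trans (by linarith), by linarith⟩, by linarith⟩⟩

theorem kernelComp_diagonalIntegral_intKernel (hk : IsVolterra l k) :
    kernelComp (diagonalIntegral l k) (intKernel l) =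
      kernelComp (intKernel l) (diagonalIntegral l k) +
        kernelComp (intKernel l) (kernelComp k (intKernel l)) := by
  have hJ : IsVolterra l (intKernel l : ℝ → ℝ → 𝔸) := isVolterra_intKernel
  ext x s
  by_cases h : 0 < s ∧ s < x ∧ x < l
  · obtain ⟨hs, -, hx⟩ := h
    rw [Pi.add_apply, Pi.add_apply, hk.diagonal.kernelComp_intKernel hs,
      hk.diagonal.intKernel_kernelComp hx, (hk.comp hJ).intKernel_kernelComp hx,
      hk.integral_Ioi_diagonalIntegral hx, hk.integral_Iio_diagonalIntegral hx]
    simp only [hk.kernelComp_intKernel hs]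
    rw [hk.integral_Iio_eq_integral_Ioo, ← integral_add]
    · refine setIntegral_congr_fun measurableSet_Ioo fun y hy => ?_
      rw [← integral_Ioc_eq_integral_Ioo,
        ← setIntegral_union (Ioc_disjoint_Ioi le_rfl) measurableSet_Ioi
          (hk.integrable_row y).integrableOn (hk.integrable_row y).integrableOn,
        Ioc_union_Ioi_eq_Ioi (by linarith [hy.2])]
    · exact (hk.integrable_setIntegral (T := {p | p.1 - x + s < p.2 ∧ p.2 < s})
        ((measurableSet_lt (by fun_prop) measurable_snd).inter
          (measurableSet_lt measurable_snd measurable_const))).integrableOn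
    · exact (hk.integrable_setIntegral (T := {p | s < p.2})
        (measurableSet_lt measurable_const measurable_snd)).integrableOn
  · rw [(hk.diagonal.comp hJ).eq_zero x s h,
      ((hJ.comp hk.diagonal).add (hJ.comp (hk.comp hJ))).eq_zero x s h]

end IsVolterra

end IntegrationKernel

section IntegrationOperator

variable {n : ℕ} {l : ℝ} {k : ℝ → ℝ → Matrix (Fin n) (Fin n) ℂ}

/-- The operator of integration `∫₀ˣ · dt` on `L²_n(0, l)`, as a Volterra operator. -/
def opJ (n : ℕ) (l : ℝ) : L2 n l →L[ℂ] L2 n l := kernelOp isVolterra_intKernel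

lemma kernelIntegral_intKernel (f : ℝ → EuclideanSpace ℂ (Fin n)) {x : ℝ} (hx : x ∈ Ioo 0 l) :
    kernelIntegral l (intKernel l) f x = ∫ t in (0 : ℝ)..x, f t := by
  rw [isVolterra_intKernel.kernelIntegral_eq_intervalIntegral f hx]
  refine intervalIntegral.integral_congr_Ioo_of_le hx.1.le fun t ht => ?_
  simp [intKernel, ht.1, ht.2, hx.2]

lemma opJ_toL2 {f : ℝ → EuclideanSpace ℂ (Fin n)} (hf : MemLp f 2 (vol l)) :
    opJ n l (toL2 l f) = toL2 l (fun x => ∫ t in (0 : ℝ)..x, f t) := by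
  rw [opJ, kernelOp_toL2 _ hf]
  refine toL2_congr ?_
  filter_upwards [ae_restrict_mem measurableSet_Ioo] with x hx using kernelIntegral_intKernel f hx

lemma opA_eq_smul_opJ : opA n l = (-Complex.I) • opJ n l := by
  ext1 f
  refine Lp.ext ?_
  filter_upwards [(memLp_primitive f).coeFn_toLp, coeFn_kernelOp isVolterra_intKernel f,
    Lp.coeFn_smul (-Complex.I) (opJ n l f), ae_restrict_mem measurableSet_Ioo] with x h1 h2 h3 hx
  rw [_root_.smul_apply, h3, Pi.smul_apply, opJ, h2, kernelIntegral_intKernel f hx]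
  exact h1

theorem kernelOp_diagonal_comp_opJ (hk : IsVolterra l k) :
    kernelOp hk.diagonal ∘L opJ n l =
      opJ n l ∘L kernelOp hk.diagonal + opJ n l ∘L kernelOp hk ∘L opJ n l := by
  simp only [opJ, kernelOp_comp, ← kernelOp_add]
  exact kernelOp_congr _ _ hk.kernelComp_diagonalIntegral_intKernel

lemma IsVolterra.kernelIntegral_const (hk : IsVolterra l k) (c : EuclideanSpace ℂ (Fin n))
    (x : ℝ) :
    kernelIntegral l k (fun _ => c) x = toEuclideanCLM (𝕜 := ℂ) (∫ t in Ioi 0, k x t) c := by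
  rw [← integral_toEuclideanCLM_apply (hk.integrable_row x).integrableOn, kernelIntegral]
  refine (setIntegral_eq_of_subset_of_forall_sdiff_eq_zero measurableSet_Ioi
    Ioo_subset_Ioi_self fun t ht => ?_).symm
  rw [hk.eq_zero x t fun h => ht.2 ⟨h.1, h.2.1.trans h.2.2⟩, map_zero, _root_.zero_apply]

lemma kernelOp_diagonal_const (hk : IsVolterra l k) (c : EuclideanSpace ℂ (Fin n)) :
    kernelOp hk.diagonal (toL2 l fun _ => c) = opJ n l (kernelOp hk (toL2 l fun _ => c)) := by
  have hc : MemLp (fun _ : ℝ => c) 2 (vol l) := memLp_const c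
  have hkc : MemLp (kernelIntegral l k fun _ => c) 2 (vol l) :=
    hk.memLp_kernelIntegral (hc.integrable (by norm_num))
  rw [kernelOp_toL2 _ hc, kernelOp_toL2 _ hc, opJ_toL2 hkc]
  refine toL2_congr ?_
  filter_upwards [ae_restrict_mem measurableSet_Ioo] with x hx
  have hrow : ∀ y ∈ Ioo 0 x, ∫ t in Ioi (y - x + 0), k y t = ∫ t in Ioi 0, k y t :=
    fun y hy => setIntegral_eq_of_subset_of_forall_sdiff_eq_zero measurableSet_Ioi
      (Ioi_subset_Ioi (by linarith [hy.2])) fun t ht => hk.eq_zero y t fun h => ht.2 h.1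
  have hint : Integrable (fun y => ∫ t in Ioi 0, k y t) :=
    hk.integrable_setIntegral (T := {p | 0 < p.2})
      (measurableSet_lt measurable_const measurable_snd)
  rw [hk.diagonal.kernelIntegral_const, hk.integral_Ioi_diagonalIntegral hx.2,
    setIntegral_congr_fun measurableSet_Ioo hrow,
    ← integral_toEuclideanCLM_apply hint.integrableOn,
    intervalIntegral.integral_of_le hx.1.le, integral_Ioc_eq_integral_Ioo]
  exact setIntegral_congr_fun measurableSet_Ioo fun y _ => (hk.kernelIntegral_const c y).symm

end IntegrationOperator

section AbsolutelyContinuous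

variable {E X : Type*} [NormedAddCommGroup E] [PseudoMetricSpace X]
  {a b l : ℝ} {P : ℝ → Prop}

lemma absolutelyContinuousOnInterval_of_dist_le {Y : Type*} [PseudoMetricSpace Y] {f : ℝ → X}
    {g : ℝ → Y} (hf : AbsolutelyContinuousOnInterval f a b)
    (h : ∀ x ∈ uIcc a b, ∀ y ∈ uIcc a b, dist (g x) (g y) ≤ dist (f x) (f y)) :
    AbsolutelyContinuousOnInterval g a b := by
  rw [absolutelyContinuousOnInterval_iff] at hf ⊢
  intro ε hε
  obtain ⟨δ, hδ, hfδ⟩ := hf ε hε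
  exact ⟨δ, hδ, fun I hI hIδ => (Finset.sum_le_sum fun i hi =>
    h _ (hI.1 i hi).1 _ (hI.1 i hi).2).trans_lt (hfδ I hI hIδ)⟩

lemma absolutelyContinuousOnInterval_congr {f g : ℝ → X}
    (hf : AbsolutelyContinuousOnInterval f a b) (h : EqOn f g (uIcc a b)) :
    AbsolutelyContinuousOnInterval g a b :=
  absolutelyContinuousOnInterval_of_dist_le hf fun x hx y hy => by rw [h hx, h hy]

lemma absolutelyContinuousOnInterval_const (c : X) (a b : ℝ) :
    AbsolutelyContinuousOnInterval (fun _ => c) a b :=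
  ((LipschitzWith.const' c (K := 0)).lipschitzOnWith).absolutelyContinuousOnInterval

lemma absolutelyContinuousOnInterval_sum {ι : Type*} {s : Finset ι} {f : ι → ℝ → E}
    (h : ∀ i ∈ s, AbsolutelyContinuousOnInterval (f i) a b) :
    AbsolutelyContinuousOnInterval (fun x => ∑ i ∈ s, f i x) a b := by
  classical
  induction s using Finset.induction_on with
  | empty => simpa using absolutelyContinuousOnInterval_const (0 : E) a b
  | insert i s hi ih =>
    simp only [Finset.sum_insert hi]
    exact (h i (Finset.mem_insert_self _ _)).fun_add
      (ih fun j hj => h j (Finset.mem_insert_of_mem hj))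

lemma absolutelyContinuousOnInterval_integral [NormedSpace ℝ E] {g : ℝ → E}
    (hg : IntervalIntegrable g volume a b) :
    AbsolutelyContinuousOnInterval (fun x => ∫ t in a..x, g t) a b := by
  refine absolutelyContinuousOnInterval_of_dist_le
    (hg.norm.absolutelyContinuousOnInterval_intervalIntegral left_mem_uIcc) fun x hx y hy => ?_
  have hax := uIcc_subset_uIcc_left hx
  have hay := uIcc_subset_uIcc_left hy
  rw [dist_eq_norm, dist_eq_norm,
    intervalIntegral.integral_interval_sub_left (hg.mono_set hax) (hg.mono_set hay),
    intervalIntegral.integral_interval_sub_left (hg.norm.mono_set hax) (hg.norm.mono_set hay)]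
  exact intervalIntegral.norm_integral_le_abs_integral_norm

theorem integral_eq_sub_of_ae_hasDerivAt [NormedSpace ℝ E] [CompleteSpace E] {f g : ℝ → E}
    (hf : AbsolutelyContinuousOnInterval f a b) (hfg : ∀ᵐ x, x ∈ uIcc a b → HasDerivAt f (g x) x)
    (hg : IntervalIntegrable g volume a b) : ∫ x in a..b, g x = f b - f a := by
  obtain ⟨C, hC⟩ := (hf.fun_sub (absolutelyContinuousOnInterval_integral hg)
    ).const_of_ae_hasDerivAt_zero (by
      filter_upwards [hfg, hg.ae_hasDerivAt_integral] with x hfx hgx hx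
      simpa using (hfx hx).fun_sub (hgx hx a left_mem_uIcc))
  have ha := hC a left_mem_uIcc
  rw [intervalIntegral.integral_same, sub_zero] at ha
  rw [ha, ← hC b right_mem_uIcc, sub_sub_cancel]

lemma ae_uIcc_of_ae_vol (hP : ∀ᵐ x ∂(vol l), P x) (ha : a ∈ Icc 0 l) (hb : b ∈ Icc 0 l) :
    ∀ᵐ x, x ∈ uIcc a b → P x := by
  rw [vol, restrict_Ioo_eq_restrict_Icc, ae_restrict_iff' measurableSet_Icc] at hP
  filter_upwards [hP] with x hx hxab
  exact hx (uIcc_subset_Icc ha hb hxab)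

lemma intervalIntegrable_of_integrable_vol {g : ℝ → E} (hg : Integrable g (vol l))
    (ha : a ∈ Icc 0 l) (hb : b ∈ Icc 0 l) : IntervalIntegrable g volume a b := by
  refine IntervalIntegrable.mono_set (a := 0) (b := l) ?_ ?_
  · exact (intervalIntegrable_iff_integrableOn_Ioo_of_le (ha.1.trans ha.2)).mpr hg
  · rw [uIcc_of_le (ha.1.trans ha.2)]
    exact uIcc_subset_Icc ha hb

end AbsolutelyContinuous

section MatrixDerivative

variable {m n p : Type*} {l : ℝ}

/-- The matrix function `U` is absolutely continuous on `[0, l]` with derivative `U'` a.e., both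
entrywise. -/
structure HasACDeriv (l : ℝ) (U U' : ℝ → Matrix m n ℂ) : Prop where
  ac : ∀ i j, AbsolutelyContinuousOnInterval (fun x => U x i j) 0 l
  deriv : ∀ᵐ x ∂(vol l), ∀ i j, HasDerivAt (fun s => U s i j) (U' x i j) x

lemma hasACDeriv_const (l : ℝ) (A : Matrix m n ℂ) : HasACDeriv l (fun _ => A) (fun _ => 0) :=
  ⟨fun _ _ => absolutelyContinuousOnInterval_const _ _ _,
    .of_forall fun x _ _ => hasDerivAt_const x _⟩

namespace HasACDeriv

variable {U V U' U'' : ℝ → Matrix m n ℂ} {W W' : ℝ → Matrix n p ℂ}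

lemma congr_deriv (h : HasACDeriv l U U') (h' : U' =ᵐ[vol l] U'') : HasACDeriv l U U'' :=
  ⟨h.ac, by filter_upwards [h.deriv, h'] with x h1 h2 using h2 ▸ h1⟩

lemma congr (hl : 0 ≤ l) (h : HasACDeriv l U U') (hUV : EqOn U V (Icc 0 l)) :
    HasACDeriv l V U' := by
  refine ⟨fun i j => absolutelyContinuousOnInterval_congr (h.ac i j) fun x hx => ?_, ?_⟩
  · rw [uIcc_of_le hl] at hx
    simp only [hUV hx]
  · filter_upwards [h.deriv, ae_restrict_mem measurableSet_Ioo] with x h1 hx i j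
    refine (h1 i j).congr_of_eventuallyEq ?_
    filter_upwards [Ioo_mem_nhds hx.1 hx.2] with y hy
    rw [hUV (Ioo_subset_Icc_self hy)]

lemma mul [Fintype n] (hU : HasACDeriv l U U') (hW : HasACDeriv l W W') :
    HasACDeriv l (fun x => U x * W x) (fun x => U' x * W x + U x * W' x) := by
  refine ⟨fun i j => ?_, ?_⟩
  · simp only [mul_apply]
    exact absolutelyContinuousOnInterval_sum fun k _ => (hU.ac i k).fun_smul (hW.ac k j)
  · filter_upwards [hU.deriv, hW.deriv] with x h1 h2 i j
    simp only [mul_apply, Matrix.add_apply, ← Finset.sum_add_distrib]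
    exact HasDerivAt.fun_sum fun k _ => (h1 i k).fun_mul (h2 k j)

lemma const_mul [Fintype n] (A : Matrix m n ℂ) (hW : HasACDeriv l W W') :
    HasACDeriv l (fun x => A * W x) (fun x => A * W' x) :=
  ((hasACDeriv_const l A).mul hW).congr_deriv (.of_forall fun x => by simp)

lemma mul_const [Fintype n] (hU : HasACDeriv l U U') (A : Matrix n p ℂ) :
    HasACDeriv l (fun x => U x * A) (fun x => U' x * A) :=
  (hU.mul (hasACDeriv_const l A)).congr_deriv (.of_forall fun x => by simp)

lemma conjTranspose (hU : HasACDeriv l U U') :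
    HasACDeriv l (fun x => (U x)ᴴ) (fun x => (U' x)ᴴ) := by
  refine ⟨fun i j => absolutelyContinuousOnInterval_of_dist_le (hU.ac j i) fun x _ y _ =>
    (dist_star_star _ _).le, ?_⟩
  filter_upwards [hU.deriv] with x h i j using (h j i).star

lemma cexp_smul (c : ℂ) (hU : HasACDeriv l U U') :
    HasACDeriv l (fun x => Complex.exp (c * x) • U x)
      (fun x => Complex.exp (c * x) • (c • U x + U' x)) := by
  refine ⟨fun i j => ?_, ?_⟩
  · have h : AbsolutelyContinuousOnInterval (fun x : ℝ => Complex.exp (c * x)) 0 l :=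
      (contDiff_const.mul Complex.ofRealCLM.contDiff).cexp.contDiffOn.absolutelyContinuousOnInterval
    exact h.fun_smul (hU.ac i j)
  · filter_upwards [hU.deriv] with x h1 i j
    have h2 : HasDerivAt (fun x : ℝ => Complex.exp (c * x)) (Complex.exp (c * x) * c) x := by
      simpa using ((Complex.ofRealCLM.hasDerivAt (x := x)).const_mul c).cexp
    refine (h2.fun_mul (h1 i j)).congr_deriv ?_
    simp only [Matrix.smul_apply, Matrix.add_apply, smul_eq_mul]
    ring

lemma eq_of_deriv_eq_zero (hU : HasACDeriv l U (fun _ => 0)) {x : ℝ} (hx : x ∈ Icc 0 l) :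
    U x = U 0 := by
  have hl : 0 ≤ l := hx.1.trans hx.2
  ext i j
  obtain ⟨C, hC⟩ := (hU.ac i j).const_of_ae_hasDerivAt_zero (ae_uIcc_of_ae_vol
    (hU.deriv.mono fun x h => h i j) (left_mem_Icc.mpr hl) (right_mem_Icc.mpr hl))
  rw [hC x (by rwa [uIcc_of_le hl]), hC 0 left_mem_uIcc]

lemma continuousOn (hl : 0 ≤ l) (hU : HasACDeriv l U U') : ContinuousOn U (Icc 0 l) := by
  refine continuousOn_pi.mpr fun i => continuousOn_pi.mpr fun j => ?_
  rw [← uIcc_of_le hl]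
  exact (hU.ac i j).continuousOn

end HasACDeriv

section BoundedMatrix

variable [Fintype m] [Fintype n] [Fintype p]

lemma intervalIntegral_matrix_mul [DecidableEq p] (A : Matrix m n ℂ) {M : ℝ → Matrix n p ℂ}
    {a b : ℝ} (hM : IntervalIntegrable M volume a b) :
    ∫ t in a..b, A * M t = A * ∫ t in a..b, M t :=
  (mulLeftLinearMap p ℂ A).toContinuousLinearMap.intervalIntegral_comp_comm hM

variable [DecidableEq n] {U U' : ℝ → Matrix m n ℂ}

lemma memLp_top_of_continuousOn_Icc {X : Type*} [NormedAddCommGroup X] {f : ℝ → X}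
    (hf : ContinuousOn f (Icc 0 l)) : MemLp f ∞ (vol l) := by
  obtain ⟨B, hB⟩ := isCompact_Icc.exists_bound_of_continuousOn hf
  refine memLp_top_of_bound ((hf.mono Ioo_subset_Icc_self).aestronglyMeasurable
    measurableSet_Ioo) B ?_
  filter_upwards [ae_restrict_mem measurableSet_Ioo] with x hx using hB x (Ioo_subset_Icc_self hx)

lemma HasACDeriv.memLp_top (hl : 0 ≤ l) (hU : HasACDeriv l U U') : MemLp U ∞ (vol l) :=
  memLp_top_of_continuousOn_Icc (hU.continuousOn hl)

variable {α : Type*} [MeasurableSpace α] {μ : Measure α}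

lemma memLp_top_matrix_mul [DecidableEq p] {M : α → Matrix m n ℂ} {N : α → Matrix n p ℂ}
    (hM : MemLp M ∞ μ) (hN : MemLp N ∞ μ) : MemLp (fun x => M x * N x) ∞ μ :=
  MemLp.of_bilin (p := ∞) (q := ∞) (fun A B => A * B) 1 hM hN
    ((continuous_fst.matrix_mul continuous_snd).comp_aestronglyMeasurable (hM.1.prodMk hN.1))
    (.of_forall fun x => by rw [one_mul]; exact l2_opNNNorm_mul _ _)

lemma memLp_conjTranspose [DecidableEq m] {q : ℝ≥0∞} {M : α → Matrix m n ℂ} (hM : MemLp M q μ) :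
    MemLp (fun x => (M x)ᴴ) q μ :=
  hM.of_le ((continuous_id.matrix_conjTranspose).comp_aestronglyMeasurable hM.1)
    (.of_forall fun _ => (l2_opNorm_conjTranspose _).le)

/-- The entry of a matrix at `(i, j)`, as a continuous linear map. -/
def entryCLM (i : m) (j : n) : Matrix m n ℂ →L[ℂ] ℂ :=
  (Matrix.entryLinearMap ℂ ℂ i j).toContinuousLinearMap

lemma intervalIntegral_entry {M : ℝ → Matrix m n ℂ} {a b : ℝ}
    (hM : IntervalIntegrable M volume a b) (i : m) (j : n) :
    (∫ t in a..b, M t) i j = ∫ t in a..b, M t i j :=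
  ((entryCLM i j).intervalIntegral_comp_comm hM).symm

theorem HasACDeriv.integral_eq_sub (hU : HasACDeriv l U U') (hU' : Integrable U' (vol l)) {a b : ℝ}
    (ha : a ∈ Icc 0 l) (hb : b ∈ Icc 0 l) : ∫ t in a..b, U' t = U b - U a := by
  have hsub : uIcc a b ⊆ uIcc 0 l := by
    rw [uIcc_of_le (ha.1.trans ha.2)]
    exact uIcc_subset_Icc ha hb
  ext i j
  rw [intervalIntegral_entry (intervalIntegrable_of_integrable_vol hU' ha hb)]
  exact integral_eq_sub_of_ae_hasDerivAt ((hU.ac i j).mono hsub)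
    (ae_uIcc_of_ae_vol (hU.deriv.mono fun x h => h i j) ha hb)
    (intervalIntegrable_of_integrable_vol ((entryCLM i j).integrable_comp hU') ha hb)

end BoundedMatrix

end MatrixDerivative

/-! ### The Dirac system -/

section SkewSystem

variable {n p : Type*} [Fintype n] {l : ℝ} {C C₀ : ℝ → Matrix n n ℂ}

lemma IsSolution.hasACDeriv {U : ℝ → Matrix n p ℂ} (h : IsSolution l C U) :
    HasACDeriv l U (fun x => C x * U x) :=
  ⟨h.ac, h.eqn⟩

variable [DecidableEq n] {U U₀ V : ℝ → Matrix n n ℂ} {x : ℝ}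

lemma IsFundamentalSolution.conjTranspose_mul_self (hU : IsFundamentalSolution l C U)
    (hC : ∀ x, (C x)ᴴ = -C x) (hx : x ∈ Icc 0 l) : (U x)ᴴ * U x = 1 := by
  have hconst : HasACDeriv l (fun x => (U x)ᴴ * U x) (fun _ => 0) :=
    (hU.hasACDeriv.conjTranspose.mul hU.hasACDeriv).congr_deriv (.of_forall fun x => by
      simp [hC, Matrix.mul_assoc])
  rw [hconst.eq_of_deriv_eq_zero hx, hU.init, conjTranspose_one, Matrix.one_mul]

lemma IsFundamentalSolution.mul_conjTranspose_self (hU : IsFundamentalSolution l C U)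
    (hC : ∀ x, (C x)ᴴ = -C x) (hx : x ∈ Icc 0 l) : U x * (U x)ᴴ = 1 :=
  mul_eq_one_comm.mp (hU.conjTranspose_mul_self hC hx)

lemma IsFundamentalSolution.congr (hl : 0 ≤ l) (hU : IsFundamentalSolution l C U)
    (hUV : EqOn U V (Icc 0 l)) : IsFundamentalSolution l C V := by
  have hV := (hU.hasACDeriv.congr hl hUV).congr_deriv (U'' := fun x => C x * V x) <| by
    filter_upwards [ae_restrict_mem measurableSet_Ioo] with x hx
    rw [hUV (Ioo_subset_Icc_self hx)]
  exact ⟨⟨hV.ac, hV.deriv⟩, (hUV (left_mem_Icc.mpr hl)).symm.trans hU.init⟩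

theorem hasACDeriv_cexp_smul_conjTranspose_mul (hU₀ : IsFundamentalSolution l C₀ U₀)
    (hC₀ : ∀ x, (C₀ x)ᴴ = -C₀ x) {V : ℝ → Matrix n p ℂ} (hV : IsSolution l C V) (c : ℂ) :
    HasACDeriv l (fun x => Complex.exp (c * x) • ((U₀ x)ᴴ * V x))
      (fun x => (U₀ x)ᴴ * (c • 1 + C x - C₀ x) * U₀ x
        * (Complex.exp (c * x) • ((U₀ x)ᴴ * V x))) := by
  refine ((hU₀.hasACDeriv.conjTranspose.mul hV.hasACDeriv).cexp_smul c).congr_deriv ?_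
  filter_upwards [ae_restrict_mem measurableSet_Ioo] with x hx
  have hcancel : U₀ x * ((U₀ x)ᴴ * V x) = V x := by
    rw [← Matrix.mul_assoc, hU₀.mul_conjTranspose_self hC₀ (Ioo_subset_Icc_self hx),
      Matrix.one_mul]
  simp only [conjTranspose_mul, hC₀, Matrix.mul_smul, Matrix.mul_assoc, hcancel, Matrix.add_mul,
    Matrix.sub_mul, Matrix.mul_add, Matrix.mul_sub, Matrix.smul_mul, Matrix.one_mul, Matrix.neg_mul,
    Matrix.mul_neg]
  congr 1
  abel

end SkewSystem

section DiracCoefficient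

variable {m₁ m₂ : ℕ}

/-- The projection onto the first `m₁` coordinates. -/
def topProj (m₁ m₂ : ℕ) : Matrix (Fin m₁) (Fin m₁ ⊕ Fin m₂) ℂ := fromCols 1 0

/-- The projection onto the last `m₂` coordinates. -/
def botProj (m₁ m₂ : ℕ) : Matrix (Fin m₂) (Fin m₁ ⊕ Fin m₂) ℂ := fromCols 0 1

lemma diracCoeff_eq_fromBlocks (v : Matrix (Fin m₁) (Fin m₂) ℂ) (z : ℂ) :
    diracCoeff v z = fromBlocks ((Complex.I * z) • 1) v (-vᴴ) (-((Complex.I * z) • 1)) := by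
  simp [diracCoeff, fromBlocks_smul, fromBlocks_multiply, fromBlocks_add]

lemma conjTranspose_diracCoeff_zero (v : Matrix (Fin m₁) (Fin m₂) ℂ) :
    (diracCoeff v 0)ᴴ = -diracCoeff v 0 := by
  simp [diracCoeff_eq_fromBlocks, fromBlocks_conjTranspose, fromBlocks_neg]

lemma topProj_mul_diracCoeff_zero (v : Matrix (Fin m₁) (Fin m₂) ℂ) :
    topProj m₁ m₂ * diracCoeff v 0 = v * botProj m₁ m₂ := by
  simp [diracCoeff_eq_fromBlocks, botProj, topProj, fromCols_mul_fromBlocks, mul_fromCols]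

lemma botProj_mul_diracCoeff_zero (v : Matrix (Fin m₁) (Fin m₂) ℂ) :
    botProj m₁ m₂ * diracCoeff v 0 = -vᴴ * topProj m₁ m₂ := by
  simp [diracCoeff_eq_fromBlocks, botProj, topProj, fromCols_mul_fromBlocks, mul_fromCols]

lemma botProj_mul_conjTranspose_botProj : botProj m₁ m₂ * (botProj m₁ m₂)ᴴ = 1 := by
  simp [botProj, conjTranspose_fromCols_eq_fromRows_conjTranspose, fromCols_mul_fromRows]

lemma topProj_mul_conjTranspose_botProj : topProj m₁ m₂ * (botProj m₁ m₂)ᴴ = 0 := by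
  simp [botProj, topProj, conjTranspose_fromCols_eq_fromRows_conjTranspose, fromCols_mul_fromRows]

lemma smul_one_add_diracCoeff_sub_diracCoeff_zero (v : Matrix (Fin m₁) (Fin m₂) ℂ) (z : ℂ) :
    (-(Complex.I * z)) • 1 + diracCoeff v z - diracCoeff v 0
      = (-(Complex.I * (2 * z))) • ((botProj m₁ m₂)ᴴ * botProj m₁ m₂) := by
  rw [sub_eq_add_neg, diracCoeff_eq_fromBlocks, diracCoeff_eq_fromBlocks, botProj,
    conjTranspose_fromCols_eq_fromRows_conjTranspose, fromRows_mul_fromCols, ← fromBlocks_one]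
  simp only [fromBlocks_smul, fromBlocks_neg, fromBlocks_add]
  congr 1
  · simp
  · simp
  · simp
  · simp only [mul_zero, zero_smul, neg_zero, add_zero, ← neg_smul, ← add_smul, conjTranspose_one,
      Matrix.mul_one]
    congr 1
    ring

end DiracCoefficient

section DiracPair

/-- The two block rows `θ`, `γ` of a unitary solution of the Dirac system at `z = 0`: they satisfy
`θ' = v γ` and `γ' = -v* θ`, and the rows of `γ` are orthonormal and orthogonal to those of `θ`. -/
structure IsDiracPair {m n p : Type*} [Fintype m] [Fintype n] [Fintype p] [DecidableEq n] (l : ℝ)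
    (v : ℝ → Matrix m n ℂ) (θ : ℝ → Matrix m p ℂ) (γ : ℝ → Matrix n p ℂ) : Prop where
  hasACDeriv_top : HasACDeriv l θ (fun x => v x * γ x)
  hasACDeriv_bot : HasACDeriv l γ (fun x => -((v x)ᴴ * θ x))
  bot_mul_conjTranspose_bot : ∀ x ∈ Icc 0 l, γ x * (γ x)ᴴ = 1
  top_mul_conjTranspose_bot : ∀ x ∈ Icc 0 l, θ x * (γ x)ᴴ = 0

namespace IsDiracPair

variable {m n p : Type*} [Fintype m] [Fintype n] [Fintype p] [DecidableEq n] {l : ℝ}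
  {v : ℝ → Matrix m n ℂ} {θ : ℝ → Matrix m p ℂ} {γ : ℝ → Matrix n p ℂ}
  {s x : ℝ}

lemma integral_mul_bot (h : IsDiracPair l v θ γ) (hv : MemLp v ∞ (vol l)) (hs : s ∈ Icc 0 l)
    (hx : x ∈ Icc 0 l) : ∫ t in s..x, v t * (γ t * (γ s)ᴴ) = θ x * (γ s)ᴴ := by
  classical
  have hl : 0 ≤ l := hs.1.trans hs.2
  have hderiv := (h.hasACDeriv_top.mul_const (γ s)ᴴ).congr_deriv
    (U'' := fun t => v t * (γ t * (γ s)ᴴ)) (.of_forall fun t => Matrix.mul_assoc ..)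
  have hint := memLp_top_matrix_mul hv
    (memLp_top_matrix_mul (h.hasACDeriv_bot.memLp_top hl) (memLp_const (γ s)ᴴ))
  rw [hderiv.integral_eq_sub (hint.integrable le_top) hs hx, h.top_mul_conjTranspose_bot s hs,
    sub_zero]

lemma integral_conjTranspose_mul_top (h : IsDiracPair l v θ γ) (hv : MemLp v ∞ (vol l))
    (hs : s ∈ Icc 0 l) (hx : x ∈ Icc 0 l) :
    ∫ t in s..x, (v t)ᴴ * (θ t * (γ s)ᴴ) = 1 - γ x * (γ s)ᴴ := by
  classical
  have hl : 0 ≤ l := hs.1.trans hs.2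
  have hderiv := (h.hasACDeriv_bot.mul_const (γ s)ᴴ).congr_deriv
    (U'' := fun t => -((v t)ᴴ * (θ t * (γ s)ᴴ)))
    (.of_forall fun t => by
      simp only [Matrix.neg_mul, Matrix.mul_assoc])
  have hint := memLp_top_matrix_mul (memLp_conjTranspose hv)
    (memLp_top_matrix_mul (h.hasACDeriv_top.memLp_top hl) (memLp_const (γ s)ᴴ))
  have hftc := hderiv.integral_eq_sub (hint.integrable le_top).neg hs hx
  rw [intervalIntegral.integral_neg, h.bot_mul_conjTranspose_bot s hs] at hftc
  rw [neg_eq_iff_eq_neg.mp hftc, neg_sub]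

end IsDiracPair

variable {m₁ m₂ : ℕ} {l : ℝ} {v : ℝ → Matrix (Fin m₁) (Fin m₂) ℂ}

lemma isDiracPair_of_isFundamentalSolution {U : ℝ → Matrix (Fin m₁ ⊕ Fin m₂) (Fin m₁ ⊕ Fin m₂) ℂ}
    (hU : IsFundamentalSolution l (fun x => diracCoeff (v x) 0) U) :
    IsDiracPair l v (fun x => topProj m₁ m₂ * U x) (fun x => botProj m₁ m₂ * U x) where
  hasACDeriv_top := (hU.hasACDeriv.const_mul _).congr_deriv (.of_forall fun x => by
    simp only [← Matrix.mul_assoc, topProj_mul_diracCoeff_zero])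
  hasACDeriv_bot := (hU.hasACDeriv.const_mul _).congr_deriv (.of_forall fun x => by
    simp only [← Matrix.mul_assoc, botProj_mul_diracCoeff_zero, Matrix.neg_mul])
  bot_mul_conjTranspose_bot x hx := by
    rw [conjTranspose_mul, Matrix.mul_assoc, ← Matrix.mul_assoc (U x),
      hU.mul_conjTranspose_self (fun x => conjTranspose_diracCoeff_zero _) hx, Matrix.one_mul,
      botProj_mul_conjTranspose_botProj]
  top_mul_conjTranspose_bot x hx := by
    rw [conjTranspose_mul, Matrix.mul_assoc, ← Matrix.mul_assoc (U x),
      hU.mul_conjTranspose_self (fun x => conjTranspose_diracCoeff_zero _) hx, Matrix.one_mul,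
      topProj_mul_conjTranspose_botProj]

end DiracPair

section CanonicalSystem

variable {m₁ m₂ : ℕ} {l : ℝ} {v : ℝ → Matrix (Fin m₁) (Fin m₂) ℂ}
  {u : ℝ → ℂ → Matrix (Fin m₁ ⊕ Fin m₂) (Fin m₁ ⊕ Fin m₂) ℂ}

/-- The fundamental solution of the canonical system `W' = -i z γ* γ W`, expressed through the
fundamental solutions `u(·, 0)` and `u(·, z / 2)` of the Dirac system. -/
def canonicalSol (u : ℝ → ℂ → Matrix (Fin m₁ ⊕ Fin m₂) (Fin m₁ ⊕ Fin m₂) ℂ) (z : ℂ) (x : ℝ) :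
    Matrix (Fin m₁ ⊕ Fin m₂) (Fin m₁ ⊕ Fin m₂) ℂ :=
  Complex.exp (-(Complex.I * (z / 2)) * x) • ((u x 0)ᴴ * u x (z / 2))

lemma canonicalSol_zero (hu : ∀ z, u 0 z = 1) (z : ℂ) : canonicalSol u z 0 = 1 := by
  simp [canonicalSol, hu]

lemma eq_exp_smul_mul_canonicalSol {x : ℝ} (hux : u x 0 * (u x 0)ᴴ = 1) (z : ℂ) :
    u x z = Complex.exp (Complex.I * x * z) • (u x 0 * canonicalSol u (2 * z) x) := by
  rw [canonicalSol, Matrix.mul_smul, ← Matrix.mul_assoc, hux, Matrix.one_mul, smul_smul,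
    ← Complex.exp_add, mul_div_cancel_left₀ z two_ne_zero,
    show Complex.I * x * z + -(Complex.I * z) * x = 0 by ring, Complex.exp_zero, one_smul]

theorem isFundamentalSolution_canonicalSol
    (hu : ∀ z, IsFundamentalSolution l (fun x => diracCoeff (v x) z) (fun x => u x z)) (z : ℂ) :
    IsFundamentalSolution l (fun x => (-(Complex.I * z)) •
      ((botProj m₁ m₂ * u x 0)ᴴ * (botProj m₁ m₂ * u x 0))) (canonicalSol u z) := by
  suffices h : HasACDeriv l (canonicalSol u z) (fun x => (-(Complex.I * z)) •
      ((botProj m₁ m₂ * u x 0)ᴴ * (botProj m₁ m₂ * u x 0)) * canonicalSol u z x) from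
    ⟨⟨h.ac, h.deriv⟩, canonicalSol_zero (fun z => (hu z).init) z⟩
  refine (hasACDeriv_cexp_smul_conjTranspose_mul (hu 0) (fun x => conjTranspose_diracCoeff_zero _)
    (hu (z / 2)).toIsSolution (-(Complex.I * (z / 2)))).congr_deriv (.of_forall fun x => ?_)
  dsimp only
  rw [smul_one_add_diracCoeff_sub_diracCoeff_zero, mul_div_cancel₀ z two_ne_zero, ← canonicalSol]
  simp only [conjTranspose_mul, Matrix.mul_smul, Matrix.smul_mul, Matrix.mul_assoc]

end CanonicalSystem

/-! ### Causal operators and their compressions -/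

section Restriction

variable {n : ℕ} {l r : ℝ}

lemma coeFn_opP (r : ℝ) (f : L2 n l) : opP n l r f =ᵐ[vol r] (Ioo 0 l).indicator f :=
  (memLp_cut r f).coeFn_toLp

lemma coeFn_opP_of_le (hr : r ≤ l) (f : L2 n l) : opP n l r f =ᵐ[vol r] f := by
  filter_upwards [coeFn_opP r f, ae_restrict_mem measurableSet_Ioo] with x hf hx
  rw [hf, indicator_of_mem (Ioo_subset_Ioo_right hr hx)]

lemma inner_opP_left (f : L2 n l) (g : L2 n r) :
    inner ℂ (opP n l r f) g = ∫ x in Ioo 0 r ∩ Ioo 0 l, inner ℂ (f x) (g x) := by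
  rw [L2.inner_def, ← setIntegral_indicator measurableSet_Ioo]
  refine integral_congr_ae ?_
  filter_upwards [coeFn_opP r f] with x hf
  rw [hf]
  by_cases hx : x ∈ Ioo 0 l <;> simp [hx]

lemma adjoint_opP (n : ℕ) (l r : ℝ) :
    ContinuousLinearMap.adjoint (opP n l r) = opP n r l := by
  refine ((ContinuousLinearMap.eq_adjoint_iff _ _).mpr fun g f => ?_).symm
  rw [inner_opP_left, ← inner_conj_symm g, inner_opP_left, ← integral_conj, inter_comm]
  simp only [inner_conj_symm]

lemma opP_comp_adjoint (hr : r ≤ l) :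
    opP n l r ∘L ContinuousLinearMap.adjoint (opP n l r) = 1 := by
  rw [adjoint_opP]
  ext1 g
  refine Lp.ext ?_
  filter_upwards [coeFn_opP_of_le hr (opP n r l g),
    ae_restrict_of_ae_restrict_of_subset (Ioo_subset_Ioo_right hr) (coeFn_opP l g),
    ae_restrict_mem measurableSet_Ioo] with x hleft hright hx
  rw [ContinuousLinearMap.comp_apply, hleft, hright, indicator_of_mem hx, one_apply_eq_self]

end Restriction

section Causal

lemma comp_eq_comp_adjoint_comp {H H' : Type*} [NormedAddCommGroup H] [InnerProductSpace ℂ H]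
    [CompleteSpace H] [NormedAddCommGroup H'] [InnerProductSpace ℂ H'] [CompleteSpace H']
    {P : H →L[ℂ] H'} {T : H →L[ℂ] H} (hP : P ∘L ContinuousLinearMap.adjoint P = 1)
    (hT : ∀ f, P f = 0 → P (T f) = 0) :
    P ∘L T = (P ∘L T ∘L ContinuousLinearMap.adjoint P) ∘L P := by
  ext1 f
  have hPf : P (ContinuousLinearMap.adjoint P (P f)) = P f := congrArg (fun S => S (P f)) hP
  have hker : P (f - ContinuousLinearMap.adjoint P (P f)) = 0 := by rw [map_sub, hPf, sub_self]
  have hTker := hT _ hker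
  rwa [map_sub, map_sub, sub_eq_zero] at hTker

variable {n : ℕ} {l r : ℝ} {S T : L2 n l →L[ℂ] L2 n l}

/-- The restriction of `T f` to each `(0, r)` depends only on the restriction of `f`. -/
def IsCausal (T : L2 n l →L[ℂ] L2 n l) : Prop :=
  ∀ r ≤ l, ∀ f, opP n l r f = 0 → opP n l r (T f) = 0

lemma IsTriangular.isCausal {ρ : ℝ → Matrix (Fin n) (Fin n) ℂ}
    {k : ℝ → ℝ → Matrix (Fin n) (Fin n) ℂ} (hT : IsTriangular T ρ k) : IsCausal T := by
  intro r hr f hf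
  have hsub : Ioo 0 r ⊆ Ioo 0 l := Ioo_subset_Ioo_right hr
  have hf0 : ∀ᵐ x ∂(vol r), f x = 0 := by
    filter_upwards [coeFn_opP_of_le hr f, Lp.coeFn_zero (EuclideanSpace ℂ (Fin n)) 2 (vol r)]
      with x hPf h0
    rw [← hPf, hf, h0, Pi.zero_apply]
  refine Lp.ext ?_
  filter_upwards [coeFn_opP_of_le hr (T f), hf0, ae_restrict_of_ae_restrict_of_subset hsub (hT f),
    Lp.coeFn_zero (EuclideanSpace ℂ (Fin n)) 2 (vol r), ae_restrict_mem measurableSet_Ioo]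
    with x hPTf hfx hTf h0 hx
  rw [hPTf, hTf, h0, hfx, map_zero, zero_add, Pi.zero_apply,
    intervalIntegral.integral_of_le hx.1.le, integral_Ioc_eq_integral_Ioo]
  refine integral_eq_zero_of_ae ?_
  filter_upwards [ae_restrict_of_ae_restrict_of_subset (Ioo_subset_Ioo_right hx.2.le) hf0] with t ht
  rw [ht, map_zero, Pi.zero_apply]

lemma IsCausal.opP_comp (hT : IsCausal T) (hr : r ≤ l) :
    opP n l r ∘L T = compress r T ∘L opP n l r :=
  comp_eq_comp_adjoint_comp (opP_comp_adjoint hr) (hT r hr)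

lemma compress_comp (hS : IsCausal S) (hr : r ≤ l) :
    compress r (S ∘L T) = compress r S ∘L compress r T := by
  rw [compress, ContinuousLinearMap.comp_assoc,
    ← ContinuousLinearMap.comp_assoc (opP n l r) S, hS.opP_comp hr,
    ContinuousLinearMap.comp_assoc]
  rfl

lemma compress_one (hr : r ≤ l) : compress r (1 : L2 n l →L[ℂ] L2 n l) = 1 :=
  opP_comp_adjoint hr

lemma compress_sub (S T : L2 n l →L[ℂ] L2 n l) :
    compress r (S - T) = compress r S - compress r T := by
  simp only [compress, ContinuousLinearMap.sub_comp, ContinuousLinearMap.comp_sub]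

lemma compress_smul (c : ℂ) (T : L2 n l →L[ℂ] L2 n l) :
    compress r (c • T) = c • compress r T := by
  simp only [compress, ContinuousLinearMap.smul_comp, ContinuousLinearMap.comp_smul]

lemma compress_adjoint (T : L2 n l →L[ℂ] L2 n l) :
    compress r (ContinuousLinearMap.adjoint T) = ContinuousLinearMap.adjoint (compress r T) := by
  unfold compress
  rw [ContinuousLinearMap.adjoint_comp, ContinuousLinearMap.adjoint_comp,
    ContinuousLinearMap.adjoint_adjoint, ContinuousLinearMap.comp_assoc]

lemma compress_mul_eq_one (hS : IsCausal S) (hr : r ≤ l) (hST : S * T = 1) :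
    compress r S * compress r T = 1 :=
  (compress_comp hS hr).symm.trans ((congrArg (compress r) hST).trans (compress_one hr))

lemma isUnit_compress (hS : IsCausal S) (hT : IsCausal T) (hr : r ≤ l) (hST : S * T = 1)
    (hTS : T * S = 1) : IsUnit (compress r S) :=
  ⟨⟨_, _, compress_mul_eq_one hS hr hST, compress_mul_eq_one hT hr hTS⟩, rfl⟩

end Causal

section VolterraCausal

variable {n : ℕ} {l r : ℝ} {k : ℝ → ℝ → Matrix (Fin n) (Fin n) ℂ}

lemma isTriangular_kernelOp (hk : IsVolterra l k) : IsTriangular (kernelOp hk) (fun _ => 0) k := by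
  intro f
  filter_upwards [coeFn_kernelOp hk f, ae_restrict_mem measurableSet_Ioo] with x hf hx
  rw [hf, hk.kernelIntegral_eq_intervalIntegral _ hx, map_zero, _root_.zero_apply, zero_add]

lemma isTriangular_one_add_kernelOp (hk : IsVolterra l k) :
    IsTriangular (1 + kernelOp hk) (fun _ => 1) k := by
  intro f
  filter_upwards [isTriangular_kernelOp hk f, Lp.coeFn_add f (kernelOp hk f)] with x hf hadd
  rw [_root_.add_apply, one_apply_eq_self, hadd, Pi.add_apply, hf, map_zero, _root_.zero_apply,
    zero_add, map_one, one_apply_eq_self]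

lemma IsVolterra.const_smul (c : ℂ) (hk : IsVolterra l k) :
    IsVolterra l (fun x t => c • k x t) := by
  obtain ⟨C, hC, hkC⟩ := hk.bounded
  refine ⟨hk.stronglyMeasurable.const_smul c, ⟨‖c‖ * C, by positivity, fun x t => ?_⟩,
    fun x t h => by rw [hk.eq_zero x t h, smul_zero]⟩
  rw [norm_smul]
  exact mul_le_mul_of_nonneg_left (hkC x t) (norm_nonneg c)

lemma kernelOp_const_smul (c : ℂ) (hk : IsVolterra l k) :
    kernelOp (hk.const_smul c) = c • kernelOp hk := by
  ext1 f
  refine Lp.ext ?_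
  filter_upwards [coeFn_kernelOp (hk.const_smul c) f, coeFn_kernelOp hk f,
    Lp.coeFn_smul c (kernelOp hk f)] with x hcf hf hsmul
  rw [hcf, _root_.smul_apply, hsmul, Pi.smul_apply, hf, kernelIntegral, kernelIntegral,
    ← integral_smul]
  simp only [map_smul, _root_.smul_apply]

lemma one_sub_smul_opA_eq (n : ℕ) (l : ℝ) (z : ℂ) :
    1 - z • opA n l = 1 + kernelOp (isVolterra_intKernel.const_smul (z * Complex.I)) := by
  rw [kernelOp_const_smul, opA_eq_smul_opJ, opJ, smul_smul, mul_neg, neg_smul, sub_neg_eq_add]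

lemma isCausal_opA (n : ℕ) (l : ℝ) : IsCausal (opA n l) := by
  rw [opA_eq_smul_opJ, opJ, ← kernelOp_const_smul]
  exact (isTriangular_kernelOp _).isCausal

theorem isUnit_one_sub_smul_compress_opA (n : ℕ) (hr : r ≤ l) (z : ℂ) :
    IsUnit (1 - z • compress r (opA n l)) := by
  obtain ⟨d, hd, hleft, hright⟩ := exists_inverse_one_add_kernelOp
    ((isVolterra_intKernel (l := l) (𝔸 := Matrix (Fin n) (Fin n) ℂ)).const_smul (z * Complex.I))
  rw [← compress_one hr, ← compress_smul, ← compress_sub, one_sub_smul_opA_eq]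
  exact isUnit_compress (isTriangular_one_add_kernelOp _).isCausal
    (isTriangular_one_add_kernelOp hd).isCausal hr hleft hright

end VolterraCausal

/-! ### Operators given by columns -/

section Columns

variable {n : ℕ} {p : Type*}

/-- The `j`-th column of a matrix as a vector of `ℂⁿ`, as a continuous linear map. -/
def colCLM [Fintype p] (n : ℕ) (j : p) : Matrix (Fin n) p ℂ →L[ℂ] EuclideanSpace ℂ (Fin n) :=
  LinearMap.toContinuousLinearMap
    { toFun := fun M => WithLp.toLp 2 fun i => M i j
      map_add' := fun _ _ => rfl
      map_smul' := fun _ _ => rfl }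

variable [Fintype p] {l r : ℝ} {M N : Matrix (Fin n) p ℂ} {θ : ℝ → Matrix (Fin n) p ℂ}

lemma colCLM_apply (j : p) (M : Matrix (Fin n) p ℂ) (i : Fin n) : colCLM n j M i = M i j := rfl

lemma col_eq_colCLM (θ : ℝ → Matrix (Fin n) p ℂ) (j : p) (x : ℝ) :
    col θ j x = colCLM n j (θ x) := rfl

lemma inner_colCLM (M N : Matrix (Fin n) p ℂ) (i j : p) :
    inner ℂ (colCLM n i M) (colCLM n j N) = (Mᴴ * N) i j := by
  simp only [mul_apply, conjTranspose_apply, colCLM_apply, PiLp.inner_apply,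
    RCLike.inner_apply, RCLike.star_def]
  exact Finset.sum_congr rfl fun a _ => mul_comm _ _

lemma toEuclideanCLM_mul_conjTranspose (M N : Matrix (Fin n) p ℂ) (w : EuclideanSpace ℂ (Fin n)) :
    toEuclideanCLM (𝕜 := ℂ) (M * Nᴴ) w = ∑ i, inner ℂ (colCLM n i N) w • colCLM n i M := by
  ext k
  rw [ofLp_toEuclideanCLM]
  simp only [mulVec, dotProduct, mul_apply, conjTranspose_apply, WithLp.ofLp_sum, Finset.sum_apply,
    WithLp.ofLp_smul, Pi.smul_apply, smul_eq_mul, Finset.sum_mul, colCLM_apply,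
    PiLp.inner_apply, RCLike.inner_apply]
  rw [Finset.sum_comm]
  refine Finset.sum_congr rfl fun i _ => Finset.sum_congr rfl fun a _ => ?_
  rw [RCLike.star_def]
  ring

lemma memLp_col [DecidableEq p] {q : ℝ≥0∞} (hθ : MemLp θ ∞ (vol l)) (j : p) :
    MemLp (col θ j) q (vol l) :=
  ((colCLM n j).comp_memLp' hθ).mono_exponent le_top

lemma ofCols_apply (c : p → L2 n l) (g : EuclideanSpace ℂ p) : ofCols c g = ∑ j, g j • c j := by
  simp [ofCols]

lemma ofCols_single [DecidableEq p] (c : p → L2 n l) (j : p) :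
    ofCols c (EuclideanSpace.single j 1) = c j := by
  rw [ofCols_apply, Finset.sum_eq_single j]
  · simp
  · intro i _ hij
    simp [hij]
  · simp

lemma comp_ofCols {n' : ℕ} (T : L2 n l →L[ℂ] L2 n' r) (c : p → L2 n l) :
    T ∘L ofCols c = ofCols fun j => T (c j) := by
  ext1 g
  rw [ContinuousLinearMap.comp_apply, ofCols_apply, ofCols_apply, map_sum]
  simp only [map_smul]

lemma adjoint_ofCols_apply (c : p → L2 n l) (f : L2 n l) (i : p) :
    ContinuousLinearMap.adjoint (ofCols c) f i = inner ℂ (c i) f := by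
  classical
  have h := ContinuousLinearMap.adjoint_inner_right (ofCols c) (EuclideanSpace.single i 1) f
  rwa [EuclideanSpace.inner_single_left, map_one, one_mul, ofCols_single] at h

lemma toEuclideanCLM_symm_apply [DecidableEq p]
    (T : EuclideanSpace ℂ p →L[ℂ] EuclideanSpace ℂ p) (i j : p) :
    (toEuclideanCLM (n := p) (𝕜 := ℂ)).symm T i j = T (EuclideanSpace.single j 1) i := by
  obtain ⟨M, rfl⟩ : ∃ M, toEuclideanCLM (n := p) (𝕜 := ℂ) M = T :=
    ⟨_, (toEuclideanCLM (n := p) (𝕜 := ℂ)).apply_symm_apply T⟩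
  rw [StarAlgEquiv.symm_apply_apply, ofLp_toEuclideanCLM]
  simp

lemma toEuclideanCLM_symm_adjoint_ofCols_comp [DecidableEq p] (c d : p → L2 n l) (i j : p) :
    (toEuclideanCLM (n := p) (𝕜 := ℂ)).symm
      (ContinuousLinearMap.adjoint (ofCols c) ∘L ofCols d) i j = inner ℂ (c i) (d j) := by
  rw [toEuclideanCLM_symm_apply, ContinuousLinearMap.comp_apply, adjoint_ofCols_apply,
    ofCols_single]

lemma inner_ofCols_adjoint (c : p → L2 n l) (f g : L2 n l) :
    inner ℂ f (ofCols c (ContinuousLinearMap.adjoint (ofCols c) g))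
      = ∑ i, inner ℂ f (c i) * inner ℂ (c i) g := by
  rw [ofCols_apply, inner_sum]
  refine Finset.sum_congr rfl fun i _ => ?_
  rw [inner_smul_right, adjoint_ofCols_apply, mul_comm]

end Columns

section MulOp

variable {n : ℕ} {p : Type*} [Fintype p] {l r : ℝ} {θ η : ℝ → Matrix (Fin n) p ℂ}

/-- Multiplication by the matrix function `θ`, as an operator from `ℂᵖ` (constant functions) to
`L²_n(0, l)`. -/
def mulOp (l : ℝ) (θ : ℝ → Matrix (Fin n) p ℂ) : EuclideanSpace ℂ p →L[ℂ] L2 n l :=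
  ofCols fun j => toL2 l (col θ j)

lemma mulOp_congr (h : θ =ᵐ[vol l] η) : mulOp l θ = mulOp l η :=
  congrArg ofCols <| funext fun j => toL2_congr (h.fun_comp (colCLM n j))

variable [DecidableEq p]

lemma mulOp_add (hθ : MemLp θ ∞ (vol l)) (hη : MemLp η ∞ (vol l)) :
    mulOp l (fun x => θ x + η x) = mulOp l θ + mulOp l η := by
  ext1 g
  simp only [mulOp, ofCols_apply, _root_.add_apply, ← Finset.sum_add_distrib, ← smul_add]
  exact Finset.sum_congr rfl fun j _ =>
    congrArg (g j • ·) (toL2_add (memLp_col hθ j) (memLp_col hη j))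

lemma mulOp_const_smul (c : ℂ) (hθ : MemLp θ ∞ (vol l)) :
    mulOp l (fun x => c • θ x) = c • mulOp l θ := by
  ext1 g
  simp only [mulOp, ofCols_apply, _root_.smul_apply, Finset.smul_sum]
  refine Finset.sum_congr rfl fun j _ => ?_
  rw [smul_comm c]
  exact congrArg (g j • ·) (toL2_const_smul c (memLp_col hθ j))

lemma opP_comp_mulOp (hr : r ≤ l) (hθ : MemLp θ ∞ (vol l)) :
    opP n l r ∘L mulOp l θ = mulOp r θ := by
  rw [mulOp, comp_ofCols]
  refine congrArg ofCols <| funext fun j => eq_toL2_of_ae_eq ?_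
  exact (coeFn_opP_of_le hr _).trans (ae_restrict_of_ae_restrict_of_subset
    (Ioo_subset_Ioo_right hr) (coeFn_toL2 (memLp_col hθ j)))

lemma toEuclideanCLM_symm_adjoint_mulOp_comp (hr : 0 ≤ r) (hθ : MemLp θ ∞ (vol r))
    (hη : MemLp η ∞ (vol r)) :
    (toEuclideanCLM (n := p) (𝕜 := ℂ)).symm
      (ContinuousLinearMap.adjoint (mulOp r θ) ∘L mulOp r η) = ∫ t in (0 : ℝ)..r, (θ t)ᴴ * η t := by
  have hint : IntervalIntegrable (fun t => (θ t)ᴴ * η t) volume 0 r :=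
    intervalIntegrable_of_integrable_vol
      ((memLp_top_matrix_mul (memLp_conjTranspose hθ) hη).integrable le_top)
      (left_mem_Icc.mpr hr) (right_mem_Icc.mpr hr)
  ext i j
  rw [mulOp, mulOp, toEuclideanCLM_symm_adjoint_ofCols_comp, intervalIntegral_entry hint,
    L2.inner_def, intervalIntegral.integral_of_le hr, integral_Ioc_eq_integral_Ioo]
  refine integral_congr_ae ?_
  filter_upwards [coeFn_toL2 (memLp_col hθ i), coeFn_toL2 (memLp_col hη j)] with x hx hx'
  rw [hx, hx', col_eq_colCLM, col_eq_colCLM, inner_colCLM]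

lemma kernelOp_comp_mulOp {k : ℝ → ℝ → Matrix (Fin n) (Fin n) ℂ} (hk : IsVolterra l k)
    (hη : MemLp η ∞ (vol l)) :
    kernelOp hk ∘L mulOp l η = mulOp l fun x => ∫ t in (0 : ℝ)..x, k x t * η t := by
  obtain ⟨C, -, hkC⟩ := hk.bounded
  have hrow (x : ℝ) : MemLp (k x) ∞ (vol l) :=
    .of_bound (hk.stronglyMeasurable_row x).aestronglyMeasurable C (.of_forall (hkC x))
  rw [mulOp, comp_ofCols]
  refine congrArg ofCols <| funext fun j => ?_
  rw [kernelOp_toL2 hk (memLp_col hη j)]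
  refine toL2_congr ?_
  filter_upwards [ae_restrict_mem measurableSet_Ioo] with x hx
  have hint : IntervalIntegrable (fun t => k x t * η t) volume 0 x :=
    intervalIntegrable_of_integrable_vol ((memLp_top_matrix_mul (hrow x) hη).integrable le_top)
      (left_mem_Icc.mpr (hx.1.trans hx.2).le) (Ioo_subset_Icc_self hx)
  rw [hk.kernelIntegral_eq_intervalIntegral _ hx]
  exact (colCLM n j).intervalIntegral_comp_comm hint

end MulOp

/-! ### The operator with kernel `θ(x) θ(t)*` -/

lemma stronglyMeasurable_indicator_of_continuousOn_Icc {X : Type*} [TopologicalSpace X]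
    [TopologicalSpace.PseudoMetrizableSpace X] [Zero X] {f : ℝ → X} {a b : ℝ}
    (hf : ContinuousOn f (Icc a b)) : StronglyMeasurable ((Ioo a b).indicator f) := by
  rcases lt_or_ge a b with hab | hab
  · have hext : (Ioo a b).indicator f
        = (Ioo a b).indicator (IccExtend hab.le ((Icc a b).domRestrict f)) :=
      indicator_congr fun x hx =>
        (IccExtend_of_mem hab.le ((Icc a b).domRestrict f) (Ioo_subset_Icc_self hx)).symm
    rw [hext]
    exact hf.domRestrict.Icc_extend'.stronglyMeasurable.indicator measurableSet_Ioo
  · rw [Ioo_eq_empty hab.not_gt, indicator_empty]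
    exact stronglyMeasurable_const

section GramKernel

variable {n p : Type*} [Fintype p] {l : ℝ} {θ : ℝ → Matrix n p ℂ}

/-- The kernel `θ(x) θ(t)*` on the triangle `0 < t < x < l`, extended by zero. -/
def gramKernel (l : ℝ) (θ : ℝ → Matrix n p ℂ) (x t : ℝ) : Matrix n n ℂ :=
  if 0 < t ∧ t < x ∧ x < l then θ x * (θ t)ᴴ else 0

lemma gramKernel_of_lt {x t : ℝ} (ht : 0 < t) (htx : t < x) (hxl : x < l) :
    gramKernel l θ x t = θ x * (θ t)ᴴ := if_pos ⟨ht, htx, hxl⟩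

lemma gramKernel_of_le {x t : ℝ} (hxt : x ≤ t) : gramKernel l θ x t = 0 :=
  if_neg fun h => hxt.not_gt h.2.1

lemma gramKernel_add_conjTranspose {x t : ℝ} (hx : x ∈ Ioo 0 l) (ht : t ∈ Ioo 0 l) (hxt : x ≠ t) :
    gramKernel l θ x t + (gramKernel l θ t x)ᴴ = θ x * (θ t)ᴴ := by
  rcases lt_or_gt_of_ne hxt with hlt | hlt
  · rw [gramKernel_of_le hlt.le, gramKernel_of_lt hx.1 hlt ht.2, zero_add, conjTranspose_mul,
      conjTranspose_conjTranspose]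
  · rw [gramKernel_of_lt ht.1 hlt hx.2, gramKernel_of_le hlt.le, conjTranspose_zero, add_zero]

variable [Fintype n] [DecidableEq n]

lemma isVolterra_gramKernel [DecidableEq p] (hm : StronglyMeasurable ((Ioo 0 l).indicator θ))
    (hb : ∃ C : ℝ, ∀ x ∈ Ioo 0 l, ‖θ x‖ ≤ C) : IsVolterra l (gramKernel l θ) := by
  obtain ⟨C, hC⟩ := hb
  refine ⟨?_, ⟨C ^ 2, sq_nonneg C, fun x t => ?_⟩, fun x t h => if_neg h⟩
  · have heq : Function.uncurry (gramKernel l θ) = fun q : ℝ × ℝ =>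
        if 0 < q.2 ∧ q.2 < q.1 ∧ q.1 < l then
          (Ioo 0 l).indicator θ q.1 * ((Ioo 0 l).indicator θ q.2)ᴴ else 0 := by
      funext ⟨x, t⟩
      refine ite_congr rfl (fun h => ?_) fun _ => rfl
      rw [indicator_of_mem (show x ∈ Ioo 0 l from ⟨h.1.trans h.2.1, h.2.2⟩),
        indicator_of_mem (show t ∈ Ioo 0 l from ⟨h.1, h.2.1.trans h.2.2⟩)]
    rw [heq]
    refine StronglyMeasurable.ite ?_ ((continuous_fst.matrix_mul
      continuous_snd.matrix_conjTranspose).comp_stronglyMeasurable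
      ((hm.comp_measurable measurable_fst).prodMk (hm.comp_measurable measurable_snd)))
      stronglyMeasurable_const
    exact (measurableSet_lt measurable_const measurable_snd).inter
      ((measurableSet_lt measurable_snd measurable_fst).inter
        (measurableSet_lt measurable_fst measurable_const))
  · unfold gramKernel
    split_ifs with h
    · have hx := hC x ⟨h.1.trans h.2.1, h.2.2⟩
      have ht := hC t ⟨h.1, h.2.1.trans h.2.2⟩
      calc ‖θ x * (θ t)ᴴ‖ ≤ ‖θ x‖ * ‖(θ t)ᴴ‖ := l2_opNorm_mul _ _
        _ = ‖θ x‖ * ‖θ t‖ := by rw [l2_opNorm_conjTranspose]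
        _ ≤ C * C := mul_le_mul hx ht (norm_nonneg _) ((norm_nonneg _).trans hx)
        _ = C ^ 2 := (sq C).symm
    · rw [norm_zero]
      exact sq_nonneg C

lemma isVolterra_gramKernel_of_continuousOn (hθ : ContinuousOn θ (Icc 0 l)) :
    IsVolterra l (gramKernel l θ) := by
  classical
  obtain ⟨C, hC⟩ := isCompact_Icc.exists_bound_of_continuousOn hθ
  exact isVolterra_gramKernel (stronglyMeasurable_indicator_of_continuousOn_Icc hθ)
    ⟨C, fun x hx => hC x (Ioo_subset_Icc_self hx)⟩

end GramKernel

section GramOperator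

variable {n : ℕ} {l : ℝ} {k : ℝ → ℝ → Matrix (Fin n) (Fin n) ℂ}

lemma integrable_inner_toEuclideanCLM (hk : IsVolterra l k) (f g : L2 n l) :
    Integrable (fun q : ℝ × ℝ => inner ℂ (f q.1) (toEuclideanCLM (𝕜 := ℂ) (k q.1 q.2) (g q.2)))
      ((vol l).prod (vol l)) := by
  obtain ⟨C, -, hkC⟩ := hk.bounded
  refine (((integrable_coe f).norm.mul_prod (integrable_coe g).norm).const_mul C).mono' ?_
    (.of_forall fun q => ?_)
  · exact (Lp.aestronglyMeasurable f).comp_fst.inner (aestronglyMeasurable_toEuclideanCLM_apply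
      hk.stronglyMeasurable.aestronglyMeasurable (Lp.aestronglyMeasurable g).comp_snd)
  · calc ‖inner ℂ (f q.1) (toEuclideanCLM (𝕜 := ℂ) (k q.1 q.2) (g q.2))‖
        ≤ ‖f q.1‖ * ‖toEuclideanCLM (𝕜 := ℂ) (k q.1 q.2) (g q.2)‖ := norm_inner_le_norm _ _
      _ ≤ ‖f q.1‖ * (C * ‖g q.2‖) := by
          gcongr
          exact (norm_toEuclideanCLM_apply_le _ _).trans (by gcongr; exact hkC _ _)
      _ = C * (‖f q.1‖ * ‖g q.2‖) := by ring

lemma inner_kernelOp (hk : IsVolterra l k) (f g : L2 n l) :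
    inner ℂ f (kernelOp hk g)
      = ∫ q : ℝ × ℝ, inner ℂ (f q.1) (toEuclideanCLM (𝕜 := ℂ) (k q.1 q.2) (g q.2))
          ∂((vol l).prod (vol l)) := by
  rw [L2.inner_def, integral_prod _ (integrable_inner_toEuclideanCLM hk f g)]
  refine integral_congr_ae ?_
  filter_upwards [coeFn_kernelOp hk g] with x hx
  rw [hx, kernelIntegral]
  exact (integral_inner (hk.integrable_toEuclideanCLM_row (integrable_coe g) x) (f x)).symm

lemma conj_inner_toEuclideanCLM (A : Matrix (Fin n) (Fin n) ℂ) (a b : EuclideanSpace ℂ (Fin n)) :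
    starRingEnd ℂ (inner ℂ a (toEuclideanCLM (𝕜 := ℂ) A b))
      = inner ℂ b (toEuclideanCLM (𝕜 := ℂ) Aᴴ a) := by
  rw [inner_conj_symm, ← star_eq_conjTranspose, map_star, ContinuousLinearMap.star_eq_adjoint,
    ContinuousLinearMap.adjoint_inner_right]

lemma integrable_inner_toEuclideanCLM_conjTranspose (hk : IsVolterra l k) (f g : L2 n l) :
    Integrable (fun q : ℝ × ℝ => inner ℂ (f q.1) (toEuclideanCLM (𝕜 := ℂ) (k q.2 q.1)ᴴ (g q.2)))
      ((vol l).prod (vol l)) := by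
  have hconj := (Complex.conjCLE.toContinuousLinearMap.integrable_comp
    (integrable_inner_toEuclideanCLM hk g f)).swap
  simpa only [Function.comp_def, ContinuousLinearEquiv.coe_coe, Complex.conjCLE_apply,
    conj_inner_toEuclideanCLM, Prod.fst_swap, Prod.snd_swap]
    using hconj

lemma inner_adjoint_kernelOp (hk : IsVolterra l k) (f g : L2 n l) :
    inner ℂ f (ContinuousLinearMap.adjoint (kernelOp hk) g)
      = ∫ q : ℝ × ℝ, inner ℂ (f q.1) (toEuclideanCLM (𝕜 := ℂ) (k q.2 q.1)ᴴ (g q.2))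
          ∂((vol l).prod (vol l)) := by
  rw [ContinuousLinearMap.adjoint_inner_right, ← inner_conj_symm, inner_kernelOp, ← integral_conj,
    ← integral_prod_swap]
  simp only [conj_inner_toEuclideanCLM, Prod.fst_swap, Prod.snd_swap]

lemma inner_mul_inner_eq_integral_prod (f c d g : L2 n l) :
    inner ℂ f c * inner ℂ d g
      = ∫ q : ℝ × ℝ, inner ℂ (f q.1) (c q.1) * inner ℂ (d q.2) (g q.2) ∂((vol l).prod (vol l)) :=
  (integral_prod_mul (fun x => inner ℂ (f x) (c x)) fun x => inner ℂ (d x) (g x)).symm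

lemma ae_prod_vol_ne (l : ℝ) : ∀ᵐ q ∂((vol l).prod (vol l)), q.1 ≠ q.2 := by
  refine (Measure.ae_prod_iff_ae_ae (p := fun q : ℝ × ℝ => q.1 ≠ q.2)
    (measurableSet_eq_fun measurable_fst measurable_snd).compl).mpr (.of_forall fun x => ?_)
  filter_upwards [compl_mem_ae_iff.mpr (measure_singleton x)] with t ht using Ne.symm ht

variable {p : Type*} [Fintype p] [DecidableEq p] {θ : ℝ → Matrix (Fin n) p ℂ}

theorem kernelOp_gramKernel_add_adjoint (hk : IsVolterra l (gramKernel l θ))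
    (hθ : MemLp θ ∞ (vol l)) :
    kernelOp hk + ContinuousLinearMap.adjoint (kernelOp hk)
      = mulOp l θ ∘L ContinuousLinearMap.adjoint (mulOp l θ) := by
  ext1 g
  refine ext_inner_left ℂ fun f => ?_
  rw [_root_.add_apply, inner_add_right, inner_kernelOp, inner_adjoint_kernelOp,
    ← integral_add (integrable_inner_toEuclideanCLM hk f g)
      (integrable_inner_toEuclideanCLM_conjTranspose hk f g),
    ContinuousLinearMap.comp_apply, mulOp, inner_ofCols_adjoint]
  simp only [inner_mul_inner_eq_integral_prod]
  rw [← integral_finsetSum _ fun i _ =>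
    (L2.integrable_inner f (toL2 l (col θ i))).mul_prod (L2.integrable_inner (toL2 l (col θ i)) g)]
  refine integral_congr_ae ?_
  have hcol : ∀ᵐ x ∂(vol l), ∀ i, toL2 l (col θ i) x = colCLM n i (θ x) :=
    ae_all_iff.mpr fun i => coeFn_toL2 (memLp_col hθ i)
  have hmem : ∀ᵐ x ∂(vol l), x ∈ Ioo 0 l := ae_restrict_mem measurableSet_Ioo
  filter_upwards [ae_prod_vol_ne l, Measure.quasiMeasurePreserving_fst.ae (hmem.and hcol),
    Measure.quasiMeasurePreserving_snd.ae (hmem.and hcol)] with q hne ⟨hx, hcolx⟩ ⟨ht, hcolt⟩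
  rw [← inner_add_right, ← _root_.add_apply, ← map_add, gramKernel_add_conjTranspose hx ht hne,
    toEuclideanCLM_mul_conjTranspose, inner_sum]
  refine Finset.sum_congr rfl fun i _ => ?_
  rw [inner_smul_right, mul_comm, hcolx, hcolt]

variable {q : Type*} [Fintype q] [DecidableEq q]

theorem kernelOp_gramKernel_comp_mulOp (hk : IsVolterra l (gramKernel l θ))
    (hθ : MemLp θ ∞ (vol l)) {η : ℝ → Matrix (Fin n) q ℂ} (hη : MemLp η ∞ (vol l)) :
    kernelOp hk ∘L mulOp l η = mulOp l fun x => θ x * ∫ t in (0 : ℝ)..x, (θ t)ᴴ * η t := by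
  rw [kernelOp_comp_mulOp hk hη]
  refine mulOp_congr ?_
  filter_upwards [ae_restrict_mem measurableSet_Ioo] with x hx
  have hint : IntervalIntegrable (fun t => (θ t)ᴴ * η t) volume 0 x :=
    intervalIntegrable_of_integrable_vol
      ((memLp_top_matrix_mul (memLp_conjTranspose hθ) hη).integrable le_top)
      (left_mem_Icc.mpr (hx.1.trans hx.2).le) (Ioo_subset_Icc_self hx)
  rw [← intervalIntegral_matrix_mul _ hint]
  refine intervalIntegral.integral_congr_Ioo_of_le hx.1.le fun t ht => ?_
  simp only [gramKernel_of_lt ht.1 ht.2 hx.2, Matrix.mul_assoc]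

end GramOperator

/-! ### The S-node of a similarity operator -/

section StarRing

lemma mul_mul_star_sub_of_mul_eq {R : Type*} [NonUnitalRing R] [StarRing R] {a f k : R}
    (h : a * f = f * k) : a * (f * star f) - f * star f * star a = f * (k - star k) * star f := by
  have hstar : star f * star a = star k * star f := by rw [← star_mul, h, star_mul]
  rw [← mul_assoc, h, mul_assoc f (star f), hstar, mul_sub, sub_mul, mul_assoc f (star k)]

lemma isUnit_mul_star {R : Type*} [Monoid R] [StarMul R] (U : Rˣ) :
    IsUnit ((U : R) * star (U : R)) :=
  (U * star U).isUnit

lemma ring_inverse_mul_star {R : Type*} [MonoidWithZero R] [StarMul R] (U : Rˣ) :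
    Ring.inverse ((U : R) * star (U : R)) = star (↑U⁻¹ : R) * ↑U⁻¹ :=
  (Ring.inverse_unit (U * star U)).trans <| by
    rw [_root_.mul_inv_rev, Units.val_mul, Units.coe_star_inv]

end StarRing

section Adjoint

open ContinuousLinearMap

variable {H₀ H₁ H₂ : Type*} [NormedAddCommGroup H₀] [InnerProductSpace ℂ H₀] [CompleteSpace H₀]
  [NormedAddCommGroup H₁] [InnerProductSpace ℂ H₁] [CompleteSpace H₁]
  [NormedAddCommGroup H₂] [InnerProductSpace ℂ H₂] [CompleteSpace H₂]

lemma adjoint_comp_adjoint_comp_adjoint_comp_self {e f : H₂ →L[ℂ] H₂} (hef : e * f = 1)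
    (Pi : H₀ →L[ℂ] H₁) (P : H₁ →L[ℂ] H₂) (Y : H₀ →L[ℂ] H₂) :
    adjoint Pi ∘L adjoint P ∘L (adjoint e ∘L e) ∘L f ∘L Y = adjoint (e ∘L P ∘L Pi) ∘L Y := by
  have hefY : e ∘L f ∘L Y = Y := by rw [← comp_assoc, ← mul_def, hef]; rfl
  rw [comp_assoc (adjoint e), hefY, adjoint_comp, adjoint_comp, comp_assoc, comp_assoc]

end Adjoint

section Triangular

variable {n : ℕ} {l : ℝ} {T T' : L2 n l →L[ℂ] L2 n l} {ρ : ℝ → Matrix (Fin n) (Fin n) ℂ}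
  {k k' : ℝ → ℝ → Matrix (Fin n) (Fin n) ℂ}

lemma IsTriangular.congr (h : IsTriangular T ρ k)
    (hkk' : ∀ x t, 0 < t → t < x → x < l → k x t = k' x t) : IsTriangular T ρ k' := by
  intro f
  filter_upwards [h f, ae_restrict_mem measurableSet_Ioo] with x hf hx
  rw [hf]
  congr 1
  refine intervalIntegral.integral_congr_Ioo_of_le hx.1.le fun t ht => ?_
  simp only [hkk' x t ht.1 ht.2 hx.2]

lemma IsTriangular.unique (h : IsTriangular T ρ k) (h' : IsTriangular T' ρ k) : T = T' := by
  ext1 f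
  refine Lp.ext ?_
  filter_upwards [h f, h' f] with x hf hf'
  rw [hf, hf']

lemma isTriangular_smul_kernelOp_gramKernel {p : Type*} [Fintype p]
    {γ : ℝ → Matrix (Fin n) p ℂ} (hk : IsVolterra l (gramKernel l γ)) (c : ℂ) :
    IsTriangular (c • kernelOp hk) (fun _ => 0) (fun x t => γ x * (c • (γ t)ᴴ)) := by
  rw [← kernelOp_const_smul]
  exact (isTriangular_kernelOp _).congr fun x t ht htx hxl => by
    rw [gramKernel_of_lt ht htx hxl, Matrix.mul_smul]

end Triangular

lemma IsFundamentalSolution.eq_one_sub_smul_integral {m n : Type*} [Fintype m] [Fintype n]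
    [DecidableEq n] {l x : ℝ} {γ : ℝ → Matrix m n ℂ} {W : ℝ → Matrix n n ℂ} {c : ℂ}
    (hW : IsFundamentalSolution l (fun x => (-c) • ((γ x)ᴴ * γ x)) W) (hγ : MemLp γ ∞ (vol l))
    (hx : x ∈ Icc 0 l) :
    W x = 1 - c • ∫ t in (0 : ℝ)..x, (γ t)ᴴ * (γ t * W t) := by
  classical
  have hl : 0 ≤ l := hx.1.trans hx.2
  have hγγ : MemLp (fun x => (-c) • ((γ x)ᴴ * γ x)) ∞ (vol l) :=
    (memLp_top_matrix_mul (memLp_conjTranspose hγ) hγ).const_smul (-c)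
  have hint := (memLp_top_matrix_mul hγγ (hW.hasACDeriv.memLp_top hl)).integrable le_top
  have hderiv := hW.hasACDeriv.integral_eq_sub hint (left_mem_Icc.mpr hl) hx
  simp only [Matrix.smul_mul, Matrix.mul_assoc] at hderiv
  rw [intervalIntegral.integral_smul, hW.init, neg_smul] at hderiv
  rw [sub_eq_add_neg, hderiv, add_sub_cancel]

section Transfer

variable {m₁ m₂ : ℕ} {l r : ℝ} {γ : ℝ → Matrix (Fin m₂) (Fin m₁ ⊕ Fin m₂) ℂ}
  {E : L2 m₂ l ≃L[ℂ] L2 m₂ l}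

namespace IsSimilarityOperator

lemma opPi_eq (hE : IsSimilarityOperator l γ E) :
    opPi γ E = (E.symm : L2 m₂ l →L[ℂ] L2 m₂ l) ∘L mulOp l γ := by
  rw [mulOp, comp_ofCols, opPi]
  refine congrArg ofCols <| funext fun j => ?_
  rcases j with j | j
  · rfl
  · exact (hE.normalized j).symm

lemma isCausal (hE : IsSimilarityOperator l γ E) : IsCausal (E : L2 m₂ l →L[ℂ] L2 m₂ l) := by
  obtain ⟨ρ, k, k', -, -, -, h, -, -⟩ := hE.triangular
  exact h.isCausal

lemma isCausal_symm (hE : IsSimilarityOperator l γ E) :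
    IsCausal (E.symm : L2 m₂ l →L[ℂ] L2 m₂ l) := by
  obtain ⟨ρ, k, k', -, -, -, -, -, h⟩ := hE.triangular
  exact h.isCausal

lemma opA_mul_symm (hE : IsSimilarityOperator l γ E) (hk : IsVolterra l (gramKernel l γ)) :
    opA m₂ l * (E.symm : L2 m₂ l →L[ℂ] L2 m₂ l)
      = (E.symm : L2 m₂ l →L[ℂ] L2 m₂ l) * ((-Complex.I) • kernelOp hk) := by
  have hconj := hE.similar.unique (isTriangular_smul_kernelOp_gramKernel hk _)
  rw [← hconj, ContinuousLinearMap.mul_def, ContinuousLinearMap.mul_def,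
    ← ContinuousLinearMap.comp_assoc, E.coe_symm_comp_coe, ContinuousLinearMap.id_comp]

theorem isSNode (hE : IsSimilarityOperator l γ E) (hγ : ContinuousOn γ (Icc 0 l)) :
    IsSNode (opA m₂ l) (opS E) (opPi γ E) := by
  have hk := isVolterra_gramKernel_of_continuousOn hγ
  have hskew : (-Complex.I) • kernelOp hk - star ((-Complex.I) • kernelOp hk)
      = (-Complex.I) • (mulOp l γ ∘L ContinuousLinearMap.adjoint (mulOp l γ)) := by
    rw [← kernelOp_gramKernel_add_adjoint hk (memLp_top_of_continuousOn_Icc hγ), star_smul,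
      ContinuousLinearMap.star_eq_adjoint, star_neg, RCLike.star_def, Complex.conj_I]
    module
  have hnode := mul_mul_star_sub_of_mul_eq (hE.opA_mul_symm hk)
  rw [hskew, mul_smul_comm, smul_mul_assoc] at hnode
  rw [IsSNode, hE.opPi_eq, ContinuousLinearMap.adjoint_comp]
  exact hnode

lemma exists_unit_compress (hE : IsSimilarityOperator l γ E) (hr : r ≤ l) :
    ∃ U : (L2 m₂ r →L[ℂ] L2 m₂ r)ˣ, ↑U = compress r (E.symm : L2 m₂ l →L[ℂ] L2 m₂ l) ∧
      ↑U⁻¹ = compress r (E : L2 m₂ l →L[ℂ] L2 m₂ l) :=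
  ⟨⟨_, _, compress_mul_eq_one hE.isCausal_symm hr E.coe_symm_comp_coe,
    compress_mul_eq_one hE.isCausal hr E.coe_comp_coe_symm⟩, rfl, rfl⟩

lemma compress_opS (hE : IsSimilarityOperator l γ E) (hr : r ≤ l) :
    compress r (opS E) = compress r (E.symm : L2 m₂ l →L[ℂ] L2 m₂ l)
      * star (compress r (E.symm : L2 m₂ l →L[ℂ] L2 m₂ l)) := by
  rw [opS, compress_comp hE.isCausal_symm hr, compress_adjoint]
  rfl

theorem isUnit_compress_opS (hE : IsSimilarityOperator l γ E) (hr : r ≤ l) :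
    IsUnit (compress r (opS E)) := by
  obtain ⟨U, hU, -⟩ := hE.exists_unit_compress hr
  rw [hE.compress_opS hr, ← hU]
  exact isUnit_mul_star U

lemma ring_inverse_compress_opS (hE : IsSimilarityOperator l γ E) (hr : r ≤ l) :
    Ring.inverse (compress r (opS E))
      = ContinuousLinearMap.adjoint (compress r (E : L2 m₂ l →L[ℂ] L2 m₂ l))
        ∘L compress r (E : L2 m₂ l →L[ℂ] L2 m₂ l) := by
  obtain ⟨U, hU, hUinv⟩ := hE.exists_unit_compress hr
  rw [hE.compress_opS hr, ← hU, ring_inverse_mul_star, hUinv]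
  rfl

lemma compress_comp_opP_comp_opPi (hE : IsSimilarityOperator l γ E) (hr : r ≤ l)
    (hγ : MemLp γ ∞ (vol l)) :
    compress r (E : L2 m₂ l →L[ℂ] L2 m₂ l) ∘L opP m₂ l r ∘L opPi γ E = mulOp r γ := by
  rw [← ContinuousLinearMap.comp_assoc, ← hE.isCausal.opP_comp hr, hE.opPi_eq,
    ContinuousLinearMap.comp_assoc, ← ContinuousLinearMap.comp_assoc _ _ (mulOp l γ),
    E.coe_comp_coe_symm, ContinuousLinearMap.id_comp, opP_comp_mulOp hr hγ]

end IsSimilarityOperator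

lemma ring_inverse_comp_opP_comp_sub {H : Type*} [NormedAddCommGroup H] [NormedSpace ℂ H] {n : ℕ}
    (hr : r ≤ l) (z : ℂ) (X : H →L[ℂ] L2 n l) :
    Ring.inverse (1 - z • compress r (opA n l)) ∘L opP n l r ∘L (X - z • (opA n l ∘L X))
      = opP n l r ∘L X := by
  have hcausal : opP n l r ∘L (X - z • (opA n l ∘L X))
      = (1 - z • compress r (opA n l)) ∘L (opP n l r ∘L X) := by
    rw [ContinuousLinearMap.comp_sub, ContinuousLinearMap.comp_smul,
      ← ContinuousLinearMap.comp_assoc, (isCausal_opA n l).opP_comp hr,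
      ContinuousLinearMap.comp_assoc, ContinuousLinearMap.sub_comp, ContinuousLinearMap.smul_comp,
      ContinuousLinearMap.one_def, ContinuousLinearMap.id_comp]
  rw [hcausal, ← ContinuousLinearMap.comp_assoc, ← ContinuousLinearMap.mul_def,
    Ring.inverse_mul_cancel _ (isUnit_one_sub_smul_compress_opA n hr z),
    ContinuousLinearMap.one_def, ContinuousLinearMap.id_comp]

namespace IsSimilarityOperator

lemma ring_inverse_comp_opP_comp_opPi (hE : IsSimilarityOperator l γ E) (hr : r ≤ l)
    (hk : IsVolterra l (gramKernel l γ)) {η : ℝ → Matrix (Fin m₂) (Fin m₁ ⊕ Fin m₂) ℂ}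
    (hη : MemLp η ∞ (vol l)) {z : ℂ}
    (h : mulOp l η + (Complex.I * z) • (kernelOp hk ∘L mulOp l η) = mulOp l γ) :
    Ring.inverse (1 - z • compress r (opA m₂ l)) ∘L opP m₂ l r ∘L opPi γ E
      = compress r (E.symm : L2 m₂ l →L[ℂ] L2 m₂ l) ∘L mulOp r η := by
  have hPi : opPi γ E = (E.symm : L2 m₂ l →L[ℂ] L2 m₂ l) ∘L mulOp l η
      - z • (opA m₂ l ∘L (E.symm : L2 m₂ l →L[ℂ] L2 m₂ l) ∘L mulOp l η) := by
    rw [hE.opPi_eq, ← h, ← ContinuousLinearMap.comp_assoc (opA m₂ l), ← ContinuousLinearMap.mul_def,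
      hE.opA_mul_symm hk, ContinuousLinearMap.mul_def, ContinuousLinearMap.comp_assoc,
      ContinuousLinearMap.smul_comp, ContinuousLinearMap.comp_add, ContinuousLinearMap.comp_smul,
      ContinuousLinearMap.comp_smul]
    module
  rw [hPi, ring_inverse_comp_opP_comp_sub hr z, ← ContinuousLinearMap.comp_assoc,
    hE.isCausal_symm.opP_comp hr, ContinuousLinearMap.comp_assoc, opP_comp_mulOp hr hη]

lemma transfer_eq (hE : IsSimilarityOperator l γ E) (hr : r ∈ Icc 0 l)
    (hk : IsVolterra l (gramKernel l γ)) (hγ : MemLp γ ∞ (vol l))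
    {η : ℝ → Matrix (Fin m₂) (Fin m₁ ⊕ Fin m₂) ℂ} (hη : MemLp η ∞ (vol l)) {z : ℂ}
    (h : mulOp l η + (Complex.I * z) • (kernelOp hk ∘L mulOp l η) = mulOp l γ) :
    transfer (opA m₂ l) (opS E) (opPi γ E) r z
      = 1 - (Complex.I * z) • ∫ t in (0 : ℝ)..r, (γ t)ᴴ * η t := by
  have hvol : vol r ≤ vol l := Measure.restrict_mono (Ioo_subset_Ioo_right hr.2) le_rfl
  have hinv := compress_mul_eq_one hE.isCausal hr.2 E.coe_comp_coe_symm
  rw [transfer, ← toEuclideanCLM_symm_adjoint_mulOp_comp hr.1 (hγ.mono_measure hvol)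
      (hη.mono_measure hvol), hE.ring_inverse_comp_opP_comp_opPi hr.2 hk hη h,
    hE.ring_inverse_compress_opS hr.2, ← hE.compress_comp_opP_comp_opPi hr.2 hγ,
    adjoint_comp_adjoint_comp_adjoint_comp_self hinv]

theorem transfer_eq_of_isFundamentalSolution (hE : IsSimilarityOperator l γ E) (hr : r ∈ Icc 0 l)
    (hγ : ContinuousOn γ (Icc 0 l)) {W : ℝ → Matrix (Fin m₁ ⊕ Fin m₂) (Fin m₁ ⊕ Fin m₂) ℂ} {z : ℂ}
    (hW : IsFundamentalSolution l (fun x => (-(Complex.I * z)) • ((γ x)ᴴ * γ x)) W) :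
    transfer (opA m₂ l) (opS E) (opPi γ E) r z = W r := by
  have hl : 0 ≤ l := hr.1.trans hr.2
  have hγb := memLp_top_of_continuousOn_Icc hγ
  have hWb := hW.hasACDeriv.memLp_top hl
  have hηb := memLp_top_matrix_mul hγb hWb
  have hcη : MemLp (fun x => (Complex.I * z) • (γ x * W x)) ∞ (vol l) :=
    hηb.const_smul (Complex.I * z)
  have hγη : MemLp (fun x => γ x - γ x * W x) ∞ (vol l) := hγb.sub hηb
  have hk := isVolterra_gramKernel_of_continuousOn hγ
  have hresolvent : (Complex.I * z) • (kernelOp hk ∘L mulOp l fun x => γ x * W x)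
      = mulOp l fun x => γ x - γ x * W x := by
    rw [← ContinuousLinearMap.comp_smul, ← mulOp_const_smul _ hηb,
      kernelOp_gramKernel_comp_mulOp hk hγb hcη]
    refine mulOp_congr ?_
    filter_upwards [ae_restrict_mem measurableSet_Ioo] with x hx
    simp only [Matrix.mul_smul, intervalIntegral.integral_smul]
    rw [← Matrix.mul_smul, ← sub_sub_cancel 1 ((Complex.I * z) • _),
      ← hW.eq_one_sub_smul_integral hγb (Ioo_subset_Icc_self hx), Matrix.mul_sub,
      Matrix.mul_one]
  refine (hE.transfer_eq hr hk hγb hηb ?_).trans (hW.eq_one_sub_smul_integral hγb hr).symm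
  rw [hresolvent, ← mulOp_add hηb hγη]
  simp only [add_sub_cancel]

end IsSimilarityOperator

end Transfer

/-! ### Boundedly differentiable functions -/

section BoundedDeriv

variable {n : ℕ} {l : ℝ}

lemma memLp_top_coe_add {f g : L2 n l} (hf : MemLp f ∞ (vol l)) (hg : MemLp g ∞ (vol l)) :
    MemLp ((f + g : L2 n l) : ℝ → EuclideanSpace ℂ (Fin n)) ∞ (vol l) :=
  (hf.add hg).ae_eq (Lp.coeFn_add f g).symm

lemma memLp_top_coe_sub {f g : L2 n l} (hf : MemLp f ∞ (vol l)) (hg : MemLp g ∞ (vol l)) :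
    MemLp ((f - g : L2 n l) : ℝ → EuclideanSpace ℂ (Fin n)) ∞ (vol l) :=
  (hf.sub hg).ae_eq (Lp.coeFn_sub f g).symm

lemma memLp_top_kernelOp {k : ℝ → ℝ → Matrix (Fin n) (Fin n) ℂ} (hk : IsVolterra l k)
    (f : L2 n l) : MemLp (kernelOp hk f) ∞ (vol l) := by
  obtain ⟨C, -, hkC⟩ := hk.bounded
  refine memLp_top_of_bound (Lp.aestronglyMeasurable _) (C * ∫ t, ‖f t‖ ∂(vol l)) ?_
  filter_upwards [coeFn_kernelOp hk f] with x hx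
  rw [hx]
  exact norm_kernelIntegral_le hkC (integrable_coe f) x

lemma toL2_coe (f : L2 n l) : toL2 l f = f :=
  (eq_toL2_of_ae_eq .rfl).symm

lemma toL2_const_add_integral {g : ℝ → EuclideanSpace ℂ (Fin n)} (hg : MemLp g 2 (vol l))
    (c : EuclideanSpace ℂ (Fin n)) :
    toL2 l (fun x => c + ∫ t in (0 : ℝ)..x, g t) = toL2 l (fun _ => c) + opJ n l (toL2 l g) := by
  have hint : MemLp (fun x => ∫ t in (0 : ℝ)..x, g t) 2 (vol l) := by
    refine (isVolterra_intKernel.memLp_kernelIntegral (hg.integrable (by norm_num))).ae_eq ?_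
    filter_upwards [ae_restrict_mem measurableSet_Ioo] with x hx using kernelIntegral_intKernel g hx
  rw [opJ_toL2 hg]
  exact toL2_add (memLp_const c) hint

lemma MemB1.memLp_top_deriv {f : ℝ → EuclideanSpace ℂ (Fin n)} (hf : MemB1 l f) :
    MemLp (deriv f) ∞ (vol l) := by
  obtain ⟨-, C, hC⟩ := hf
  exact memLp_top_of_bound (stronglyMeasurable_deriv f).aestronglyMeasurable C hC

lemma MemB1.eq_add_integral {f : ℝ → EuclideanSpace ℂ (Fin n)} (hf : MemB1 l f) {x : ℝ}
    (hx : x ∈ Icc 0 l) : f x = f 0 + ∫ t in (0 : ℝ)..x, deriv f t := by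
  have hl : 0 ≤ l := hx.1.trans hx.2
  have hsub : uIcc 0 x ⊆ uIcc 0 l := by
    rw [uIcc_of_le hl]
    exact uIcc_subset_Icc (left_mem_Icc.mpr hl) hx
  rw [integral_eq_sub_of_ae_hasDerivAt (hf.1.mono hsub), add_sub_cancel]
  · filter_upwards [(hf.1.mono hsub).boundedVariationOn.ae_differentiableAt_of_mem_uIcc]
      with t ht htx using (ht htx).hasDerivAt
  · exact intervalIntegrable_of_integrable_vol (hf.memLp_top_deriv.integrable le_top)
      (left_mem_Icc.mpr hl) hx

lemma memB1_const_add_integral (hl : 0 ≤ l) {g : ℝ → EuclideanSpace ℂ (Fin n)}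
    (hg : MemLp g ∞ (vol l)) (c : EuclideanSpace ℂ (Fin n)) :
    MemB1 l (fun x => c + ∫ t in (0 : ℝ)..x, g t) := by
  have hgI : IntervalIntegrable g volume 0 l :=
    intervalIntegrable_of_integrable_vol (hg.integrable le_top) (left_mem_Icc.mpr hl)
      (right_mem_Icc.mpr hl)
  refine ⟨(absolutelyContinuousOnInterval_const c 0 l).fun_add
    (absolutelyContinuousOnInterval_integral hgI), (eLpNorm g ∞ (vol l)).toReal, ?_⟩
  filter_upwards [ae_restrict_of_ae hgI.ae_hasDerivAt_integral, ae_restrict_mem measurableSet_Ioo,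
    ae_le_eLpNormEssSup (f := g) (μ := vol l)] with x hderiv hx hbound
  rw [uIcc_of_le hl] at hderiv
  rw [((hderiv (Ioo_subset_Icc_self hx) 0 (left_mem_Icc.mpr hl)).const_add c).deriv,
    ← toReal_enorm, eLpNorm_exponent_top]
  exact ENNReal.toReal_mono (eLpNorm_exponent_top (f := g) ▸ hg.2.ne) hbound

theorem exists_memB1_eq_toL2_iff (hl : 0 ≤ l) {h : L2 n l} :
    (∃ f, MemB1 l f ∧ h = toL2 l f) ↔
      ∃ (c : EuclideanSpace ℂ (Fin n)) (g : L2 n l), MemLp g ∞ (vol l) ∧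
        h = toL2 l (fun _ => c) + opJ n l g := by
  constructor
  · rintro ⟨f, hf, rfl⟩
    have hderiv : MemLp (deriv f) 2 (vol l) := hf.memLp_top_deriv.mono_exponent le_top
    refine ⟨f 0, toL2 l (deriv f), hf.memLp_top_deriv.ae_eq (coeFn_toL2 hderiv).symm, ?_⟩
    rw [← toL2_const_add_integral hderiv]
    refine toL2_congr ?_
    filter_upwards [ae_restrict_mem measurableSet_Ioo] with x hx
      using hf.eq_add_integral (Ioo_subset_Icc_self hx)
  · rintro ⟨c, g, hg, rfl⟩
    refine ⟨_, memB1_const_add_integral hl hg c, ?_⟩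
    rw [toL2_const_add_integral (Lp.memLp g), toL2_coe]

end BoundedDeriv

/-! ### Transmutation operators -/

lemma one_add_mul_mul_one_add_mul_of_neg_mul {R : Type*} [Ring R] {J Q D : R}
    (h : -D * J = J * -D + J * (Q * (1 + D) * J)) :
    (1 + J * Q) * ((1 + D) * J) = J * (1 + D) := by
  linear_combination (norm := noncomm_ring) -h

section Transmutation

variable {n : ℕ} {l : ℝ} {q d : ℝ → ℝ → Matrix (Fin n) (Fin n) ℂ}

lemma injective_one_add_opJ_comp_kernelOp (hq : IsVolterra l q) :
    Function.Injective (1 + opJ n l ∘L kernelOp hq : L2 n l →L[ℂ] L2 n l) := by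
  rw [opJ, kernelOp_comp]
  obtain ⟨e, he, -, hinv⟩ := exists_inverse_one_add_kernelOp (isVolterra_intKernel.comp hq)
  exact Function.LeftInverse.injective (g := (1 + kernelOp he : L2 n l →L[ℂ] L2 n l)) fun f =>
    congrArg (fun T => T f) hinv

/-- `E = I + D` with a Volterra operator `D` transmutes `(I + J Q)⁻¹ J` into `J`, where `J` is the
operator of integration and `Q` has the kernel `q`, and maps the constants `c` to `(I + J Q)⁻¹ c`.
Both relations are multiplied by `I + J Q`, so that no inverse occurs in them. -/
structure IsTransmutation (hq : IsVolterra l q) (E : L2 n l ≃L[ℂ] L2 n l) : Prop where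
  exists_eq_one_add : ∃ (d : ℝ → ℝ → Matrix (Fin n) (Fin n) ℂ) (hd : IsVolterra l d),
    (E : L2 n l →L[ℂ] L2 n l) = 1 + kernelOp hd
  exists_symm_eq_one_add : ∃ (d : ℝ → ℝ → Matrix (Fin n) (Fin n) ℂ) (hd : IsVolterra l d),
    (E.symm : L2 n l →L[ℂ] L2 n l) = 1 + kernelOp hd
  map_const : ∀ c, (1 + opJ n l ∘L kernelOp hq) (E (toL2 l fun _ => c)) = toL2 l fun _ => c
  map_opJ : ∀ f, (1 + opJ n l ∘L kernelOp hq) (E (opJ n l f)) = opJ n l (E f)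

section Kernel

variable (hq : IsVolterra l q) (hd : IsVolterra l d)

lemma kernelOp_add_kernelComp :
    kernelOp (hq.add (hq.comp hd)) = kernelOp hq ∘L (1 + kernelOp hd) := by
  rw [kernelOp_add hq (hq.comp hd), ← kernelOp_comp hq hd, ContinuousLinearMap.comp_add]
  rfl

variable (h : d + diagonalIntegral l (q + kernelComp q d) = 0)

include h

lemma kernelOp_diagonal_eq_neg : kernelOp (hq.add (hq.comp hd)).diagonal = -kernelOp hd := by
  refine eq_neg_of_add_eq_zero_right ?_
  rw [← kernelOp_add, kernelOp_congr _ IsVolterra.zero h, kernelOp_zero]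

lemma one_add_opJ_comp_kernelOp_apply_const (c : EuclideanSpace ℂ (Fin n)) :
    (1 + opJ n l ∘L kernelOp hq) ((1 + kernelOp hd) (toL2 l fun _ => c)) = toL2 l fun _ => c := by
  have hc := kernelOp_diagonal_const (hq.add (hq.comp hd)) c
  rw [kernelOp_diagonal_eq_neg hq hd h, kernelOp_add_kernelComp hq hd] at hc
  rw [_root_.add_apply, one_apply_eq_self, ContinuousLinearMap.comp_apply,
    ← ContinuousLinearMap.comp_apply (kernelOp hq), ← hc, _root_.add_apply, one_apply_eq_self,
    _root_.neg_apply, add_neg_cancel_right]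

lemma one_add_opJ_comp_kernelOp_apply_opJ (f : L2 n l) :
    (1 + opJ n l ∘L kernelOp hq) ((1 + kernelOp hd) (opJ n l f))
      = opJ n l ((1 + kernelOp hd) f) := by
  have hJ := kernelOp_diagonal_comp_opJ (hq.add (hq.comp hd))
  rw [kernelOp_diagonal_eq_neg hq hd h, kernelOp_add_kernelComp hq hd] at hJ
  exact congrArg (fun T => T f) (one_add_mul_mul_one_add_mul_of_neg_mul hJ)

end Kernel

lemma exists_isTransmutation (hq : IsVolterra l q) :
    ∃ E : L2 n l ≃L[ℂ] L2 n l, IsTransmutation hq E := by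
  obtain ⟨d, hd, h⟩ := hq.exists_transmutation
  obtain ⟨e, he, hleft, hright⟩ := exists_inverse_one_add_kernelOp hd
  exact ⟨.equivOfInverse (1 + kernelOp hd) (1 + kernelOp he)
    (fun f => congrArg (fun T => T f) hright) (fun f => congrArg (fun T => T f) hleft),
    ⟨d, hd, rfl⟩, ⟨e, he, rfl⟩, one_add_opJ_comp_kernelOp_apply_const hq hd h,
    one_add_opJ_comp_kernelOp_apply_opJ hq hd h⟩

namespace IsTransmutation

variable {hq : IsVolterra l q} {E : L2 n l ≃L[ℂ] L2 n l}

lemma eq_apply_const (hE : IsTransmutation hq E) {f : L2 n l} {c : EuclideanSpace ℂ (Fin n)}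
    (hf : (1 + opJ n l ∘L kernelOp hq) f = toL2 l fun _ => c) : E (toL2 l fun _ => c) = f :=
  injective_one_add_opJ_comp_kernelOp hq ((hE.map_const c).trans hf.symm)

lemma comp_opJ_comp_symm (hE : IsTransmutation hq E) {Y : L2 n l →L[ℂ] L2 n l}
    (hY : (1 + opJ n l ∘L kernelOp hq) ∘L Y = opJ n l) :
    (E : L2 n l →L[ℂ] L2 n l) ∘L opJ n l ∘L (E.symm : L2 n l →L[ℂ] L2 n l) = Y := by
  ext1 f
  refine injective_one_add_opJ_comp_kernelOp hq ((hE.map_opJ (E.symm f)).trans ?_)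
  rw [E.apply_symm_apply]
  exact (congrArg (fun T => T f) hY).symm

lemma memLp_top (hE : IsTransmutation hq E) {f : L2 n l} (hf : MemLp f ∞ (vol l)) :
    MemLp (E f) ∞ (vol l) := by
  obtain ⟨d, hd, hEd⟩ := hE.exists_eq_one_add
  rw [← ContinuousLinearEquiv.coe_coe E, hEd]
  exact memLp_top_coe_add hf (memLp_top_kernelOp hd f)

lemma symm_memLp_top (hE : IsTransmutation hq E) {f : L2 n l} (hf : MemLp f ∞ (vol l)) :
    MemLp (E.symm f) ∞ (vol l) := by
  obtain ⟨d, hd, hEd⟩ := hE.exists_symm_eq_one_add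
  rw [← ContinuousLinearEquiv.coe_coe E.symm, hEd]
  exact memLp_top_coe_add hf (memLp_top_kernelOp hd f)

lemma map_const_add_opJ (hE : IsTransmutation hq E) (c : EuclideanSpace ℂ (Fin n)) (g : L2 n l) :
    (1 + opJ n l ∘L kernelOp hq) (E (toL2 l (fun _ => c) + opJ n l g))
      = toL2 l (fun _ => c) + opJ n l (E g) := by
  rw [map_add, map_add, hE.map_const, hE.map_opJ]

lemma apply_const_add_opJ (hE : IsTransmutation hq E) (c : EuclideanSpace ℂ (Fin n))
    (g : L2 n l) : E (toL2 l (fun _ => c) + opJ n l g)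
      = toL2 l (fun _ => c)
        + opJ n l (E g - kernelOp hq (E (toL2 l (fun _ => c) + opJ n l g))) := by
  rw [map_sub (opJ n l), ← add_sub_assoc, ← hE.map_const_add_opJ, eq_sub_iff_add_eq]
  rfl

lemma symm_apply_const_add_opJ (hE : IsTransmutation hq E) (c : EuclideanSpace ℂ (Fin n))
    (g : L2 n l) : E.symm (toL2 l (fun _ => c) + opJ n l g)
      = toL2 l (fun _ => c)
        + opJ n l (E.symm (g + kernelOp hq (toL2 l (fun _ => c) + opJ n l g))) := by
  rw [E.symm_apply_eq]
  refine injective_one_add_opJ_comp_kernelOp hq ?_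
  rw [hE.map_const_add_opJ, E.apply_symm_apply, map_add (opJ n l) g, ← add_assoc]
  rfl

lemma map_B1 (hE : IsTransmutation hq E) (hl : 0 ≤ l) {f : ℝ → EuclideanSpace ℂ (Fin n)}
    (hf : MemB1 l f) : ∃ g, MemB1 l g ∧ E (toL2 l f) = toL2 l g := by
  obtain ⟨c, g, hg, hfg⟩ := (exists_memB1_eq_toL2_iff hl).mp ⟨f, hf, rfl⟩
  rw [exists_memB1_eq_toL2_iff hl, hfg]
  exact ⟨c, _, memLp_top_coe_sub (hE.memLp_top hg) (memLp_top_kernelOp hq _),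
    hE.apply_const_add_opJ c g⟩

lemma symm_map_B1 (hE : IsTransmutation hq E) (hl : 0 ≤ l) {f : ℝ → EuclideanSpace ℂ (Fin n)}
    (hf : MemB1 l f) : ∃ g, MemB1 l g ∧ E.symm (toL2 l f) = toL2 l g := by
  obtain ⟨c, g, hg, hfg⟩ := (exists_memB1_eq_toL2_iff hl).mp ⟨f, hf, rfl⟩
  rw [exists_memB1_eq_toL2_iff hl, hfg]
  exact ⟨c, _, hE.symm_memLp_top (memLp_top_coe_add hg (memLp_top_kernelOp hq _)),
    hE.symm_apply_const_add_opJ c g⟩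

end IsTransmutation

end Transmutation

/-! ### Existence of the similarity operator -/

lemma kernelComp_eq_intervalIntegral {𝔸 : Type*} [NormedRing 𝔸] [NormedSpace ℝ 𝔸] {l : ℝ}
    {k d : ℝ → ℝ → 𝔸} (hk : IsVolterra l k) (hd : IsVolterra l d) {x s : ℝ} (hsx : s ≤ x) :
    kernelComp k d x s = ∫ t in s..x, k x t * d t s := by
  rw [kernelComp, ← setIntegral_univ]
  refine setIntegral_eq_intervalIntegral MeasurableSet.univ hsx (subset_univ _) fun t ht => ?_
  by_cases hst : s < t
  · rw [hk.eq_zero x t fun h => ht ⟨hst, h.2.1⟩, zero_mul]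
  · rw [hd.eq_zero t s fun h => hst h.2.1, mul_zero]

lemma kernelComp_gramKernel_gramKernel {n p q : Type*} [Fintype n] [DecidableEq n] [Fintype p]
    [DecidableEq p] [Fintype q] [DecidableEq q] {l : ℝ} {η : ℝ → Matrix n p ℂ}
    {θ : ℝ → Matrix n q ℂ}
    (hη : MemLp η ∞ (vol l)) (hθ : MemLp θ ∞ (vol l)) (hkη : IsVolterra l (gramKernel l η))
    (hkθ : IsVolterra l (gramKernel l θ)) {x s : ℝ} (hs : 0 < s) (hsx : s < x) (hxl : x < l) :
    kernelComp (gramKernel l η) (gramKernel l θ) x s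
      = η x * ∫ t in s..x, (η t)ᴴ * (θ t * (θ s)ᴴ) := by
  have hint : IntervalIntegrable (fun t => (η t)ᴴ * (θ t * (θ s)ᴴ)) volume s x :=
    intervalIntegrable_of_integrable_vol ((memLp_top_matrix_mul (memLp_conjTranspose hη)
      (memLp_top_matrix_mul hθ (memLp_const (θ s)ᴴ))).integrable le_top)
      ⟨hs.le, (hsx.trans hxl).le⟩ ⟨(hs.trans hsx).le, hxl.le⟩
  rw [kernelComp_eq_intervalIntegral hkη hkθ hsx.le, ← intervalIntegral_matrix_mul _ hint]
  refine intervalIntegral.integral_congr_Ioo_of_le hsx.le fun t ht => ?_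
  simp only [gramKernel_of_lt (hs.trans ht.1) ht.2 hxl, gramKernel_of_lt hs ht.1 (ht.2.trans hxl),
    Matrix.mul_assoc]

lemma opJ_comp_mulOp {n : ℕ} {p : Type*} [Fintype p] [DecidableEq p] {l : ℝ}
    {η : ℝ → Matrix (Fin n) p ℂ} (hη : MemLp η ∞ (vol l)) :
    opJ n l ∘L mulOp l η = mulOp l fun x => ∫ t in (0 : ℝ)..x, η t := by
  rw [opJ, kernelOp_comp_mulOp isVolterra_intKernel hη]
  refine mulOp_congr ?_
  filter_upwards [ae_restrict_mem measurableSet_Ioo] with x hx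
  refine intervalIntegral.integral_congr_Ioo_of_le hx.1.le fun t ht => ?_
  simp only [intKernel, ht.1, ht.2, hx.2, and_self, if_true, Matrix.one_mul]

lemma exists_stronglyMeasurable_modification {m n : Type*} [Fintype m] [Fintype n] [DecidableEq n]
    {l : ℝ} {v : ℝ → Matrix m n ℂ} (hv : ∀ i j, AEMeasurable (fun x => v x i j) (vol l))
    (hb : ∃ M : ℝ, ∀ x ∈ Ioo 0 l, ‖v x‖ ≤ M) :
    ∃ w : ℝ → Matrix m n ℂ,
      StronglyMeasurable w ∧ (∃ M : ℝ, ∀ x, ‖w x‖ ≤ M) ∧ v =ᵐ[vol l] w := by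
  classical
  obtain ⟨M, hM⟩ := hb
  let w : ℝ → Matrix m n ℂ := fun x => Matrix.of fun i j => (hv i j).mk _ x
  have hw : StronglyMeasurable w := by
    have hsum : w = fun x => ∑ i, ∑ j, (hv i j).mk _ x • Matrix.single i j (1 : ℂ) := by
      ext1 x
      conv_lhs => rw [matrix_eq_sum_single (w x)]
      simp only [smul_single, smul_eq_mul, mul_one]
      rfl
    rw [hsum]
    exact Finset.stronglyMeasurable_fun_sum _ fun i _ => Finset.stronglyMeasurable_fun_sum _
      fun j _ => (hv i j).measurable_mk.stronglyMeasurable.smul_const _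
  refine ⟨fun x => if ‖w x‖ ≤ M then w x else 0, ?_, ⟨max M 0, fun x => ?_⟩, ?_⟩
  · exact StronglyMeasurable.ite (measurableSet_le hw.norm.measurable measurable_const) hw
      stronglyMeasurable_const
  · dsimp only
    split_ifs with h
    · exact h.trans (le_max_left _ _)
    · rw [norm_zero]
      exact le_max_right _ _
  · have hmk : ∀ᵐ x ∂(vol l), ∀ i j, v x i j = w x i j :=
      ae_all_iff.mpr fun i => ae_all_iff.mpr fun j => (hv i j).ae_eq_mk
    filter_upwards [hmk, ae_restrict_mem measurableSet_Ioo] with x hx hxl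
    have hvw : v x = w x := by
      ext i j
      exact hx i j
    rw [if_pos (hvw ▸ hM x hxl), hvw]

section DiracPair

namespace IsDiracPair

variable {m n p : Type*} [Fintype m] [Fintype n] [Fintype p] [DecidableEq n] {l : ℝ}
  {v w : ℝ → Matrix m n ℂ} {θ : ℝ → Matrix m p ℂ} {γ : ℝ → Matrix n p ℂ}

lemma congr (h : IsDiracPair l v θ γ) (hvw : v =ᵐ[vol l] w) : IsDiracPair l w θ γ where
  hasACDeriv_top := h.hasACDeriv_top.congr_deriv (hvw.mono fun x hx => by simp only [hx])
  hasACDeriv_bot := h.hasACDeriv_bot.congr_deriv (hvw.mono fun x hx => by simp only [hx])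
  bot_mul_conjTranspose_bot := h.bot_mul_conjTranspose_bot
  top_mul_conjTranspose_bot := h.top_mul_conjTranspose_bot

lemma isSolution_one (h : IsDiracPair l v θ γ) :
    IsSolution l (fun x => Complex.I • (mderiv γ x * ((-Complex.I) • (γ x)ᴴ)))
      (fun _ => (1 : Matrix n n ℂ)) := by
  refine ⟨(hasACDeriv_const l 1).ac, ?_⟩
  filter_upwards [h.hasACDeriv_bot.deriv, ae_restrict_mem measurableSet_Ioo] with x hγ hx i j
  have hmderiv : mderiv γ x = -((v x)ᴴ * θ x) := by
    ext i j
    exact (hγ i j).deriv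
  have hcoeff : mderiv γ x * (γ x)ᴴ = 0 := by
    rw [hmderiv, Matrix.neg_mul, Matrix.mul_assoc,
      h.top_mul_conjTranspose_bot x (Ioo_subset_Icc_self hx), Matrix.mul_zero, neg_zero]
  simpa [hcoeff] using hasDerivAt_const x ((1 : Matrix n n ℂ) i j)

lemma gramKernel_add_kernelComp (h : IsDiracPair l v θ γ)
    (hv : MemLp v ∞ (vol l)) (hq : IsVolterra l (gramKernel l fun x => (v x)ᴴ))
    (hg : IsVolterra l (gramKernel l γ)) :
    gramKernel l γ + kernelComp (intKernel l)
      (kernelComp (gramKernel l fun x => (v x)ᴴ) (gramKernel l γ)) = intKernel l := by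
  classical
  have hJ : IsVolterra l (intKernel l : ℝ → ℝ → Matrix n n ℂ) := isVolterra_intKernel
  ext1 x
  ext1 s
  by_cases hmem : 0 < s ∧ s < x ∧ x < l
  swap
  · rw [(hg.add (hJ.comp (hq.comp hg))).eq_zero x s hmem, hJ.eq_zero x s hmem]
  obtain ⟨hs, hsx, hxl⟩ := hmem
  have hsl : s ∈ Icc 0 l := ⟨hs.le, (hsx.trans hxl).le⟩
  have hγ := h.hasACDeriv_bot.memLp_top (hsl.1.trans hsl.2)
  have hqg : ∀ y ∈ Ioo s x, kernelComp (gramKernel l fun x => (v x)ᴴ) (gramKernel l γ) y s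
      = (v y)ᴴ * (θ y * (γ s)ᴴ) := by
    intro y hy
    rw [kernelComp_gramKernel_gramKernel (memLp_conjTranspose hv) hγ hq hg hs hy.1
      (hy.2.trans hxl)]
    simp only [conjTranspose_conjTranspose]
    rw [h.integral_mul_bot hv hsl ⟨(hs.trans hy.1).le, (hy.2.trans hxl).le⟩]
  have hJqg : kernelComp (intKernel l)
      (kernelComp (gramKernel l fun x => (v x)ᴴ) (gramKernel l γ)) x s = 1 - γ x * (γ s)ᴴ := by
    rw [kernelComp_eq_intervalIntegral hJ (hq.comp hg) hsx.le,
      ← h.integral_conjTranspose_mul_top hv hsl ⟨(hs.trans hsx).le, hxl.le⟩]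
    refine intervalIntegral.integral_congr_Ioo_of_le hsx.le fun y hy => ?_
    simp only [hqg y hy, intKernel, hs.trans hy.1, hy.2, hxl, and_self, if_true, one_mul]
  rw [Pi.add_apply, Pi.add_apply, hJqg, gramKernel_of_lt hs hsx hxl, add_sub_cancel, intKernel,
    if_pos ⟨hs, hsx, hxl⟩]

end IsDiracPair

end DiracPair

lemma mul_conjTranspose_botProj {k m₁ m₂ : ℕ} (A : Matrix (Fin k) (Fin m₁ ⊕ Fin m₂) ℂ) :
    A * (botProj m₁ m₂)ᴴ = A.toCols₂ := by
  rw [botProj, conjTranspose_fromCols_eq_fromRows_conjTranspose]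
  conv_lhs => rw [← fromCols_toCols A]
  rw [fromCols_mul_fromRows, conjTranspose_zero, conjTranspose_one, Matrix.mul_zero, zero_add,
    Matrix.mul_one]

lemma IsVolterra.isBoundedKernel {n : ℕ} {l : ℝ} {k : ℝ → ℝ → Matrix (Fin n) (Fin n) ℂ}
    (hk : IsVolterra l k) : IsBoundedKernel l k := by
  obtain ⟨C, -, hC⟩ := hk.bounded
  exact ⟨fun i j =>
    ((entryCLM i j).continuous.comp_stronglyMeasurable hk.stronglyMeasurable).measurable,
    C, fun x t _ _ _ => hC x t⟩

section DiracOperator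

namespace IsDiracPair

variable {m p : Type*} [Fintype m] [Fintype p] {n : ℕ} {l : ℝ}
  {v : ℝ → Matrix m (Fin n) ℂ} {θ : ℝ → Matrix m p ℂ} {γ : ℝ → Matrix (Fin n) p ℂ}

lemma one_add_opJ_comp_kernelOp_comp_kernelOp (h : IsDiracPair l v θ γ) (hv : MemLp v ∞ (vol l))
    (hq : IsVolterra l (gramKernel l fun x => (v x)ᴴ)) (hg : IsVolterra l (gramKernel l γ)) :
    (1 + opJ n l ∘L kernelOp hq) ∘L kernelOp hg = opJ n l := by
  classical
  rw [ContinuousLinearMap.add_comp, ContinuousLinearMap.comp_assoc, opJ, kernelOp_comp hq hg,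
    kernelOp_comp isVolterra_intKernel (hq.comp hg), ContinuousLinearMap.one_def,
    ContinuousLinearMap.id_comp, ← kernelOp_add hg (isVolterra_intKernel.comp (hq.comp hg))]
  exact kernelOp_congr _ _ (h.gramKernel_add_kernelComp hv hq hg)

lemma one_add_opJ_comp_kernelOp_comp_mulOp (h : IsDiracPair l v θ γ) (hv : MemLp v ∞ (vol l))
    (hq : IsVolterra l (gramKernel l fun x => (v x)ᴴ)) (hl : 0 ≤ l) :
    (1 + opJ n l ∘L kernelOp hq) ∘L mulOp l (fun x => γ x * (γ 0)ᴴ) = mulOp l fun _ => 1 := by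
  classical
  have h0 : (0 : ℝ) ∈ Icc 0 l := left_mem_Icc.mpr hl
  have hγ : MemLp (fun x => γ x * (γ 0)ᴴ) ∞ (vol l) :=
    memLp_top_matrix_mul (h.hasACDeriv_bot.memLp_top hl) (memLp_const _)
  have hθ : MemLp (fun x => (v x)ᴴ * (θ x * (γ 0)ᴴ)) ∞ (vol l) :=
    memLp_top_matrix_mul (memLp_conjTranspose hv)
      (memLp_top_matrix_mul (h.hasACDeriv_top.memLp_top hl) (memLp_const _))
  have hQ : kernelOp hq ∘L mulOp l (fun x => γ x * (γ 0)ᴴ)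
      = mulOp l fun x => (v x)ᴴ * (θ x * (γ 0)ᴴ) := by
    rw [kernelOp_gramKernel_comp_mulOp hq (memLp_conjTranspose hv) hγ]
    refine mulOp_congr ?_
    filter_upwards [ae_restrict_mem measurableSet_Ioo] with x hx
    simp only [conjTranspose_conjTranspose]
    rw [h.integral_mul_bot hv h0 (Ioo_subset_Icc_self hx)]
  have hsub : MemLp (fun x => 1 - γ x * (γ 0)ᴴ) ∞ (vol l) := (memLp_const 1).sub hγ
  have hJQ : opJ n l ∘L kernelOp hq ∘L mulOp l (fun x => γ x * (γ 0)ᴴ)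
      = mulOp l fun x => 1 - γ x * (γ 0)ᴴ := by
    rw [hQ, opJ_comp_mulOp hθ]
    refine mulOp_congr ?_
    filter_upwards [ae_restrict_mem measurableSet_Ioo] with x hx
    exact h.integral_conjTranspose_mul_top hv h0 (Ioo_subset_Icc_self hx)
  rw [ContinuousLinearMap.add_comp, ContinuousLinearMap.comp_assoc, hJQ,
    ContinuousLinearMap.one_def, ContinuousLinearMap.id_comp, ← mulOp_add hγ hsub]
  simp only [add_sub_cancel]

end IsDiracPair

end DiracOperator

namespace IsTransmutation

variable {m₁ m₂ : ℕ} {l : ℝ} {v : ℝ → Matrix (Fin m₁) (Fin m₂) ℂ}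
  {θ : ℝ → Matrix (Fin m₁) (Fin m₁ ⊕ Fin m₂) ℂ} {γ : ℝ → Matrix (Fin m₂) (Fin m₁ ⊕ Fin m₂) ℂ}
  {hq : IsVolterra l (gramKernel l fun x => (v x)ᴴ)} {E : L2 m₂ l ≃L[ℂ] L2 m₂ l}

lemma symm_toCols₂ (hE : IsTransmutation hq E) (hl : 0 ≤ l) (h : IsDiracPair l v θ γ)
    (h0 : γ 0 = botProj m₁ m₂) (hv : MemLp v ∞ (vol l)) (j : Fin m₂) :
    E.symm (toL2 l (col (fun x => (γ x).toCols₂) j)) = toL2 l (col (fun _ => 1) j) := by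
  have hJQ := congrArg (fun T => T (EuclideanSpace.single j 1))
    (h.one_add_opJ_comp_kernelOp_comp_mulOp hv hq hl)
  simp only [h0, mul_conjTranspose_botProj] at hJQ
  rw [ContinuousLinearMap.comp_apply, mulOp, ofCols_single, mulOp, ofCols_single] at hJQ
  exact E.symm_apply_eq.mpr (hE.eq_apply_const hJQ).symm

theorem isSimilarityOperator (hE : IsTransmutation hq E) (hl : 0 ≤ l) (h : IsDiracPair l v θ γ)
    (h0 : γ 0 = botProj m₁ m₂) (hv : MemLp v ∞ (vol l)) : IsSimilarityOperator l γ E where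
  similar := by
    have hg := isVolterra_gramKernel_of_continuousOn (h.hasACDeriv_bot.continuousOn hl)
    have hconj : (E : L2 m₂ l →L[ℂ] L2 m₂ l) ∘L opA m₂ l ∘L (E.symm : L2 m₂ l →L[ℂ] L2 m₂ l)
        = (-Complex.I) • kernelOp hg := by
      rw [opA_eq_smul_opJ, ContinuousLinearMap.smul_comp, ContinuousLinearMap.comp_smul,
        hE.comp_opJ_comp_symm (h.one_add_opJ_comp_kernelOp_comp_kernelOp hv hq hg)]
    rw [hconj]
    exact isTriangular_smul_kernelOp_gramKernel hg _
  triangular := by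
    obtain ⟨d, hd, hEd⟩ := hE.exists_eq_one_add
    obtain ⟨e, he, hEe⟩ := hE.exists_symm_eq_one_add
    refine ⟨fun _ => 1, d, e, h.isSolution_one, by simp, hd.isBoundedKernel, ?_,
      he.isBoundedKernel, ?_⟩
    · rw [hEd]
      exact isTriangular_one_add_kernelOp hd
    · simp only [inv_one]
      rw [hEe]
      exact isTriangular_one_add_kernelOp he
  map_B1 _ := hE.map_B1 hl
  symm_map_B1 _ := hE.symm_map_B1 hl
  normalized := hE.symm_toCols₂ hl h h0 hv

end IsTransmutation

theorem IsDiracPair.exists_isSimilarityOperator {m₁ m₂ : ℕ} {l : ℝ}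
    {v : ℝ → Matrix (Fin m₁) (Fin m₂) ℂ} {θ : ℝ → Matrix (Fin m₁) (Fin m₁ ⊕ Fin m₂) ℂ}
    {γ : ℝ → Matrix (Fin m₂) (Fin m₁ ⊕ Fin m₂) ℂ} (h : IsDiracPair l v θ γ) (hl : 0 ≤ l)
    (h0 : γ 0 = botProj m₁ m₂) (hv : ∀ i j, AEMeasurable (fun x => v x i j) (vol l))
    (hb : ∃ M : ℝ, ∀ x ∈ Ioo 0 l, ‖v x‖ ≤ M) :
    ∃ E : L2 m₂ l ≃L[ℂ] L2 m₂ l, IsSimilarityOperator l γ E := by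
  obtain ⟨w, hw, ⟨M, hM⟩, hvw⟩ := exists_stronglyMeasurable_modification hv hb
  have hwL : MemLp w ∞ (vol l) :=
    MemLp.of_bound hw.aestronglyMeasurable M (.of_forall hM)
  have hq : IsVolterra l (gramKernel l fun x => (w x)ᴴ) := isVolterra_gramKernel
    ((continuous_id.matrix_conjTranspose.comp_stronglyMeasurable hw).indicator measurableSet_Ioo)
    ⟨M, fun x _ => (l2_opNorm_conjTranspose (w x)).trans_le (hM x)⟩
  obtain ⟨E, hE⟩ := exists_isTransmutation hq
  exact ⟨E, hE.isSimilarityOperator hl (h.congr hvw) h0 hwL⟩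

end SkewDirac

end

theorem mainTheorem11 (m₁ m₂ : ℕ) (l : ℝ) (hl : 0 < l)
    (v : ℝ → Matrix (Fin m₁) (Fin m₂) ℂ)
    (hv_meas : ∀ i j, AEMeasurable (fun x => v x i j) (vol l))
    (hv_bdd : ∃ M : ℝ, ∀ x ∈ Set.Ioo 0 l, ‖v x‖ ≤ M)
    (u : ℝ → ℂ → Matrix (Fin m₁ ⊕ Fin m₂) (Fin m₁ ⊕ Fin m₂) ℂ)
    (hu : ∀ z : ℂ, IsFundamentalSolution l (fun x => diracCoeff (v x) z) (fun x => u x z))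
    (γ : ℝ → Matrix (Fin m₂) (Fin m₁ ⊕ Fin m₂) ℂ)
    (hγ : ∀ x, γ x = Matrix.fromCols 0 1 * u x 0) :
    (∃ E : L2 m₂ l ≃L[ℂ] L2 m₂ l, IsSimilarityOperator l γ E) ∧
    ∀ E : L2 m₂ l ≃L[ℂ] L2 m₂ l, IsSimilarityOperator l γ E →
      IsSNode (opA m₂ l) (opS E) (opPi γ E) ∧
      (∀ r ∈ Set.Icc 0 l, IsUnit (compress r (opS E)) ∧
        ∀ z : ℂ, IsUnit (1 - z • compress r (opA m₂ l))) ∧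
      (∀ z : ℂ, IsFundamentalSolution l (fun x => (-(Complex.I * z)) • ((γ x)ᴴ * γ x))
        (fun x => transfer (opA m₂ l) (opS E) (opPi γ E) x z)) ∧
      ∀ x ∈ Set.Icc 0 l, ∀ z : ℂ,
        u x z = Complex.exp (Complex.I * x * z) •
          (u x 0 * transfer (opA m₂ l) (opS E) (opPi γ E) x (2 * z)) := by
  obtain rfl : γ = fun x => botProj m₁ m₂ * u x 0 := funext hγ
  have hdirac := isDiracPair_of_isFundamentalSolution (hu 0)
  have hγc := hdirac.hasACDeriv_bot.continuousOn hl.le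
  have hinit : botProj m₁ m₂ * u 0 0 = botProj m₁ m₂ := by rw [(hu 0).init, Matrix.mul_one]
  refine ⟨hdirac.exists_isSimilarityOperator hl.le hinit hv_meas hv_bdd, fun E hE => ?_⟩
  have htransfer : ∀ z, EqOn (canonicalSol u z) (transfer (opA m₂ l) (opS E) (opPi _ E) · z)
      (Icc 0 l) := fun z x hx =>
    (hE.transfer_eq_of_isFundamentalSolution hx hγc (isFundamentalSolution_canonicalSol hu z)).symm
  refine ⟨hE.isSNode hγc, fun r hr => ⟨hE.isUnit_compress_opS hr.2,
    isUnit_one_sub_smul_compress_opA m₂ hr.2⟩, fun z => ?_, fun x hx z => ?_⟩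
  · exact (isFundamentalSolution_canonicalSol hu z).congr hl.le (htransfer z)
  · have hux : u x 0 * (u x 0)ᴴ = 1 :=
      (hu 0).mul_conjTranspose_self (fun _ => conjTranspose_diracCoeff_zero _) hx
    exact (eq_exp_smul_mul_canonicalSol hux z).trans (by rw [htransfer (2 * z) hx])
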